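/- Let $M$ be a connected smooth manifold of dimension $n\ge 2$. Let $\alpha=\sqrt{a_{ij}(x)y^iy^j}$ be a Riemannian metric on $M$, let $\beta=b_i(x)y^i$ be a smooth $1$-form on $M$, and let $\phi$ be a $C^\infty$ function on an interval $(-b_0,b_0)$, $0<b_0\le\infty$, with $\phi(0)=1$ and $\|\beta\|_\alpha<b_0$ on $M$, such that the $(\alpha,\beta)$-metric $$F=\alpha\,\phi(s),\qquad s=\beta/\alpha,$$ is a (regular) Finsler metric, that is, $F$ is smooth and positive on $TM\setminus 0$, and its fundamental matrix $g_{ij}=\tfrac12[F^2]_{y^iy^j}$ is positive definite there. Suppose that $F$ is non-Riemannian, in the sense that $F$ is not a Riemannian metric on any nonempty open subset of $M$. Suppose also that $F$ is of isotropic S-curvature, that is, $\mathbf S=(n+1)\theta F$ for some scalar function $\theta=\theta(x)$ on $M$, where $$\mathbf S(x,y)=\frac{\partial G^m}{\partial y^m}-y^m\frac{\partial\ln\sigma}{\partial x^m},\qquad G^i=\tfrac14 g^{il}\bigl\{[F^2]_{x^ky^l}y^k-[F^2]_{x^l}\bigr\},\qquad \sigma(x)=\frac{\mathrm{Vol}(\mathbb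 B^n(1))}{\mathrm{Vol}\{y\in\mathbb R^n: F(x,y^i\partial/\partial x^i)<1\}} .$$ Then every conformal vector field of $(M,F)$ is homothetic. That is, if $V$ is a smooth vector field on $M$ with $$V_{0|0}=-2cF^2$$ for some scalar function $c=c(x)$ on $M$, then this holds with $c$ a constant. Here $V_{0|0}=V_{i|j}y^iy^j$, $V_i=g_{im}V^m$, and $|$ is the horizontal covariant derivative of the Berwald connection (the Cartan and Chern connections give the same $V_{0|0}$). -/

import Mathlib

open scoped Manifold ContDiff

noncomputable section

/-! # Finsler geometry in local coordinates

A function `f : ℝⁿ → ℝⁿ → ℝ` is the coordinate expression `f(x, y)` of a function on the tangent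
bundle of an open subset of `ℝⁿ`.  All the quantities below are the usual ones at `y ≠ 0`. -/

namespace FinslerCoord

variable {n : ℕ}

/-- The partial derivative `∂f/∂xⁱ`. -/
def pdx (f : EuclideanSpace ℝ (Fin n) → EuclideanSpace ℝ (Fin n) → ℝ) (i : Fin n) :
    EuclideanSpace ℝ (Fin n) → EuclideanSpace ℝ (Fin n) → ℝ :=
  fun x y => fderiv ℝ (fun x' => f x' y) x (EuclideanSpace.single i 1)

/-- The partial derivative `∂f/∂yⁱ`. -/
def pdy (f : EuclideanSpace ℝ (Fin n) → EuclideanSpace ℝ (Fin n) → ℝ) (i : Fin n) :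
    EuclideanSpace ℝ (Fin n) → EuclideanSpace ℝ (Fin n) → ℝ :=
  fun x y => fderiv ℝ (fun y' => f x y') y (EuclideanSpace.single i 1)

/-- The square `F²`. -/
def energy (f : EuclideanSpace ℝ (Fin n) → EuclideanSpace ℝ (Fin n) → ℝ) :
    EuclideanSpace ℝ (Fin n) → EuclideanSpace ℝ (Fin n) → ℝ :=
  fun x y => f x y ^ 2

/-- The fundamental metric matrix `g_{ij} = ½ [F²]_{yⁱyʲ}`. -/
def fundMatrix (f : EuclideanSpace ℝ (Fin n) → EuclideanSpace ℝ (Fin n) → ℝ)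
    (x y : EuclideanSpace ℝ (Fin n)) : Matrix (Fin n) (Fin n) ℝ :=
  Matrix.of fun i j => (1 / 2 : ℝ) * pdy (pdy (energy f) i) j x y

/-- The spray coefficients `Gⁱ = ¼ gⁱˡ ([F²]_{xᵏyˡ} yᵏ - [F²]_{xˡ})`. -/
def sprayCoeff (f : EuclideanSpace ℝ (Fin n) → EuclideanSpace ℝ (Fin n) → ℝ) (i : Fin n) :
    EuclideanSpace ℝ (Fin n) → EuclideanSpace ℝ (Fin n) → ℝ :=
  fun x y => (1 / 4 : ℝ) * ∑ l, (fundMatrix f x y)⁻¹ i l *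
    ((∑ k, pdy (pdx (energy f) k) l x y * y k) - pdx (energy f) l x y)

/-- The nonlinear connection coefficients `Nⁱⱼ = ∂Gⁱ/∂yʲ`. -/
def nonlinearConn (f : EuclideanSpace ℝ (Fin n) → EuclideanSpace ℝ (Fin n) → ℝ) (i j : Fin n) :
    EuclideanSpace ℝ (Fin n) → EuclideanSpace ℝ (Fin n) → ℝ :=
  pdy (sprayCoeff f i) j

/-- The Berwald connection coefficients `Γⁱⱼₖ = ∂²Gⁱ/∂yʲ∂yᵏ`. -/
def berwaldConn (f : EuclideanSpace ℝ (Fin n) → EuclideanSpace ℝ (Fin n) → ℝ) (i j k : Fin n) :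
    EuclideanSpace ℝ (Fin n) → EuclideanSpace ℝ (Fin n) → ℝ :=
  pdy (nonlinearConn f i j) k

/-- The horizontal derivative `δh/δxʲ = ∂h/∂xʲ - Nᵏⱼ ∂h/∂yᵏ`. -/
def horizDeriv (f h : EuclideanSpace ℝ (Fin n) → EuclideanSpace ℝ (Fin n) → ℝ) (j : Fin n) :
    EuclideanSpace ℝ (Fin n) → EuclideanSpace ℝ (Fin n) → ℝ :=
  fun x y => pdx h j x y - ∑ k, nonlinearConn f k j x y * pdy h k x y

/-- The lowered components `Vᵢ = g_{im} Vᵐ` of a vector field; they depend on `(x, y)`. -/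
def lowered (f : EuclideanSpace ℝ (Fin n) → EuclideanSpace ℝ (Fin n) → ℝ)
    (v : EuclideanSpace ℝ (Fin n) → EuclideanSpace ℝ (Fin n)) (i : Fin n) :
    EuclideanSpace ℝ (Fin n) → EuclideanSpace ℝ (Fin n) → ℝ :=
  fun x y => ∑ m, fundMatrix f x y i m * v x m

/-- The horizontal covariant derivative `V_{i|j} = δVᵢ/δxʲ - Γᵏᵢⱼ Vₖ` with respect to the
Berwald connection. -/
def covDeriv (f : EuclideanSpace ℝ (Fin n) → EuclideanSpace ℝ (Fin n) → ℝ)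
    (v : EuclideanSpace ℝ (Fin n) → EuclideanSpace ℝ (Fin n)) (i j : Fin n)
    (x y : EuclideanSpace ℝ (Fin n)) : ℝ :=
  horizDeriv f (lowered f v i) j x y - ∑ k, berwaldConn f k i j x y * lowered f v k x y

/-- The contraction `V_{0|0} = V_{i|j} yⁱ yʲ`. -/
def covDeriv00 (f : EuclideanSpace ℝ (Fin n) → EuclideanSpace ℝ (Fin n) → ℝ)
    (v : EuclideanSpace ℝ (Fin n) → EuclideanSpace ℝ (Fin n))
    (x y : EuclideanSpace ℝ (Fin n)) : ℝ :=
  ∑ i, ∑ j, covDeriv f v i j x y * y i * y j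

/-- The density `σ(x) = Vol(Bⁿ(1)) / Vol{y ∈ ℝⁿ | F(x, y) < 1}` of the Busemann-Hausdorff volume
form `σ(x) dx¹ ∧ ⋯ ∧ dxⁿ`. -/
def bhDensity (f : EuclideanSpace ℝ (Fin n) → EuclideanSpace ℝ (Fin n) → ℝ)
    (x : EuclideanSpace ℝ (Fin n)) : ℝ :=
  (MeasureTheory.volume (Metric.ball (0 : EuclideanSpace ℝ (Fin n)) 1)).toReal /
    (MeasureTheory.volume {y : EuclideanSpace ℝ (Fin n) | f x y < 1}).toReal

/-- The S-curvature `S = ∂Gᵐ/∂yᵐ - yᵐ ∂(ln σ)/∂xᵐ` of the Busemann-Hausdorff volume form. -/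
def sCurvature (f : EuclideanSpace ℝ (Fin n) → EuclideanSpace ℝ (Fin n) → ℝ)
    (x y : EuclideanSpace ℝ (Fin n)) : ℝ :=
  (∑ m, nonlinearConn f m m x y) -
    ∑ m, y m * fderiv ℝ (fun x' => Real.log (bhDensity f x')) x (EuclideanSpace.single m 1)

end FinslerCoord

/-! # Finsler metrics on manifolds -/

namespace Finsler

variable {n : ℕ} {M : Type*} [TopologicalSpace M] [ChartedSpace (EuclideanSpace ℝ (Fin n)) M]

/-- The coordinate expression `F(x, yⁱ ∂/∂xⁱ)` in a chart `e`, as a function of the coordinates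
`u` of `x` and of `y`. -/
def coordMetric (F : (x : M) → TangentSpace (𝓡 n) x → ℝ)
    (e : OpenPartialHomeomorph M (EuclideanSpace ℝ (Fin n)))
    (u y : EuclideanSpace ℝ (Fin n)) : ℝ :=
  F (e.symm u) (mfderiv (𝓡 n) (𝓡 n) e.symm u y)

/-- The components `(V¹, …, Vⁿ)` of a vector field in a chart `e`. -/
def coordField (V : (x : M) → TangentSpace (𝓡 n) x)
    (e : OpenPartialHomeomorph M (EuclideanSpace ℝ (Fin n)))
    (u : EuclideanSpace ℝ (Fin n)) : EuclideanSpace ℝ (Fin n) :=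
  mfderiv (𝓡 n) (𝓡 n) e (e.symm u) (V (e.symm u))

/-- `F` is a (regular, positive definite) Finsler metric: smooth and positive on the slit tangent
bundle, positively homogeneous of degree one, with positive definite fundamental form
`g_y(v, w) = ½ ∂²/∂s∂t F²(y + s v + t w)` at `s = t = 0`. -/
structure IsFinslerMetric [IsManifold (𝓡 n) ∞ M]
    (F : (x : M) → TangentSpace (𝓡 n) x → ℝ) : Prop where
  smooth : ContMDiffOn (𝓡 n).tangent 𝓘(ℝ, ℝ) ∞
    (fun p : TangentBundle (𝓡 n) M => F p.1 p.2) {p | p.2 ≠ 0}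
  pos : ∀ (x : M) (y : TangentSpace (𝓡 n) x), y ≠ 0 → 0 < F x y
  homog : ∀ (x : M) (y : TangentSpace (𝓡 n) x) (r : ℝ), 0 ≤ r → F x (r • y) = r * F x y
  posDef : ∀ (x : M) (y v : TangentSpace (𝓡 n) x), y ≠ 0 → v ≠ 0 →
    0 < (1 / 2 : ℝ) * deriv (fun s : ℝ => deriv (fun t : ℝ => F x (y + s • v + t • v) ^ 2) 0) 0

/-- `F` restricted to the tangent space at `x` is Euclidean: `F²` is there a quadratic form. -/
def IsRiemannianAt (F : (x : M) → TangentSpace (𝓡 n) x → ℝ) (x : M) : Prop :=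
  ∃ B : TangentSpace (𝓡 n) x →ₗ[ℝ] TangentSpace (𝓡 n) x →ₗ[ℝ] ℝ, ∀ y, F x y ^ 2 = B y y

/-- `F` is non-Riemannian, a local condition: `F` is not a Riemannian metric on any nonempty
open subset of `M`. -/
def IsNonRiemannian (F : (x : M) → TangentSpace (𝓡 n) x → ℝ) : Prop :=
  ∀ U : Set M, IsOpen U → U.Nonempty → ¬ ∀ x ∈ U, IsRiemannianAt F x

/-- `F` is of isotropic S-curvature: `S = (n + 1) θ F` for a scalar function `θ` on `M`. -/
def HasIsotropicSCurvature [IsManifold (𝓡 n) ∞ M]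
    (F : (x : M) → TangentSpace (𝓡 n) x → ℝ) : Prop :=
  ∃ θ : M → ℝ, ∀ e ∈ IsManifold.maximalAtlas (𝓡 n) ∞ M, ∀ u ∈ e.target,
    ∀ y : EuclideanSpace ℝ (Fin n), y ≠ 0 →
      FinslerCoord.sCurvature (coordMetric F e) u y
        = ((n : ℝ) + 1) * θ (e.symm u) * coordMetric F e u y

/-- `V` is a conformal vector field of `(M, F)` with conformal factor `c`: `V_{0|0} = -2 c F²`. -/
def IsConformalWith [IsManifold (𝓡 n) ∞ M] (F : (x : M) → TangentSpace (𝓡 n) x → ℝ)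
    (V : (x : M) → TangentSpace (𝓡 n) x) (c : M → ℝ) : Prop :=
  ∀ e ∈ IsManifold.maximalAtlas (𝓡 n) ∞ M, ∀ u ∈ e.target,
    ∀ y : EuclideanSpace ℝ (Fin n), y ≠ 0 →
      FinslerCoord.covDeriv00 (coordMetric F e) (coordField V e) u y
        = -2 * c (e.symm u) * coordMetric F e u y ^ 2

/-- `V` is a conformal vector field of `(M, F)`. -/
def IsConformal [IsManifold (𝓡 n) ∞ M] (F : (x : M) → TangentSpace (𝓡 n) x → ℝ)
    (V : (x : M) → TangentSpace (𝓡 n) x) : Prop :=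
  ∃ c : M → ℝ, IsConformalWith F V c

/-- `V` is a homothetic vector field of `(M, F)`: conformal with a constant conformal factor. -/
def IsHomothetic [IsManifold (𝓡 n) ∞ M] (F : (x : M) → TangentSpace (𝓡 n) x → ℝ)
    (V : (x : M) → TangentSpace (𝓡 n) x) : Prop :=
  ∃ c₀ : ℝ, IsConformalWith F V (fun _ => c₀)

/-- The norm `α = √(a_{ij} yⁱ yʲ)` of a Riemannian metric. -/
def riemNorm [IsManifold (𝓡 n) ∞ M]
    (a : Bundle.ContMDiffRiemannianMetric (𝓡 n) ∞ (EuclideanSpace ℝ (Fin n))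
      (fun x : M => TangentSpace (𝓡 n) x))
    (x : M) (y : TangentSpace (𝓡 n) x) : ℝ :=
  Real.sqrt (a.inner x y y)

/-- The function `F = α φ(β / α)`.  It vanishes at `y = 0`. -/
def alphaBeta [IsManifold (𝓡 n) ∞ M]
    (a : Bundle.ContMDiffRiemannianMetric (𝓡 n) ∞ (EuclideanSpace ℝ (Fin n))
      (fun x : M => TangentSpace (𝓡 n) x))
    (β : (x : M) → TangentSpace (𝓡 n) x →L[ℝ] ℝ) (φ : ℝ → ℝ)
    (x : M) (y : TangentSpace (𝓡 n) x) : ℝ :=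
  riemNorm a x y * φ (β x y / riemNorm a x y)

/-- `F = α φ(β / α)` is a (regular) (α, β)-metric: `α` is a Riemannian metric, `β` is a smooth
1-form, `φ` is smooth on an interval `(-b₀, b₀)`, `0 < b₀ ≤ ∞`, in which `β / α` takes its values
(that is, `‖β‖_α < b₀`), and `F` is a Finsler metric. -/
structure IsAlphaBetaMetric [IsManifold (𝓡 n) ∞ M]
    (a : Bundle.ContMDiffRiemannianMetric (𝓡 n) ∞ (EuclideanSpace ℝ (Fin n))
      (fun x : M => TangentSpace (𝓡 n) x))
    (β : (x : M) → TangentSpace (𝓡 n) x →L[ℝ] ℝ) (φ : ℝ → ℝ) (b₀ : EReal) : Prop where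
  smooth_form : ContMDiff (𝓡 n).tangent 𝓘(ℝ, ℝ) ∞
    (fun p : TangentBundle (𝓡 n) M => β p.1 p.2)
  smooth_phi : ContDiffOn ℝ ∞ φ {s : ℝ | ((|s| : ℝ) : EReal) < b₀}
  norm_lt : ∀ (x : M) (y : TangentSpace (𝓡 n) x), y ≠ 0 →
    ((|β x y / riemNorm a x y| : ℝ) : EReal) < b₀
  finsler : IsFinslerMetric (alphaBeta a β φ)

end Finsler

end

/-!
Let `L = F²`, let `V` be conformal with factor `c`, and put `ρ = -2 c`.  It is enough to show that,
in a chart, `F` is Euclidean in every tangent space where `dρ ≠ 0`: if `dρ ≠ 0` at some point, then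
`F` is Riemannian on the nonempty open set where `dρ ≠ 0`, which is excluded.  So `dρ = 0`, and `c`,
being locally constant, is constant on the connected manifold.  The argument in a chart concerns a
general Finsler metric.

Let `X = (V, DV y)` be the complete lift of `V`.  Since `V_{0|0}` is half of `X L`
(`IsFinslerOn.covDeriv00_eq`), conformality says that `X L = 2 ρ L`.  The spray `Γ = (y, -2 G)` is
determined by the Euler-Lagrange equation, and the commutator of `X` and `Γ` yields the Lie
derivative of `G`: it is `dρ(y) y - L R`, where `R` is dual to `dρ` with respect to the Hessian
`∂²L/∂yⁱ∂yʲ` (`IsFinslerOn.lieSpray_eq`).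

Take divergences in `y`.  On the left stands the derivative along `X` of `∂Gᵐ/∂yᵐ`, plus
`d(div V)(y)`.  On the right stands `n dρ(y) + L R(u)`, where `u = ln det (∂²L/∂yⁱ∂yʲ)`, because
`div R = -R(u)` by the symmetry of the third derivative of `L`.  By the hypothesis on the
S-curvature, `∂Gᵐ/∂yᵐ = (n + 1) θ F + d(ln σ)(y)`.  Comparing unit balls gives
`V(ln σ) = n ρ - div V` (`IsFinslerOn.fderiv_log_bhDensity`), and all the terms that are linear in
`y` cancel.  What remains is `F R(u) = k` with `k` depending on `x` only.

This is an equation on a single Minkowski space, and for `dρ ≠ 0` and `n ≥ 2` it forces the norm to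
be Euclidean (`IsMinkowskiEnergy.exists_bilinear`).  At a maximum of `u` one sees that `k = 0`, so
`u` is constant along the integral curves of `R`, along which the quotient `dρ / F` increases.  By
strict convexity its only critical directions are its maximum and its minimum, and so every level
set of `u` contains one of the two; a level set that meets the hyperplane `dρ = 0` contains both.
Hence `u` is constant, and Deicke's theorem applies (`IsMinkowskiEnergy.fderiv3_eq_zero`).  For the
latter, the trace of the Hessian of `∂²L/∂v²` with respect to the metric is a square, whose integral
against a cutoff that depends on `L` only vanishes by the divergence theorem.
-/

open scoped Manifold ContDiff Topology
open Matrix MeasureTheory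

set_option maxSynthPendingDepth 3

noncomputable section

/-! ### Derivatives of matrix-valued functions -/

namespace FinslerCoord

section MatrixCalculus

variable {X : Type*} [NormedAddCommGroup X] [NormedSpace ℝ X] {ι : Type*} [Fintype ι]

/-- The derivative at `x` in the direction `w` of a matrix-valued function, taken entrywise, so
that no norm on the space of matrices has to be chosen. -/
def matFDeriv (A : X → Matrix ι ι ℝ) (x w : X) : Matrix ι ι ℝ :=
  Matrix.of fun i j => fderiv ℝ (fun z => A z i j) x w

theorem matFDeriv_mul {A B : X → Matrix ι ι ℝ} {x : X}
    (hA : ∀ i j, DifferentiableAt ℝ (fun z => A z i j) x)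
    (hB : ∀ i j, DifferentiableAt ℝ (fun z => B z i j) x) (w : X) :
    matFDeriv (fun z => A z * B z) x w = matFDeriv A x w * B x + A x * matFDeriv B x w := by
  ext i j
  simp only [matFDeriv, Matrix.mul_apply, Matrix.of_apply, Matrix.add_apply]
  have h1 := fderiv_fun_sum (u := Finset.univ) (A := fun k z => A z i k * B z k j) (x := x)
    (𝕜 := ℝ) fun k _ => (hA i k).mul (hB k j)
  refine (congrArg (fun T => T w) h1).trans ?_
  simp only [_root_.sum_apply, ← Finset.sum_add_distrib]
  refine Finset.sum_congr rfl fun k _ => ?_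
  rw [fderiv_fun_mul (hA i k) (hB k j)]
  simp only [_root_.add_apply, _root_.smul_apply, smul_eq_mul]
  ring

theorem fderiv_trace_mul {A B : X → Matrix ι ι ℝ} {x : X}
    (hA : ∀ i j, DifferentiableAt ℝ (fun z => A z i j) x)
    (hB : ∀ i j, DifferentiableAt ℝ (fun z => B z i j) x) (w : X) :
    fderiv ℝ (fun z => (A z * B z).trace) x w
      = (matFDeriv A x w * B x).trace + (A x * matFDeriv B x w).trace := by
  have hAB : ∀ i, DifferentiableAt ℝ (fun z => (A z * B z) i i) x := fun i => by
    simp only [Matrix.mul_apply]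
    exact DifferentiableAt.fun_sum fun k _ => (hA i k).mul (hB k i)
  rw [← Matrix.trace_add, ← matFDeriv_mul hA hB]
  simp only [Matrix.trace, Matrix.diag_apply]
  rw [fderiv_fun_sum fun k _ => hAB k, _root_.sum_apply]
  rfl

variable [DecidableEq ι]

theorem contDiffAt_det {A : X → Matrix ι ι ℝ} {x : X} {k : WithTop ℕ∞}
    (h : ∀ i j, ContDiffAt ℝ k (fun z => A z i j) x) :
    ContDiffAt ℝ k (fun z => (A z).det) x := by
  simp only [Matrix.det_apply']
  exact ContDiffAt.sum fun σ _ => contDiffAt_const.mul (contDiffAt_prod fun i _ => h _ _)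

theorem contDiffAt_inv_apply {A : X → Matrix ι ι ℝ} {x : X} {k : WithTop ℕ∞}
    (h : ∀ i j, ContDiffAt ℝ k (fun z => A z i j) x) (hx : (A x).det ≠ 0) (i j : ι) :
    ContDiffAt ℝ k (fun z => (A z)⁻¹ i j) x := by
  have h1 : (fun z => (A z)⁻¹ i j)
      = fun z => ((A z).det)⁻¹ * ((A z).updateRow j (Pi.single i 1)).det := by
    funext z
    rw [Matrix.inv_def, Matrix.smul_apply, Matrix.adjugate_apply, smul_eq_mul,
      Ring.inverse_eq_inv']
  rw [h1]
  refine ((contDiffAt_det h).inv hx).mul (contDiffAt_det fun p q => ?_)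
  by_cases hp : p = j
  · subst hp
    simpa using contDiffAt_const
  · simpa [Matrix.updateRow_ne hp] using h p q

theorem matFDeriv_inv {A : X → Matrix ι ι ℝ} {x : X}
    (hA : ∀ i j, ContDiffAt ℝ 1 (fun z => A z i j) x) (hx : (A x).det ≠ 0) (w : X) :
    matFDeriv (fun z => (A z)⁻¹) x w = -((A x)⁻¹ * matFDeriv A x w * (A x)⁻¹) := by
  have hd : ∀ᶠ z in 𝓝 x, (A z).det ≠ 0 :=
    (contDiffAt_det hA).continuousAt.eventually_ne hx
  have h1 : matFDeriv (fun z => (A z)⁻¹ * A z) x w = 0 := by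
    ext i j
    have : (fun z => ((A z)⁻¹ * A z) i j) =ᶠ[𝓝 x] fun _ => (1 : Matrix ι ι ℝ) i j := by
      filter_upwards [hd] with z hz
      rw [Matrix.nonsing_inv_mul _ (isUnit_iff_ne_zero.2 hz)]
    simp only [matFDeriv, Matrix.of_apply]
    rw [this.fderiv_eq]
    simp
  rw [matFDeriv_mul (fun i j => (contDiffAt_inv_apply hA hx i j).differentiableAt one_ne_zero)
    (fun i j => (hA i j).differentiableAt one_ne_zero)] at h1
  have h2 := congrArg (· * (A x)⁻¹) (eq_neg_of_add_eq_zero_left h1)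
  simp only [Matrix.mul_assoc, Matrix.mul_nonsing_inv _ (isUnit_iff_ne_zero.2 hx)] at h2
  simpa [Matrix.mul_assoc] using h2

/-- The derivative of `det (1 + t M)` at `t = 0` is the trace of `M`. -/
theorem hasDerivAt_det_one_add_smul (M : Matrix ι ι ℝ) :
    HasDerivAt (fun t : ℝ => (1 + t • M).det) M.trace 0 := by
  have h0 := fun t : ℝ => Matrix.det_one_add_smul t M
  have h1 : HasDerivAt (fun t : ℝ => 1 + M.trace * t) M.trace 0 := by
    simpa using ((hasDerivAt_id (0 : ℝ)).const_mul M.trace).const_add 1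
  have h2 : ∀ P : Polynomial ℝ, HasDerivAt (fun t : ℝ => P.eval t * t ^ 2) 0 0 := fun P => by
    simpa using (P.hasDerivAt 0).fun_mul (hasDerivAt_pow 2 (0 : ℝ))
  rw [funext h0]
  simpa only [add_zero] using h1.fun_add (h2 _)

/-- Jacobi's formula for the derivative of a determinant. -/
theorem fderiv_det {A : X → Matrix ι ι ℝ} {x : X}
    (hA : ∀ i j, DifferentiableAt ℝ (fun z => A z i j) x) (hx : (A x).det ≠ 0) (w : X) :
    fderiv ℝ (fun z => (A z).det) x w
      = (A x).det * ((A x)⁻¹ * matFDeriv A x w).trace := by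
  let d : (ι → ι → ℝ) → ℝ := fun B => (Matrix.of B).det
  have hd : Differentiable ℝ d := fun B =>
    (contDiffAt_det (k := 1) (A := fun B : ι → ι → ℝ => Matrix.of B)
      fun i j => by
        simp only [Matrix.of_apply]
        fun_prop).differentiableAt one_ne_zero
  let B : X → ι → ι → ℝ := fun z i j => A z i j
  let B' : ι → ι → ℝ := fun i j => matFDeriv A x w i j
  have hB : DifferentiableAt ℝ B x :=
    differentiableAt_pi.2 fun i => differentiableAt_pi.2 fun j => hA i j
  have hB' : fderiv ℝ B x w = B' := by
    funext i j
    have h1 : HasFDerivAt (fun z => B z i j) _ x :=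
      hasFDerivAt_pi'.1 (hasFDerivAt_pi'.1 hB.hasFDerivAt i) j
    simp only [B', matFDeriv, Matrix.of_apply]
    exact (congrArg (fun T => T w) h1.fderiv).symm
  have h1 : fderiv ℝ (fun z => (A z).det) x w = fderiv ℝ d (B x) B' := by
    have : (fun z => (A z).det) = d ∘ B := rfl
    rw [this, fderiv_comp x (hd _) hB, ContinuousLinearMap.comp_apply, hB']
  have h2 : HasDerivAt (fun t : ℝ => d (B x + t • B')) (fderiv ℝ d (B x) B') 0 := by
    have h3 : HasDerivAt (fun t : ℝ => B x + t • B') B' 0 := by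
      simpa using ((hasDerivAt_id (0 : ℝ)).smul_const B').const_add (B x)
    have h4 : HasFDerivAt d (fderiv ℝ d (B x)) (B x + (0 : ℝ) • B') := by
      simpa using (hd (B x)).hasFDerivAt
    exact h4.comp_hasDerivAt 0 h3
  have h3 : (fun t : ℝ => d (B x + t • B'))
      = fun t => (A x).det * (1 + t • ((A x)⁻¹ * matFDeriv A x w)).det := by
    funext t
    rw [← Matrix.det_mul, Matrix.mul_add, Matrix.mul_smul, Matrix.mul_one, ← Matrix.mul_assoc,
      Matrix.mul_nonsing_inv _ (isUnit_iff_ne_zero.2 hx), Matrix.one_mul]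
    rfl
  rw [h1]
  rw [h3] at h2
  exact h2.unique ((hasDerivAt_det_one_add_smul _).const_mul _)

open scoped MatrixOrder in
/-- For a positive definite `P` and a symmetric `B`, the trace of `(P B)²` is nonnegative. -/
theorem trace_mul_mul_self_nonneg {P B : Matrix ι ι ℝ} (hP : P.PosDef) (hB : B.IsSymm) :
    0 ≤ (P * B * (P * B)).trace ∧ ((P * B * (P * B)).trace = 0 → B = 0) := by
  obtain ⟨C, hC, rfl⟩ : ∃ C : Matrix ι ι ℝ, IsUnit C ∧ P = Cᵀ * C := by
    obtain ⟨C, rfl⟩ := CStarAlgebra.nonneg_iff_eq_star_mul_self.mp hP.posSemidef.nonneg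
    refine ⟨C, (Matrix.isUnit_iff_isUnit_det C).2 (isUnit_iff_ne_zero.2 fun h => ?_), ?_⟩
    · have := hP.det_pos
      simp [h] at this
    · rw [Matrix.star_eq_conjTranspose, Matrix.conjTranspose_eq_transpose_of_trivial]
  set S := C * B * Cᵀ with hS
  have h1 : (Cᵀ * C * B * (Cᵀ * C * B)).trace = (Sᴴ * S).trace := by
    have : Sᴴ = S := by
      rw [Matrix.conjTranspose_eq_transpose_of_trivial, hS]
      simp [Matrix.transpose_mul, hB.eq, Matrix.mul_assoc]
    rw [this, hS]
    calc _ = (Cᵀ * (C * B * Cᵀ * C * B)).trace := by simp only [Matrix.mul_assoc]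
      _ = _ := by rw [Matrix.trace_mul_comm]; simp only [Matrix.mul_assoc]
  rw [h1]
  refine ⟨(Matrix.posSemidef_conjTranspose_mul_self S).trace_nonneg, fun h => ?_⟩
  have h2 := Matrix.trace_conjTranspose_mul_self_eq_zero_iff.1 h
  have h3 : IsUnit Cᵀ := (Matrix.isUnit_transpose C).2 hC
  rw [hS] at h2
  have h4 : C * B = 0 := h3.mul_left_eq_zero.1 h2
  exact hC.mul_right_eq_zero.1 h4

end MatrixCalculus

end FinslerCoord

/-! ### Homogeneous functions and Minkowski norms -/

namespace FinslerCoord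

/-- The coordinate space `ℝⁿ`. -/
abbrev Vec (n : ℕ) := EuclideanSpace ℝ (Fin n)

/-- The `i`-th vector of the standard basis. -/
abbrev stdVec {n : ℕ} (i : Fin n) : Vec n := EuclideanSpace.single i 1

theorem fderiv_fderiv_comm {X G : Type*} [NormedAddCommGroup X] [NormedSpace ℝ X]
    [NormedAddCommGroup G] [NormedSpace ℝ G] {f : X → G} {x : X} (hf : ContDiffAt ℝ ∞ f x)
    (v w : X) : fderiv ℝ (fderiv ℝ f) x v w = fderiv ℝ (fderiv ℝ f) x w v :=
  (hf.isSymmSndFDerivAt (by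
    rw [minSmoothness_of_isRCLikeNormedField]
    exact WithTop.coe_le_coe.2 le_top)).eq v w

section Homogeneous

variable {X G : Type*} [NormedAddCommGroup X] [NormedSpace ℝ X]
  [NormedAddCommGroup G] [NormedSpace ℝ G]

theorem smul_fderiv_of_homogeneous {f : X → G} {k : ℕ}
    (hf : ∀ r : ℝ, 0 < r → ∀ y, y ≠ 0 → f (r • y) = r ^ k • f y) {r : ℝ} (hr : 0 < r) {y : X}
    (hy : y ≠ 0) : r • fderiv ℝ f (r • y) = r ^ k • fderiv ℝ f y := by
  rw [← fderiv_comp_smul]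
  have h1 : (fun z => f (r • z)) =ᶠ[𝓝 y] r ^ k • f := by
    filter_upwards [isOpen_ne.mem_nhds hy] with z hz using hf r hr z hz
  rw [h1.fderiv_eq, fderiv_const_smul_field, Pi.smul_apply]

theorem fderiv_of_homogeneous {f : X → G} {k : ℕ}
    (hf : ∀ r : ℝ, 0 < r → ∀ y, y ≠ 0 → f (r • y) = r ^ (k + 1) • f y) (r : ℝ) (hr : 0 < r) (y : X)
    (hy : y ≠ 0) : fderiv ℝ f (r • y) = r ^ k • fderiv ℝ f y := by
  have h := smul_fderiv_of_homogeneous hf hr hy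
  rw [pow_succ', mul_smul] at h
  exact smul_right_injective _ hr.ne' h

/-- Euler's identity for positively homogeneous functions. -/
theorem fderiv_self_of_homogeneous {f : X → G} {k : ℕ}
    (hf : ∀ r : ℝ, 0 < r → ∀ y, y ≠ 0 → f (r • y) = r ^ k • f y) {y : X} (hy : y ≠ 0)
    (hd : DifferentiableAt ℝ f y) : fderiv ℝ f y y = (k : ℝ) • f y := by
  have h1 : HasDerivAt (fun r : ℝ => f (r • y)) (fderiv ℝ f y y) 1 := by
    have h2 : HasDerivAt (fun r : ℝ => r • y) y 1 := by
      simpa using (hasDerivAt_id (1 : ℝ)).smul_const y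
    have h3 : HasFDerivAt f (fderiv ℝ f y) ((1 : ℝ) • y) := by
      simpa using hd.hasFDerivAt
    exact h3.comp_hasDerivAt 1 h2
  have h2 : HasDerivAt (fun r : ℝ => r ^ k • f y) ((k : ℝ) • f y) 1 := by
    simpa using (hasDerivAt_pow k (1 : ℝ)).smul_const (f y)
  refine h1.unique (h2.congr_of_eventuallyEq ?_)
  filter_upwards [lt_mem_nhds (zero_lt_one' ℝ)] with r hr using hf r hr y hy

end Homogeneous

/-- The square `L` of a Minkowski norm on `ℝⁿ`: a function that is smooth, positive and
positive definite away from the origin, and positively homogeneous of degree two. -/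
structure IsMinkowskiEnergy {n : ℕ} (L : Vec n → ℝ) : Prop where
  contDiffOn : ContDiffOn ℝ ∞ L {0}ᶜ
  pos : ∀ y, y ≠ 0 → 0 < L y
  homog : ∀ (r : ℝ) (y : Vec n), 0 ≤ r → L (r • y) = r ^ 2 * L y
  posDef : ∀ y v, y ≠ 0 → v ≠ 0 → 0 < fderiv ℝ (fderiv ℝ L) y v v

/-- The matrix `∂²L/∂yⁱ∂yʲ`, twice the fundamental matrix of the norm `√L`. -/
def hessMatrix {n : ℕ} (L : Vec n → ℝ) (y : Vec n) : Matrix (Fin n) (Fin n) ℝ :=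
  Matrix.of fun i j => fderiv ℝ (fderiv ℝ L) y (stdVec i) (stdVec j)

/-- The vector dual to the covector `ℓ` with respect to the Hessian of `L` at `y`. -/
def dualVec {n : ℕ} (L : Vec n → ℝ) (ℓ : Vec n →L[ℝ] ℝ) (y : Vec n) : Vec n :=
  WithLp.toLp 2 ((hessMatrix L y)⁻¹ *ᵥ fun j => ℓ (stdVec j))

/-- The divergence `∂Rⁱ/∂yⁱ` of a vector field on `ℝⁿ`. -/
def divergence {n : ℕ} (R : Vec n → Vec n) (y : Vec n) : ℝ :=
  ∑ i, fderiv ℝ R y (stdVec i) i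

/-- The function `ln det (∂²L/∂yⁱ∂yʲ)`, up to an additive constant twice the distortion of the
norm `√L`. -/
def logDetHess {n : ℕ} (L : Vec n → ℝ) (y : Vec n) : ℝ := Real.log (hessMatrix L y).det

theorem sum_smul_stdVec {n : ℕ} (v : Vec n) : ∑ i, v i • stdVec i = v := by
  ext j
  simp [Pi.single_apply]

theorem map_eq_sum_stdVec {n : ℕ} {G : Type*} [AddCommGroup G] [Module ℝ G] [TopologicalSpace G]
    (T : Vec n →L[ℝ] G) (v : Vec n) : T v = ∑ i, v i • T (stdVec i) := by
  conv_lhs => rw [← sum_smul_stdVec v, map_sum]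
  simp

theorem fderiv_coord {X : Type*} [NormedAddCommGroup X] [NormedSpace ℝ X] {n : ℕ}
    {R : X → Vec n} {x : X} (hR : DifferentiableAt ℝ R x) (i : Fin n) (w : X) :
    fderiv ℝ (fun z => R z i) x w = fderiv ℝ R x w i := by
  have h := ((EuclideanSpace.proj i : Vec n →L[ℝ] ℝ).hasFDerivAt
    (x := R x)).comp x hR.hasFDerivAt
  exact congrArg (fun T : X →L[ℝ] ℝ => T w) h.fderiv

namespace IsMinkowskiEnergy

variable {n : ℕ} {L : Vec n → ℝ} (hL : IsMinkowskiEnergy L) {y : Vec n}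

include hL

theorem contDiffAt (hy : y ≠ 0) : ContDiffAt ℝ ∞ L y :=
  hL.contDiffOn.contDiffAt (isOpen_compl_singleton.mem_nhds hy)

theorem contDiffAt_fderiv (hy : y ≠ 0) : ContDiffAt ℝ ∞ (fderiv ℝ L) y :=
  (hL.contDiffAt hy).fderiv_right (by simp)

theorem contDiffAt_fderiv2 (hy : y ≠ 0) : ContDiffAt ℝ ∞ (fderiv ℝ (fderiv ℝ L)) y :=
  (hL.contDiffAt_fderiv hy).fderiv_right (by simp)

theorem contDiffAt_fderiv3 (hy : y ≠ 0) :
    ContDiffAt ℝ ∞ (fderiv ℝ (fderiv ℝ (fderiv ℝ L))) y :=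
  (hL.contDiffAt_fderiv2 hy).fderiv_right (by simp)

theorem differentiableAt_fderiv2 (hy : y ≠ 0) :
    DifferentiableAt ℝ (fderiv ℝ (fderiv ℝ L)) y :=
  (hL.contDiffAt_fderiv2 hy).differentiableAt (by simp)

theorem fderiv2_symm (hy : y ≠ 0) (v w : Vec n) :
    fderiv ℝ (fderiv ℝ L) y v w = fderiv ℝ (fderiv ℝ L) y w v :=
  fderiv_fderiv_comm (hL.contDiffAt hy) v w

theorem fderiv3_symm_left (hy : y ≠ 0) (v w : Vec n) :
    fderiv ℝ (fderiv ℝ (fderiv ℝ L)) y v w = fderiv ℝ (fderiv ℝ (fderiv ℝ L)) y w v :=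
  fderiv_fderiv_comm (hL.contDiffAt_fderiv hy) v w

omit hL in
theorem fderiv_apply_apply {f : Vec n → Vec n →L[ℝ] Vec n →L[ℝ] ℝ}
    (hf : DifferentiableAt ℝ f y) (u v w : Vec n) :
    fderiv ℝ (fun z => f z v w) y u = fderiv ℝ f y u v w := by
  rw [fderiv_clm_apply (hf.clm_apply (differentiableAt_const v)) (differentiableAt_const w),
    fderiv_clm_apply hf (differentiableAt_const v)]
  simp

theorem fderiv3_symm_right (hy : y ≠ 0) (u v w : Vec n) :
    fderiv ℝ (fderiv ℝ (fderiv ℝ L)) y u v w = fderiv ℝ (fderiv ℝ (fderiv ℝ L)) y u w v := by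
  have hd := hL.differentiableAt_fderiv2 hy
  rw [← fderiv_apply_apply hd, ← fderiv_apply_apply hd]
  refine congrArg (fun T : Vec n →L[ℝ] ℝ => T u) (Filter.EventuallyEq.fderiv_eq ?_)
  filter_upwards [isOpen_ne.mem_nhds hy] with z hz using hL.fderiv2_symm hz v w

theorem homog_fderiv (r : ℝ) (hr : 0 < r) (y : Vec n) (hy : y ≠ 0) :
    fderiv ℝ L (r • y) = r ^ 1 • fderiv ℝ L y :=
  fderiv_of_homogeneous (fun r hr y _ => hL.homog r y hr.le) r hr y hy

theorem homog_fderiv2 (r : ℝ) (hr : 0 < r) (y : Vec n) (hy : y ≠ 0) :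
    fderiv ℝ (fderiv ℝ L) (r • y) = r ^ 0 • fderiv ℝ (fderiv ℝ L) y :=
  fderiv_of_homogeneous hL.homog_fderiv r hr y hy

theorem fderiv_self (hy : y ≠ 0) : fderiv ℝ L y y = 2 * L y := by
  simpa using fderiv_self_of_homogeneous (fun r hr y _ => hL.homog r y hr.le) hy
    ((hL.contDiffAt hy).differentiableAt (by simp))

theorem fderiv2_self (hy : y ≠ 0) : fderiv ℝ (fderiv ℝ L) y y = fderiv ℝ L y := by
  simpa using fderiv_self_of_homogeneous hL.homog_fderiv hy
    ((hL.contDiffAt_fderiv hy).differentiableAt (by simp))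

theorem fderiv3_self (hy : y ≠ 0) : fderiv ℝ (fderiv ℝ (fderiv ℝ L)) y y = 0 := by
  simpa using fderiv_self_of_homogeneous hL.homog_fderiv2 hy (hL.differentiableAt_fderiv2 hy)

theorem contDiffAt_hessMatrix (hy : y ≠ 0) (i j : Fin n) :
    ContDiffAt ℝ ∞ (fun z => hessMatrix L z i j) y := by
  simp only [hessMatrix, Matrix.of_apply]
  exact ((hL.contDiffAt_fderiv2 hy).clm_apply contDiffAt_const).clm_apply contDiffAt_const

omit hL in
theorem dotProduct_hessMatrix (v w : Vec n) :
    v.ofLp ⬝ᵥ hessMatrix L y *ᵥ w.ofLp = fderiv ℝ (fderiv ℝ L) y v w := by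
  rw [map_eq_sum_stdVec (fderiv ℝ (fderiv ℝ L) y) v]
  simp only [_root_.sum_apply, _root_.smul_apply, smul_eq_mul, dotProduct, mulVec]
  refine Finset.sum_congr rfl fun i _ => ?_
  rw [map_eq_sum_stdVec (fderiv ℝ (fderiv ℝ L) y (stdVec i)) w]
  simp only [hessMatrix, Matrix.of_apply, smul_eq_mul, mul_comm]

theorem hessMatrix_isSymm (hy : y ≠ 0) : (hessMatrix L y).IsSymm := by
  ext i j
  simp only [hessMatrix, Matrix.of_apply, Matrix.transpose_apply]
  exact hL.fderiv2_symm hy _ _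

theorem hessMatrix_posDef (hy : y ≠ 0) : (hessMatrix L y).PosDef := by
  refine Matrix.PosDef.of_dotProduct_mulVec_pos ?_ fun v hv => ?_
  · rw [Matrix.IsHermitian, Matrix.conjTranspose_eq_transpose_of_trivial]
    exact hL.hessMatrix_isSymm hy
  · have h := dotProduct_hessMatrix (L := L) (y := y) (WithLp.toLp 2 v) (WithLp.toLp 2 v)
    simp only [star_trivial] at h ⊢
    rw [h]
    exact hL.posDef _ _ hy (by simpa using hv)

theorem det_hessMatrix_pos (hy : y ≠ 0) : 0 < (hessMatrix L y).det :=
  (hL.hessMatrix_posDef hy).det_pos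

theorem isUnit_det (hy : y ≠ 0) : IsUnit (hessMatrix L y).det :=
  isUnit_iff_ne_zero.2 (hL.det_hessMatrix_pos hy).ne'

theorem fderiv2_dualVec (hy : y ≠ 0) (ℓ : Vec n →L[ℝ] ℝ) (w : Vec n) :
    fderiv ℝ (fderiv ℝ L) y (dualVec L ℓ y) w = ℓ w := by
  rw [hL.fderiv2_symm hy, ← dotProduct_hessMatrix, dualVec, Matrix.mulVec_mulVec,
    Matrix.mul_nonsing_inv _ (hL.isUnit_det hy), Matrix.one_mulVec, map_eq_sum_stdVec ℓ w]
  rfl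

theorem eq_of_fderiv2_eq (hy : y ≠ 0) {v w : Vec n}
    (h : fderiv ℝ (fderiv ℝ L) y v = fderiv ℝ (fderiv ℝ L) y w) : v = w := by
  by_contra hne
  have := hL.posDef y (v - w) hy (sub_ne_zero.2 hne)
  have h0 : fderiv ℝ (fderiv ℝ L) y (v - w) = 0 := by rw [map_sub, h, sub_self]
  rw [h0] at this
  simp at this

theorem contDiffAt_inv_hessMatrix (hy : y ≠ 0) (i j : Fin n) :
    ContDiffAt ℝ ∞ (fun z => (hessMatrix L z)⁻¹ i j) y :=
  contDiffAt_inv_apply (hL.contDiffAt_hessMatrix hy) (hL.det_hessMatrix_pos hy).ne' i j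

theorem contDiffAt_dualVec (hy : y ≠ 0) (ℓ : Vec n →L[ℝ] ℝ) :
    ContDiffAt ℝ ∞ (dualVec L ℓ) y := by
  rw [contDiffAt_euclidean]
  intro i
  simp only [dualVec, mulVec, dotProduct]
  exact ContDiffAt.sum fun j _ => (hL.contDiffAt_inv_hessMatrix hy i j).mul contDiffAt_const

theorem contDiffAt_logDetHess (hy : y ≠ 0) : ContDiffAt ℝ ∞ (logDetHess L) y :=
  (contDiffAt_det (hL.contDiffAt_hessMatrix hy)).log (hL.det_hessMatrix_pos hy).ne'

theorem matFDeriv_hessMatrix (hy : y ≠ 0) (w : Vec n) (i j : Fin n) :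
    matFDeriv (hessMatrix L) y w i j
      = fderiv ℝ (fderiv ℝ (fderiv ℝ L)) y w (stdVec i) (stdVec j) :=
  fderiv_apply_apply (hL.differentiableAt_fderiv2 hy) _ _ _

theorem fderiv_logDetHess (hy : y ≠ 0) (w : Vec n) :
    fderiv ℝ (logDetHess L) y w
      = ((hessMatrix L y)⁻¹ * matFDeriv (hessMatrix L) y w).trace := by
  have hd := (hL.det_hessMatrix_pos hy).ne'
  have hM := fun i j => (hL.contDiffAt_hessMatrix hy i j).differentiableAt (by simp)
  have h1 : fderiv ℝ (logDetHess L) y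
      = ((hessMatrix L y).det)⁻¹ • fderiv ℝ (fun z => (hessMatrix L z).det) y := fderiv.log
    ((contDiffAt_det (hL.contDiffAt_hessMatrix hy)).differentiableAt (by simp)) hd
  rw [h1, _root_.smul_apply, fderiv_det hM hd, smul_eq_mul, inv_mul_cancel_left₀ hd]

omit hL in
theorem divergence_eq_sum {R : Vec n → Vec n} (hR : DifferentiableAt ℝ R y) :
    divergence R y = ∑ i, fderiv ℝ (fun z => R z i) y (stdVec i) := by
  refine Finset.sum_congr rfl fun i _ => ?_
  rw [fderiv_coord hR]

/-- The divergence of the vector field dual to a constant covector is the derivative of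
`-ln det (∂²L/∂yⁱ∂yʲ)` along it, because the third derivative of `L` is symmetric. -/
theorem divergence_dualVec (hy : y ≠ 0) (ℓ : Vec n →L[ℝ] ℝ) :
    divergence (dualVec L ℓ) y = -fderiv ℝ (logDetHess L) y (dualVec L ℓ y) := by
  have hd := (hL.det_hessMatrix_pos hy).ne'
  rw [divergence_eq_sum ((hL.contDiffAt_dualVec hy ℓ).differentiableAt (by simp)),
    hL.fderiv_logDetHess hy, Matrix.trace, ← Finset.sum_neg_distrib]
  refine Finset.sum_congr rfl fun i _ => ?_
  set P := (hessMatrix L y)⁻¹ with hP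
  have h1 : fderiv ℝ (fun z => dualVec L ℓ z i) y (stdVec i)
      = (matFDeriv (fun z => (hessMatrix L z)⁻¹) y (stdVec i) *ᵥ fun j => ℓ (stdVec j)) i := by
    have h2 := fderiv_fun_sum (𝕜 := ℝ) (u := Finset.univ) (x := y)
      (A := fun j z => (hessMatrix L z)⁻¹ i j * ℓ (stdVec j)) fun j _ =>
        ((hL.contDiffAt_inv_hessMatrix hy i j).mul contDiffAt_const).differentiableAt (by simp)
    refine (congrArg (fun T => T (stdVec i)) h2).trans ?_
    simp only [_root_.sum_apply, mulVec, dotProduct]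
    refine Finset.sum_congr rfl fun j _ => ?_
    rw [fderiv_mul_const ((hL.contDiffAt_inv_hessMatrix hy i j).differentiableAt (by simp)),
      _root_.smul_apply, smul_eq_mul, mul_comm]
    rfl
  rw [h1, matFDeriv_inv (fun i j => (hL.contDiffAt_hessMatrix hy i j).of_le (by simp)) hd,
    Matrix.neg_mulVec, Pi.neg_apply, ← Matrix.mulVec_mulVec, ← Matrix.mulVec_mulVec]
  congr 1
  simp only [Matrix.diag_apply, Matrix.mul_apply, mulVec, dotProduct]
  refine Finset.sum_congr rfl fun p _ => ?_
  congr 1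
  rw [hL.matFDeriv_hessMatrix hy, hL.fderiv3_symm_right hy, hL.fderiv3_symm_left hy,
    map_eq_sum_stdVec (fderiv ℝ (fderiv ℝ (fderiv ℝ L)) y (stdVec i)) (dualVec L ℓ y)]
  simp only [_root_.sum_apply, _root_.smul_apply, smul_eq_mul, dualVec, mulVec, dotProduct]
  refine Finset.sum_congr rfl fun q _ => ?_
  rw [hL.matFDeriv_hessMatrix hy, hL.fderiv3_symm_right hy, mul_comm]

end IsMinkowskiEnergy

end FinslerCoord

/-! ### The logarithm of the determinant of the Hessian -/

namespace FinslerCoord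

namespace IsMinkowskiEnergy

variable {n : ℕ} {L : Vec n → ℝ} (hL : IsMinkowskiEnergy L) {y : Vec n}

include hL

theorem logDetHess_smul {r : ℝ} (hr : 0 < r) (hy : y ≠ 0) :
    logDetHess L (r • y) = logDetHess L y := by
  have h : hessMatrix L (r • y) = hessMatrix L y := by
    ext i j
    simp only [hessMatrix, Matrix.of_apply]
    rw [hL.homog_fderiv2 r hr y hy, pow_zero, one_smul]
  rw [logDetHess, h, logDetHess]

/-- If the derivative of `ln det (∂²L/∂yⁱ∂yʲ)` along the dual of a covector is a multiple
`k / √L` of `1 / √L`, then `k = 0`: the function has a maximum on the unit sphere, and it is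
homogeneous of degree zero. -/
theorem fderiv_logDetHess_dualVec_eq_zero [NeZero n] {ℓ : Vec n →L[ℝ] ℝ} {k : ℝ}
    (h : ∀ y, y ≠ 0 → √(L y) * fderiv ℝ (logDetHess L) y (dualVec L ℓ y) = k) (hy : y ≠ 0) :
    fderiv ℝ (logDetHess L) y (dualVec L ℓ y) = 0 := by
  have hne : ∀ z ∈ Metric.sphere (0 : Vec n) 1, z ≠ 0 := fun z hz =>
    ne_zero_of_mem_unit_sphere ⟨z, hz⟩
  have hcont : ContinuousOn (logDetHess L) (Metric.sphere (0 : Vec n) 1) := fun z hz =>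
    (hL.contDiffAt_logDetHess (hne z hz)).continuousAt.continuousWithinAt
  obtain ⟨m, hm, hmax⟩ := (isCompact_sphere (0 : Vec n) 1).exists_isMaxOn
    ⟨stdVec 0, by simp⟩ hcont
  have hloc : IsLocalMax (logDetHess L) m := by
    filter_upwards [isOpen_ne.mem_nhds (hne m hm)] with z hz
    have hz' : 0 < ‖z‖⁻¹ := inv_pos.2 (norm_pos_iff.2 hz)
    rw [← hL.logDetHess_smul hz' hz]
    exact hmax (by simp [norm_smul, norm_ne_zero_iff.2 hz])
  have hk : k = 0 := by
    rw [← h m (hne m hm), hloc.fderiv_eq_zero]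
    simp
  have h1 := h y hy
  rw [hk] at h1
  exact (mul_eq_zero.1 h1).resolve_left (Real.sqrt_ne_zero'.2 (hL.pos y hy))

/-- The fundamental inequality of Minkowski norms: `L` lies strictly above its tangent planes. -/
theorem fderiv_lt (hy : y ≠ 0) {z : Vec n} (hz : z ≠ 0) (hne : z ≠ y) :
    fderiv ℝ L y z < L y + L z := by
  by_cases hneg : ∃ r : ℝ, 0 ≤ r ∧ z = -(r • y)
  · obtain ⟨r, hr, rfl⟩ := hneg
    have h1 := hL.pos _ hz
    have h2 := hL.pos _ hy
    rw [map_neg, map_smul, hL.fderiv_self hy, smul_eq_mul]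
    nlinarith [mul_nonneg hr h2.le]
  have hseg : ∀ t ∈ Set.Icc (0 : ℝ) 1, y + t • (z - y) ≠ 0 := by
    intro t ht h0
    rcases eq_or_lt_of_le ht.1 with h | h
    · rw [← h] at h0
      simp [hy] at h0
    · refine hneg ⟨(1 - t) / t, div_nonneg (by linarith [ht.2]) h.le, ?_⟩
      have h1 : t • z = -((1 - t) • y) := by
        rw [smul_sub] at h0
        rw [eq_neg_iff_add_eq_zero, sub_smul, one_smul, ← h0]
        abel
      rw [div_eq_inv_mul, mul_smul, ← smul_neg, ← h1, smul_smul, inv_mul_cancel₀ h.ne', one_smul]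
  set v := z - y with hv
  have hv0 : v ≠ 0 := sub_ne_zero.2 hne
  have hline : ∀ t : ℝ, HasDerivAt (fun t : ℝ => y + t • v) v t := fun t => by
    simpa using ((hasDerivAt_id t).smul_const v).const_add y
  have hg : ∀ t ∈ Set.Icc (0 : ℝ) 1,
      HasDerivAt (fun t : ℝ => L (y + t • v)) (fderiv ℝ L (y + t • v) v) t := fun t ht =>
    ((hL.contDiffAt (hseg t ht)).differentiableAt (by simp)).hasFDerivAt.comp_hasDerivAt t (hline t)
  have hg' : ∀ t ∈ Set.Icc (0 : ℝ) 1, HasDerivAt (fun t : ℝ => fderiv ℝ L (y + t • v) v)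
      (fderiv ℝ (fderiv ℝ L) (y + t • v) v v) t := fun t ht => by
    have h1 := ((hL.contDiffAt_fderiv (hseg t ht)).differentiableAt
      (by simp)).hasFDerivAt.comp_hasDerivAt t (hline t)
    simpa using h1.clm_apply (hasDerivAt_const t v)
  obtain ⟨c, hc, hc'⟩ := exists_hasDerivAt_eq_slope (fun t : ℝ => L (y + t • v)) _ zero_lt_one
    (fun t ht => (hg t ht).continuousAt.continuousWithinAt)
    fun t ht => hg t (Set.Ioo_subset_Icc_self ht)
  have hsub : Set.Icc 0 c ⊆ Set.Icc (0 : ℝ) 1 := Set.Icc_subset_Icc_right hc.2.le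
  obtain ⟨d, hd, hd'⟩ := exists_hasDerivAt_eq_slope (fun t : ℝ => fderiv ℝ L (y + t • v) v) _ hc.1
    (fun t ht => (hg' t (hsub ht)).continuousAt.continuousWithinAt)
    fun t ht => hg' t (hsub (Set.Ioo_subset_Icc_self ht))
  have hpos := hL.posDef _ v (hseg d (hsub (Set.Ioo_subset_Icc_self hd))) hv0
  rw [hd'] at hpos
  have h1 := (div_pos_iff_of_pos_right (by linarith [hc.1])).1 hpos
  simp only [zero_smul, add_zero, one_smul, sub_zero, div_one] at h1 hc'
  have h2 : y + v = z := by rw [hv]; abel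
  rw [h2] at hc'
  have h3 : fderiv ℝ L y v = fderiv ℝ L y z - 2 * L y := by
    rw [hv, map_sub, hL.fderiv_self hy]
  linarith

/-- Suppose that the derivative of `ln det (∂²L/∂yⁱ∂yʲ)` along the dual of the covector `ℓ`
vanishes.  Every level set of this function that meets the half-space `0 ≤ ℓ` contains the direction
in which `ℓ / √L` has its maximum `m`, because `ℓ / √L` increases strictly along the integral curves
of the dual of `ℓ`, except at its critical points, and strict convexity makes a critical point with
`0 ≤ ℓ` a strict maximum. -/
theorem exists_direction_of_max {ℓ : Vec n →L[ℝ] ℝ} (hℓ : ℓ ≠ 0)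
    (h : ∀ y, y ≠ 0 → fderiv ℝ (logDetHess L) y (dualVec L ℓ y) = 0) (hy : y ≠ 0)
    (hℓy : 0 ≤ ℓ y) : ∃ m : Vec n, m ≠ 0 ∧ logDetHess L m = logDetHess L y ∧
      ∃ κ : ℝ, 0 < κ ∧ ∀ w, ℓ w = κ * fderiv ℝ L m w := by
  have hne : ∀ z ∈ Metric.sphere (0 : Vec n) 1, z ≠ 0 := fun z hz =>
    ne_zero_of_mem_unit_sphere ⟨z, hz⟩
  have hnorm : ∀ z : Vec n, z ≠ 0 → ‖z‖⁻¹ • z ∈ Metric.sphere (0 : Vec n) 1 := fun z hz => by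
    simp [norm_smul, norm_ne_zero_iff.2 hz]
  have hcont : ContinuousOn (logDetHess L) (Metric.sphere (0 : Vec n) 1) := fun z hz =>
    (hL.contDiffAt_logDetHess (hne z hz)).continuousAt.continuousWithinAt
  let q : Vec n → ℝ := fun z => ℓ z / √(L z)
  have hq : ∀ z, z ≠ 0 → ∀ r : ℝ, 0 < r → q (r • z) = q z := fun z hz r hr => by
    simp only [q]
    rw [hL.homog r z hr.le, Real.sqrt_mul (sq_nonneg r), Real.sqrt_sq hr.le, map_smul, smul_eq_mul,
      mul_div_mul_left _ _ hr.ne']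
  have hsqrt : ∀ z, z ≠ 0 → √(L z) ≠ 0 := fun z hz => Real.sqrt_ne_zero'.2 (hL.pos z hz)
  have hqd : ∀ z, z ≠ 0 → HasFDerivAt q ((√(L z))⁻¹ • ℓ -
      (ℓ z / (2 * L z * √(L z))) • fderiv ℝ L z) z := fun z hz => by
    have hp := hL.pos z hz
    have h1 := (((hL.contDiffAt hz).differentiableAt (by simp)).hasFDerivAt.sqrt hp.ne')
    have h2 := (ℓ.hasFDerivAt (x := z)).fun_mul
      ((hasDerivAt_inv (hsqrt z hz)).comp_hasFDerivAt z h1)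
    refine h2.congr_fderiv ?_
    ext w
    have h3 : √(L z) ^ 2 = L z := Real.sq_sqrt hp.le
    simp only [_root_.sub_apply, _root_.add_apply, _root_.smul_apply, smul_eq_mul,
      Function.comp_apply]
    have h4 := hsqrt z hz
    rw [h3]
    field_simp
    ring
  set K := Metric.sphere (0 : Vec n) 1 ∩ logDetHess L ⁻¹' {logDetHess L y} with hK
  have hKc : IsCompact K := (isCompact_sphere (0 : Vec n) 1).of_isClosed_subset
    (hcont.preimage_isClosed_of_isClosed Metric.isClosed_sphere isClosed_singleton)
    Set.inter_subset_left
  have hmemK : ∀ z, z ≠ 0 → logDetHess L z = logDetHess L y → ‖z‖⁻¹ • z ∈ K := fun z hz hzy =>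
    ⟨hnorm z hz, by
      rw [Set.mem_preimage, Set.mem_singleton_iff,
        hL.logDetHess_smul (inv_pos.2 (norm_pos_iff.2 hz)) hz, hzy]⟩
  obtain ⟨m, hm, hmax⟩ := hKc.exists_isMaxOn ⟨_, hmemK y hy rfl⟩
    (f := q) fun z hz => (hqd z (hne z hz.1)).continuousAt.continuousWithinAt
  have hm0 : m ≠ 0 := hne m hm.1
  have hqmax : ∀ z, z ≠ 0 → logDetHess L z = logDetHess L y → q z ≤ q m := fun z hz hzy => by
    rw [← hq z hz _ (inv_pos.2 (norm_pos_iff.2 hz))]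
    exact hmax (hmemK z hz hzy)
  have hum : logDetHess L m = logDetHess L y := hm.2
  refine ⟨m, hm0, hum, ?_⟩
  have hLm := hL.pos m hm0
  -- `ℓ m` is nonnegative, since `m` maximizes `ℓ / √L` on a set that contains `y`.
  have hℓm : 0 ≤ ℓ m := by
    have h1 : 0 ≤ q m := (div_nonneg hℓy (Real.sqrt_nonneg _)).trans (hqmax y hy rfl)
    have h2 : ℓ m = q m * √(L m) := (div_mul_cancel₀ _ (hsqrt m hm0)).symm
    rw [h2]
    exact mul_nonneg h1 (Real.sqrt_nonneg _)
  set R := dualVec L ℓ with hR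
  -- `q` has a local maximum at `m` along the integral curve of `R` through `m`.
  have hcrit : (√(L m))⁻¹ * ℓ (R m) - ℓ m / (2 * L m * √(L m)) * fderiv ℝ L m (R m) = 0 := by
    obtain ⟨α, hα0, ε, hε, hα⟩ := ((hL.contDiffAt_dualVec hm0 ℓ).of_le
      (by simp)).exists_forall_mem_closedBall_exists_eq_forall_mem_Ioo_hasDerivAt₀ 0
    simp only [zero_sub, zero_add] at hα
    have hα0' : HasDerivAt α (R m) 0 := by
      have := hα 0 ⟨by linarith, hε⟩
      rwa [hα0] at this
    have hev : ∀ᶠ t in 𝓝 (0 : ℝ), α t ≠ 0 :=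
      hα0'.continuousAt.eventually_ne (by rwa [hα0])
    obtain ⟨δ, hδ, hδ'⟩ := Metric.eventually_nhds_iff_ball.1
      (hev.and (Ioo_mem_nhds (by linarith : -ε < 0) hε))
    have huα : ∀ t ∈ Metric.ball (0 : ℝ) δ, HasDerivAt (logDetHess L ∘ α) 0 t := fun t ht => by
      have h1 := ((hL.contDiffAt_logDetHess (hδ' t ht).1).differentiableAt
        (by simp)).hasFDerivAt.comp_hasDerivAt t (hα t (hδ' t ht).2)
      rwa [h _ (hδ' t ht).1] at h1
    have hconst : ∀ t ∈ Metric.ball (0 : ℝ) δ, logDetHess L (α t) = logDetHess L y := by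
      intro t ht
      rw [← hum, ← hα0]
      exact Metric.isOpen_ball.is_const_of_deriv_eq_zero (convex_ball _ _).isPreconnected
        (fun s hs => (huα s hs).differentiableAt.differentiableWithinAt)
        (fun s hs => (huα s hs).deriv) ht (Metric.mem_ball_self hδ)
    have hlocmax : IsLocalMax (q ∘ α) 0 := by
      filter_upwards [Metric.ball_mem_nhds (0 : ℝ) hδ] with t ht
      simp only [Function.comp_apply]
      rw [hα0]
      exact hqmax _ (hδ' t ht).1 (hconst t ht)
    have hqα : HasDerivAt (q ∘ α) _ 0 :=
      (show HasFDerivAt q _ (α 0) by rw [hα0]; exact hqd m hm0).comp_hasDerivAt 0 hα0'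
    have := hlocmax.hasDerivAt_eq_zero hqα
    simpa using this
  have hRw : ∀ w, fderiv ℝ (fderiv ℝ L) m (R m) w = ℓ w := hL.fderiv2_dualVec hm0 ℓ
  have hDLR : fderiv ℝ L m (R m) = ℓ m := by
    rw [← hL.fderiv2_self hm0, hL.fderiv2_symm hm0, hRw]
  rw [hDLR] at hcrit
  have hcrit' : ℓ (R m) = ℓ m / (2 * L m) * ℓ m := by
    have h4 := hsqrt m hm0
    field_simp at hcrit ⊢
    linarith
  set κ := ℓ m / (2 * L m) with hκ
  -- Equality in the Cauchy-Schwarz inequality.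
  have hRm : R m = κ • m := by
    by_contra hne'
    have h1 := hL.posDef m (R m - κ • m) hm0 (sub_ne_zero.2 hne')
    have h2 : fderiv ℝ (fderiv ℝ L) m (R m - κ • m) (R m - κ • m)
        = ℓ (R m) - κ * ℓ m - κ * (ℓ m - κ * (2 * L m)) := by
      simp only [map_sub, map_smul, _root_.sub_apply, _root_.smul_apply, smul_eq_mul, hRw,
        hL.fderiv2_self hm0, hL.fderiv_self hm0, hDLR]
    rw [h2, hcrit', hκ] at h1
    have h3 : ℓ m / (2 * L m) * (2 * L m) = ℓ m := div_mul_cancel₀ _ (by positivity)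
    rw [h3] at h1
    linarith
  have hℓκ : ∀ w, ℓ w = κ * fderiv ℝ L m w := fun w => by
    rw [← hRw, hRm, map_smul, _root_.smul_apply, hL.fderiv2_self hm0, smul_eq_mul]
  refine ⟨κ, lt_of_le_of_ne (div_nonneg hℓm (by positivity)) fun h0 => hℓ ?_, hℓκ⟩
  ext w
  rw [hℓκ w, ← h0, zero_mul]
  rfl

/-- The direction in which `ℓ / √L` has its maximum is unique, so there is only one level set. -/
theorem logDetHess_eq_of_nonneg {ℓ : Vec n →L[ℝ] ℝ} (hℓ : ℓ ≠ 0)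
    (h : ∀ y, y ≠ 0 → fderiv ℝ (logDetHess L) y (dualVec L ℓ y) = 0) {y z : Vec n} (hy : y ≠ 0)
    (hℓy : 0 ≤ ℓ y) (hz : z ≠ 0) (hℓz : 0 ≤ ℓ z) : logDetHess L y = logDetHess L z := by
  obtain ⟨m, hm, hmy, κ, hκ, hκm⟩ := hL.exists_direction_of_max hℓ h hy hℓy
  obtain ⟨p, hp, hpz, μ, hμ, hμp⟩ := hL.exists_direction_of_max hℓ h hz hℓz
  rw [← hmy, ← hpz]
  by_cases hs : (κ / μ) • m = p
  · rw [← hs, hL.logDetHess_smul (div_pos hκ hμ) hm]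
  -- Otherwise the fundamental inequality at `(κ / μ) • m`, where the differential of `L` is `ℓ / μ`,
  -- and at `p`, where it is the same covector, gives `2 L < L + L` twice.
  exfalso
  have hr : 0 < κ / μ := div_pos hκ hμ
  have hm' : (κ / μ) • m ≠ 0 := smul_ne_zero hr.ne' hm
  have hd : fderiv ℝ L ((κ / μ) • m) = fderiv ℝ L p := by
    ext w
    rw [hL.homog_fderiv _ hr _ hm, pow_one, _root_.smul_apply, smul_eq_mul]
    have := (hκm w).symm.trans (hμp w)
    field_simp
    linarith
  have h1 := hL.fderiv_lt hm' hp (Ne.symm hs)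
  have h2 := hL.fderiv_lt hp hm' hs
  rw [hd, hL.fderiv_self hp] at h1
  rw [← hd, hL.fderiv_self hm'] at h2
  linarith

omit hL in
theorem dualVec_neg (ℓ : Vec n →L[ℝ] ℝ) (y : Vec n) : dualVec L (-ℓ) y = -dualVec L ℓ y := by
  have : (fun j => (-ℓ) (stdVec j)) = -fun j => ℓ (stdVec j) := rfl
  rw [dualVec, this, Matrix.mulVec_neg]
  rfl

/-- The half-spaces `0 ≤ ℓ` and `ℓ ≤ 0` share a nonzero vector since `2 ≤ n`. -/
theorem logDetHess_eq (hn : 2 ≤ n) {ℓ : Vec n →L[ℝ] ℝ} (hℓ : ℓ ≠ 0)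
    (h : ∀ y, y ≠ 0 → fderiv ℝ (logDetHess L) y (dualVec L ℓ y) = 0) {y z : Vec n} (hy : y ≠ 0)
    (hz : z ≠ 0) : logDetHess L y = logDetHess L z := by
  have h' : ∀ y, y ≠ 0 → fderiv ℝ (logDetHess L) y (dualVec L (-ℓ) y) = 0 := fun y hy => by
    rw [dualVec_neg, map_neg, h y hy, neg_zero]
  -- A nonzero vector of the hyperplane that separates the two half-spaces.
  obtain ⟨k, hk, hk0⟩ : ∃ k : Vec n, ℓ k = 0 ∧ k ≠ 0 := by
    have h1 : 0 < Module.finrank ℝ (LinearMap.ker (ℓ : Vec n →ₗ[ℝ] ℝ)) := by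
      have h2 := LinearMap.finrank_range_add_finrank_ker (ℓ : Vec n →ₗ[ℝ] ℝ)
      have h3 := Submodule.finrank_le (LinearMap.range (ℓ : Vec n →ₗ[ℝ] ℝ))
      simp only [finrank_euclideanSpace, Fintype.card_fin, Module.finrank_self] at h2 h3
      omega
    have : Nontrivial (LinearMap.ker (ℓ : Vec n →ₗ[ℝ] ℝ)) := Module.finrank_pos_iff.1 h1
    obtain ⟨⟨k, hk⟩, hk0⟩ := exists_ne (0 : LinearMap.ker (ℓ : Vec n →ₗ[ℝ] ℝ))
    exact ⟨k, hk, fun h0 => hk0 (Subtype.ext h0)⟩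
  have key : ∀ y : Vec n, y ≠ 0 → logDetHess L y = logDetHess L k := fun y hy => by
    rcases le_total 0 (ℓ y) with hy' | hy'
    · exact hL.logDetHess_eq_of_nonneg hℓ h hy hy' hk0 hk.ge
    · exact hL.logDetHess_eq_of_nonneg (neg_ne_zero.2 hℓ) h' hy (by simpa using hy') hk0
        (by simp [hk])
  rw [key y hy, key z hz]

end IsMinkowskiEnergy

end FinslerCoord

/-! ### Deicke's theorem -/

namespace FinslerCoord

theorem integral_fderiv_eq_zero {n : ℕ} {f : Vec n → ℝ} (hf : ContDiff ℝ 1 f)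
    (hc : HasCompactSupport f) (v : Vec n) : ∫ y, fderiv ℝ f y v = 0 := by
  have hint : Integrable (fun y => fderiv ℝ f y v) :=
    ((hf.continuous_fderiv one_ne_zero).clm_apply continuous_const).integrable_of_hasCompactSupport
      (hc.fderiv_apply ℝ v)
  have h := integral_mul_fderiv_eq_neg_fderiv_mul_of_integrable (μ := volume) (v := v)
    (f := fun _ : Vec n => (1 : ℝ)) (g := f) (by simp) (by simpa using hint)
    (by simpa using hf.continuous.integrable_of_hasCompactSupport hc) (by fun_prop)
    (fun x _ => hf.differentiable one_ne_zero x)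
  simpa using h

/-- The divergence theorem for a compactly supported vector field. -/
theorem integral_divergence_eq_zero {n : ℕ} {R : Vec n → Vec n} (hR : ContDiff ℝ 1 R)
    (hc : HasCompactSupport R) : ∫ y, divergence R y = 0 := by
  have h1 : ∀ i, ContDiff ℝ 1 fun y => R y i := fun i => contDiff_euclidean.1 hR i
  have h2 : ∀ i : Fin n, HasCompactSupport fun y => R y i := fun i =>
    hc.comp_left (g := fun v : Vec n => v i) rfl
  have h3 : divergence R = fun y => ∑ i, fderiv ℝ (fun z => R z i) y (stdVec i) := by
    funext y
    exact IsMinkowskiEnergy.divergence_eq_sum (hR.differentiable one_ne_zero y)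
  rw [h3, integral_finsetSum]
  · exact Finset.sum_eq_zero fun i _ => integral_fderiv_eq_zero (h1 i) (h2 i) _
  · exact fun i _ => (((h1 i).continuous_fderiv one_ne_zero).clm_apply
      continuous_const).integrable_of_hasCompactSupport ((h2 i).fderiv_apply ℝ _)

theorem divergence_smul {n : ℕ} {f : Vec n → ℝ} {R : Vec n → Vec n} {y : Vec n}
    (hf : DifferentiableAt ℝ f y) (hR : DifferentiableAt ℝ R y) :
    divergence (fun z => f z • R z) y = fderiv ℝ f y (R y) + f y * divergence R y := by
  simp only [divergence]
  rw [map_eq_sum_stdVec (fderiv ℝ f y) (R y), Finset.mul_sum, ← Finset.sum_add_distrib]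
  refine Finset.sum_congr rfl fun i _ => ?_
  rw [fderiv_fun_smul hf hR]
  simp
  ring

theorem divergence_sum {n : ℕ} {ι : Type*} (s : Finset ι) {R : ι → Vec n → Vec n} {y : Vec n}
    (hR : ∀ j ∈ s, DifferentiableAt ℝ (R j) y) :
    divergence (fun z => ∑ j ∈ s, R j z) y = ∑ j ∈ s, divergence (R j) y := by
  simp only [divergence]
  rw [fderiv_fun_sum hR, Finset.sum_comm]
  simp

namespace IsMinkowskiEnergy

variable {n : ℕ} {L : Vec n → ℝ} (hL : IsMinkowskiEnergy L) {y : Vec n}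

include hL

theorem exists_norm_bounds [NeZero n] : ∃ c C : ℝ, 0 < c ∧ 0 < C ∧
    ∀ y : Vec n, c * ‖y‖ ^ 2 ≤ L y ∧ L y ≤ C * ‖y‖ ^ 2 := by
  have hne : ∀ z ∈ Metric.sphere (0 : Vec n) 1, z ≠ 0 := fun z hz =>
    ne_zero_of_mem_unit_sphere ⟨z, hz⟩
  have hcont : ContinuousOn L (Metric.sphere (0 : Vec n) 1) := fun z hz =>
    (hL.contDiffAt (hne z hz)).continuousAt.continuousWithinAt
  have hS : (Metric.sphere (0 : Vec n) 1).Nonempty := ⟨stdVec 0, by simp⟩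
  obtain ⟨a, ha, hmin⟩ := (isCompact_sphere (0 : Vec n) 1).exists_isMinOn hS hcont
  obtain ⟨b, hb, hmax⟩ := (isCompact_sphere (0 : Vec n) 1).exists_isMaxOn hS hcont
  refine ⟨L a, L b, hL.pos a (hne a ha), hL.pos b (hne b hb), fun y => ?_⟩
  rcases eq_or_ne y 0 with rfl | hy
  · have h0 : L 0 = 0 := by simpa using hL.homog 0 0 le_rfl
    simp [h0]
  · have h1 : ‖y‖⁻¹ • y ∈ Metric.sphere (0 : Vec n) 1 := by
      simp [norm_smul, norm_ne_zero_iff.2 hy]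
    have h2 : L y = L (‖y‖⁻¹ • y) * ‖y‖ ^ 2 := by
      rw [hL.homog _ _ (by positivity)]
      have := norm_ne_zero_iff.2 hy
      field_simp
    rw [h2]
    exact ⟨mul_le_mul_of_nonneg_right (hmin h1) (by positivity),
      mul_le_mul_of_nonneg_right (hmax h1) (by positivity)⟩

/-- The trace `gⁱʲ ∂ᵢ∂ⱼ h` of the Hessian of the component `h = ∂²L/∂v²` equals, when the determinant
of the Hessian of `L` is constant, the square of the norm of its derivative `∂ᵥ ∂²L`. -/
theorem sum_fderiv_dualVec (hu : ∀ y, y ≠ 0 → fderiv ℝ (logDetHess L) y = 0) (hy : y ≠ 0)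
    (v : Vec n) :
    ∑ j, fderiv ℝ (fun z => fderiv ℝ (fderiv ℝ (fderiv ℝ L)) z (stdVec j) v v) y
        (dualVec L (EuclideanSpace.proj j) y)
      = ((hessMatrix L y)⁻¹ * matFDeriv (hessMatrix L) y v *
          ((hessMatrix L y)⁻¹ * matFDeriv (hessMatrix L) y v)).trace := by
  have hd := (hL.det_hessMatrix_pos hy).ne'
  set D3 := fderiv ℝ (fderiv ℝ (fderiv ℝ L)) with hD3
  have h3 := (hL.contDiffAt_fderiv3 hy).differentiableAt (by simp)
  have hmf : ∀ i j, (fun z => matFDeriv (hessMatrix L) z v i j)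
      =ᶠ[𝓝 y] fun z => D3 z v (stdVec i) (stdVec j) := fun i j => by
    filter_upwards [isOpen_ne.mem_nhds hy] with z hz using hL.matFDeriv_hessMatrix hz v i j
  have hD3d : ∀ a b c : Vec n, DifferentiableAt ℝ (fun z => D3 z a b c) y := fun a b c =>
    ((h3.clm_apply (differentiableAt_const a)).clm_apply (differentiableAt_const b)).clm_apply
      (differentiableAt_const c)
  have hB : ∀ i j, DifferentiableAt ℝ (fun z => matFDeriv (hessMatrix L) z v i j) y := fun i j =>
    (hD3d _ _ _).congr_of_eventuallyEq (hmf i j)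
  -- Differentiate the trace of `(∂²L)⁻¹ ∂ᵥ∂²L`, which is the derivative of the log-determinant.
  have h0 : fderiv ℝ (fun z => ((hessMatrix L z)⁻¹ * matFDeriv (hessMatrix L) z v).trace) y v
      = 0 := by
    have : (fun z => ((hessMatrix L z)⁻¹ * matFDeriv (hessMatrix L) z v).trace)
        =ᶠ[𝓝 y] fun _ => 0 := by
      filter_upwards [isOpen_ne.mem_nhds hy] with z hz
      rw [← hL.fderiv_logDetHess hz, hu z hz]
      rfl
    rw [this.fderiv_eq]
    simp
  rw [fderiv_trace_mul
    (fun i j => (hL.contDiffAt_inv_hessMatrix hy i j).differentiableAt (by simp)) hB,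
    matFDeriv_inv (fun i j => (hL.contDiffAt_hessMatrix hy i j).of_le (by simp)) hd,
    Matrix.neg_mul, Matrix.trace_neg, neg_add_eq_zero] at h0
  rw [← Matrix.mul_assoc, h0, Matrix.trace, Finset.sum_congr rfl fun j _ => map_eq_sum_stdVec _ _,
    Finset.sum_comm]
  refine Finset.sum_congr rfl fun i _ => ?_
  rw [Matrix.diag_apply, Matrix.mul_apply]
  refine Finset.sum_congr rfl fun j _ => ?_
  have h4 : dualVec L (EuclideanSpace.proj j) y i = (hessMatrix L y)⁻¹ i j := by
    simp [dualVec, mulVec, dotProduct]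
  rw [h4, smul_eq_mul]
  congr 1
  have hcomm : ∀ a b c d : Vec n, fderiv ℝ (fun z => D3 z b c d) y a
      = fderiv ℝ (fun z => D3 z a c d) y b := fun a b c d => by
    have e : ∀ a b, fderiv ℝ (fun z => D3 z b c d) y a = fderiv ℝ D3 y a b c d := fun a b => by
      rw [fderiv_apply_apply (f := fun z => D3 z b) (h3.clm_apply (differentiableAt_const b)),
        fderiv_clm_apply h3 (differentiableAt_const b)]
      simp [hD3]
    rw [e, e, fderiv_fderiv_comm (hL.contDiffAt_fderiv2 hy)]
  have hsw : ∀ a b c d : Vec n, fderiv ℝ (fun z => D3 z b c d) y a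
      = fderiv ℝ (fun z => D3 z c b d) y a := fun a b c d => by
    refine congrArg (fun T : Vec n →L[ℝ] ℝ => T a) (Filter.EventuallyEq.fderiv_eq ?_)
    filter_upwards [isOpen_ne.mem_nhds hy] with z hz
    rw [hL.fderiv3_symm_left hz]
  have hsw' : ∀ a b c d : Vec n, fderiv ℝ (fun z => D3 z b c d) y a
      = fderiv ℝ (fun z => D3 z b d c) y a := fun a b c d => by
    refine congrArg (fun T : Vec n →L[ℝ] ℝ => T a) (Filter.EventuallyEq.fderiv_eq ?_)
    filter_upwards [isOpen_ne.mem_nhds hy] with z hz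
    rw [hL.fderiv3_symm_right hz]
  simp only [matFDeriv, Matrix.of_apply]
  have h5 := congrArg (fun T : Vec n →L[ℝ] ℝ => T v) (hmf j i).fderiv_eq
  simp only [matFDeriv, Matrix.of_apply] at h5
  rw [h5, hcomm (stdVec i), hsw v, hsw' v, hcomm v, hsw (stdVec j)]

/-- **Deicke's theorem**: if the determinant of the Hessian of `L` is constant, then the norm is
Euclidean.  Integrate the divergence of `χ(L) gⁱʲ ∂ⱼ h`, where `h = ∂²L/∂v²` and `χ` is a cutoff. -/
theorem fderiv3_eq_zero [NeZero n] (hu : ∀ y, y ≠ 0 → fderiv ℝ (logDetHess L) y = 0)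
    {y₀ : Vec n} (hy₀ : y₀ ≠ 0) (v : Vec n) :
    fderiv ℝ (fderiv ℝ (fderiv ℝ L)) y₀ v = 0 := by
  obtain ⟨c, C, hc, hC, hcC⟩ := hL.exists_norm_bounds
  set s := L y₀ with hs
  have hs0 : 0 < s := hL.pos _ hy₀
  let χ : ContDiffBump s := ⟨s / 4, s / 2, by positivity, by linarith⟩
  have hχ0 : ∀ y, L y ≤ s / 2 ∨ 3 * s / 2 ≤ L y → χ (L y) = 0 := fun y hy => by
    refine χ.zero_of_le_dist ?_
    rw [Real.dist_eq]
    show s / 2 ≤ _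
    rcases hy with hy | hy
    · rw [abs_sub_comm]
      exact le_trans (by linarith) (le_abs_self _)
    · exact le_trans (by linarith) (le_abs_self _)
  let R : Fin n → Vec n → Vec n := fun j => dualVec L (EuclideanSpace.proj j)
  let h : Fin n → Vec n → ℝ := fun j z => fderiv ℝ (fderiv ℝ (fderiv ℝ L)) z (stdVec j) v v
  let Z : Vec n → Vec n := fun y => ∑ j, (χ (L y) * h j y) • R j y
  let Q : Vec n → ℝ := fun y => ∑ j, fderiv ℝ (h j) y (R j y)
  have hh : ∀ j y, y ≠ 0 → ContDiffAt ℝ ∞ (h j) y := fun j y hy =>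
    (((hL.contDiffAt_fderiv3 hy).clm_apply contDiffAt_const).clm_apply
      contDiffAt_const).clm_apply contDiffAt_const
  have hR : ∀ j y, y ≠ 0 → ContDiffAt ℝ ∞ (R j) y := fun j y hy => hL.contDiffAt_dualVec hy _
  have hχL : ∀ y, y ≠ 0 → ContDiffAt ℝ ∞ (fun y => χ (L y)) y := fun y hy =>
    χ.contDiffAt.comp y (hL.contDiffAt hy)
  -- The cutoff vanishes near the origin and outside a ball.
  have hnear : ∀ᶠ y in 𝓝 (0 : Vec n), χ (L y) = 0 := by
    have h1 : Filter.Tendsto (fun y : Vec n => C * ‖y‖ ^ 2) (𝓝 0) (𝓝 0) := by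
      have : Continuous fun y : Vec n => C * ‖y‖ ^ 2 := by fun_prop
      simpa using this.tendsto 0
    filter_upwards [h1.eventually_lt_const (show (0 : ℝ) < s / 2 by positivity)] with y hy
    exact hχ0 y (Or.inl ((hcC y).2.trans hy.le))
  have hfar : ∀ y, y ∉ Metric.closedBall (0 : Vec n) √(3 * s / 2 / c) → χ (L y) = 0 := by
    intro y hy
    rw [mem_closedBall_zero_iff, not_le, Real.sqrt_lt' (lt_of_le_of_lt (Real.sqrt_nonneg _)
      (by simpa using hy)), div_lt_iff₀' hc] at hy
    exact hχ0 y (Or.inr (hy.le.trans (hcC y).1))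
  have hZc : ContDiff ℝ 1 Z := by
    rw [contDiff_iff_contDiffAt]
    intro y
    rcases eq_or_ne y 0 with rfl | hy
    · refine (contDiffAt_const (c := (0 : Vec n))).congr_of_eventuallyEq ?_
      filter_upwards [hnear] with y hy
      simp [Z, hy]
    · exact (ContDiffAt.sum fun j _ => (((hχL y hy).mul (hh j y hy)).smul (hR j y hy))).of_le
        (by simp)
  have hZs : HasCompactSupport Z :=
    HasCompactSupport.intro (isCompact_closedBall (0 : Vec n) √(3 * s / 2 / c)) fun y hy => by
      simp [Z, hfar y hy]
  have hdiv : ∀ y, divergence Z y = χ (L y) * Q y := by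
    intro y
    rcases eq_or_ne y 0 with rfl | hy
    · have h1 : Z =ᶠ[𝓝 0] fun _ => 0 := by
        filter_upwards [hnear] with y hy
        simp [Z, hy]
      rw [divergence, h1.fderiv_eq, hnear.self_of_nhds]
      simp
    · have hd1 := (hχL y hy).differentiableAt (by simp)
      have hd2 := fun j => (hh j y hy).differentiableAt (by simp)
      have hd3 := fun j => (hR j y hy).differentiableAt (by simp)
      have hLd := (hL.contDiffAt hy).differentiableAt (by simp)
      refine (divergence_sum Finset.univ (R := fun j z => (χ (L z) * h j z) • R j z) (y := y)
        fun j _ => (hd1.mul (hd2 j)).smul (hd3 j)).trans ?_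
      have h1 : ∀ j, divergence (fun z => (χ (L z) * h j z) • R j z) y
          = χ (L y) * fderiv ℝ (h j) y (R j y) + deriv χ (L y) * (h j y * y j) := fun j => by
        have e1 : fderiv ℝ (fun z => χ (L z)) y (R j y) = deriv χ (L y) * y j := by
          have e2 : HasFDerivAt (fun z => χ (L z)) (deriv χ (L y) • fderiv ℝ L y) y :=
            ((χ.contDiffAt (n := 1)).differentiableAt
              one_ne_zero).hasDerivAt.comp_hasFDerivAt y hLd.hasFDerivAt
          rw [e2.fderiv, _root_.smul_apply, smul_eq_mul, ← hL.fderiv2_self hy, hL.fderiv2_symm hy,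
            hL.fderiv2_dualVec hy]
          rfl
        rw [divergence_smul (f := fun z => χ (L z) * h j z) (hd1.mul (hd2 j)) (hd3 j), hL.divergence_dualVec hy, hu y hy,
          fderiv_fun_mul hd1 (hd2 j)]
        simp only [_root_.add_apply, _root_.smul_apply, smul_eq_mul, e1, _root_.zero_apply]
        ring
      simp only [h1]
      rw [Finset.sum_add_distrib, ← Finset.mul_sum, ← Finset.mul_sum]
      have h2 : ∑ j, h j y * y j = 0 := by
        have h3 := map_eq_sum_stdVec (fderiv ℝ (fderiv ℝ (fderiv ℝ L)) y) y
        rw [hL.fderiv3_self hy] at h3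
        have h4 := congrArg (fun T : Vec n →L[ℝ] Vec n →L[ℝ] ℝ => T v v) h3
        simp only [_root_.sum_apply, _root_.smul_apply, smul_eq_mul, _root_.zero_apply] at h4
        rw [h4]
        exact Finset.sum_congr rfl fun j _ => mul_comm _ _
      rw [h2, mul_zero, add_zero]
  have hQ : ∀ y, y ≠ 0 → 0 ≤ Q y ∧ (Q y = 0 → matFDeriv (hessMatrix L) y v = 0) := by
    intro y hy
    have h1 : Q y = _ := hL.sum_fderiv_dualVec hu hy v
    rw [h1]
    refine trace_mul_mul_self_nonneg (hL.hessMatrix_posDef hy).inv ?_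
    ext i j
    rw [Matrix.transpose_apply, hL.matFDeriv_hessMatrix hy, hL.matFDeriv_hessMatrix hy,
      hL.fderiv3_symm_right hy]
  have hcont : Continuous (divergence Z) := by
    have h1 := hZc.continuous_fderiv one_ne_zero
    exact continuous_finsetSum _ fun i _ =>
      (EuclideanSpace.proj i : Vec n →L[ℝ] ℝ).continuous.comp (h1.clm_apply continuous_const)
  have hnn : ∀ y, 0 ≤ divergence Z y := fun y => by
    rcases eq_or_ne y 0 with rfl | hy
    · rw [hdiv, hnear.self_of_nhds, zero_mul]
    · rw [hdiv]
      exact mul_nonneg χ.nonneg (hQ y hy).1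
  have hcs : HasCompactSupport (divergence Z) :=
    HasCompactSupport.intro (isCompact_closedBall (0 : Vec n) √(3 * s / 2 / c)) fun y hy => by
      rw [hdiv, hfar y hy, zero_mul]
  have hzero : divergence Z y₀ = 0 := by
    by_contra hne
    have h1 := hcont.integral_pos_of_hasCompactSupport_nonneg_nonzero (μ := volume) hcs hnn hne
    rw [integral_divergence_eq_zero hZc hZs] at h1
    exact lt_irrefl _ h1
  have hχ1 : χ (L y₀) = 1 := χ.one_of_mem_closedBall (by
    rw [← hs]
    exact Metric.mem_closedBall_self χ.rIn_pos.le)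
  rw [hdiv, hχ1, one_mul] at hzero
  have h1 := (hQ y₀ hy₀).2 hzero
  have h2 : ∀ i j, fderiv ℝ (fderiv ℝ (fderiv ℝ L)) y₀ v (stdVec i) (stdVec j) = 0 := fun i j => by
    rw [← hL.matFDeriv_hessMatrix hy₀, h1]
    rfl
  ext a b
  rw [map_eq_sum_stdVec _ a]
  simp only [_root_.sum_apply, _root_.smul_apply]
  refine Finset.sum_eq_zero fun i _ => ?_
  rw [map_eq_sum_stdVec _ b]
  simp [h2]

/-- If the derivative of `ln det (∂²L/∂yⁱ∂yʲ)` along the dual of some nonzero covector is a multiple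
of `1 / √L`, then the norm `√L` is Euclidean. -/
theorem exists_bilinear (hn : 2 ≤ n) {ℓ : Vec n →L[ℝ] ℝ} (hℓ : ℓ ≠ 0) {k : ℝ}
    (h : ∀ y, y ≠ 0 → √(L y) * fderiv ℝ (logDetHess L) y (dualVec L ℓ y) = k) :
    ∃ B : Vec n →L[ℝ] Vec n →L[ℝ] ℝ, ∀ y, L y = B y y := by
  have : NeZero n := ⟨by omega⟩
  have h0 := fun y hy => hL.fderiv_logDetHess_dualVec_eq_zero h (y := y) hy
  have hu : ∀ y, y ≠ 0 → fderiv ℝ (logDetHess L) y = 0 := fun y hy => by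
    have h1 : logDetHess L =ᶠ[𝓝 y] fun _ => logDetHess L y := by
      filter_upwards [isOpen_ne.mem_nhds hy] with z hz using hL.logDetHess_eq hn hℓ h0 hz hy
    rw [h1.fderiv_eq]
    simp
  have hconn : IsPreconnected ({0}ᶜ : Set (Vec n)) :=
    (isConnected_compl_singleton_of_one_lt_rank (by
      rw [← Module.finrank_eq_rank, finrank_euclideanSpace, Fintype.card_fin]
      exact_mod_cast hn) 0).isPreconnected
  set y₀ : Vec n := stdVec 0
  have hy₀ : y₀ ≠ 0 := by simp [y₀]
  have hc : ∀ y, y ≠ 0 → fderiv ℝ (fderiv ℝ L) y = fderiv ℝ (fderiv ℝ L) y₀ := fun y hy =>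
    isOpen_compl_singleton.is_const_of_fderiv_eq_zero (𝕜 := ℝ) hconn
      (fun z hz => (hL.differentiableAt_fderiv2 hz).differentiableWithinAt)
      (fun z hz => by ext v : 1; exact hL.fderiv3_eq_zero hu hz v) hy hy₀
  refine ⟨(2 : ℝ)⁻¹ • fderiv ℝ (fderiv ℝ L) y₀, fun y => ?_⟩
  rcases eq_or_ne y 0 with rfl | hy
  · simpa using hL.homog 0 0 le_rfl
  · rw [← hc y hy]
    simp only [_root_.smul_apply, smul_eq_mul]
    rw [hL.fderiv2_self hy, hL.fderiv_self hy]
    ring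

end IsMinkowskiEnergy

end FinslerCoord

/-! ### The Busemann-Hausdorff density -/

namespace FinslerCoord

section SphereIntegral

variable {n : ℕ}

/-- Differentiation under the integral sign over the unit sphere. -/
theorem hasFDerivAt_integral_sphere {P Γ : Type} [NormedAddCommGroup P] [NormedSpace ℝ P]
    [ProperSpace P] [NormedAddCommGroup Γ] [NormedSpace ℝ Γ] {W : Set P} (hW : IsOpen W)
    {g : P × Vec n → Γ} (hg : ContDiffOn ℝ ∞ g (W ×ˢ {0}ᶜ)) {p : P} (hp : p ∈ W) :
    HasFDerivAt (fun p => ∫ ζ : Metric.sphere (0 : Vec n) 1, g (p, ζ) ∂volume.toSphere)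
      (∫ ζ : Metric.sphere (0 : Vec n) 1,
        (fderiv ℝ g (p, ζ)).comp (ContinuousLinearMap.inl ℝ P (Vec n)) ∂volume.toSphere) p := by
  have hopen : IsOpen (W ×ˢ ({0}ᶜ : Set (Vec n))) := hW.prod isOpen_compl_singleton
  have hmem : ∀ {q : P}, q ∈ W → ∀ ζ : Metric.sphere (0 : Vec n) 1,
      (q, (ζ : Vec n)) ∈ W ×ˢ ({0}ᶜ : Set (Vec n)) := fun hq ζ =>
    ⟨hq, ne_zero_of_mem_unit_sphere ζ⟩
  set g' : P × Vec n → P →L[ℝ] Γ := fun q =>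
    (fderiv ℝ g q).comp (ContinuousLinearMap.inl ℝ P (Vec n)) with hg'
  have hg'c : ContinuousOn g' (W ×ˢ {0}ᶜ) :=
    (hg.continuousOn_fderiv_of_isOpen hopen (by simp)).clm_comp continuousOn_const
  have hsec : ∀ {Δ : Type} [NormedAddCommGroup Δ] {k : P × Vec n → Δ},
      ContinuousOn k (W ×ˢ {0}ᶜ) → ∀ {q : P}, q ∈ W →
      Continuous fun ζ : Metric.sphere (0 : Vec n) 1 => k (q, ζ) := fun hk q hq =>
    hk.comp_continuous (by fun_prop) (hmem hq)
  obtain ⟨r, hr, hrW⟩ := Metric.nhds_basis_closedBall.mem_iff.1 (hW.mem_nhds hp)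
  have hK : IsCompact (Metric.closedBall p r ×ˢ Metric.sphere (0 : Vec n) 1) :=
    (isCompact_closedBall _ _).prod (isCompact_sphere _ _)
  obtain ⟨C, hC⟩ := hK.exists_bound_of_continuousOn (f := g') (hg'c.mono fun q hq =>
    ⟨hrW hq.1, ne_zero_of_mem_unit_sphere ⟨q.2, hq.2⟩⟩)
  refine hasFDerivAt_integral_of_dominated_of_fderiv_le (s := Metric.closedBall p r)
    (F := fun p (ζ : Metric.sphere (0 : Vec n) 1) => g (p, ζ))
    (F' := fun p (ζ : Metric.sphere (0 : Vec n) 1) => g' (p, ζ)) (bound := fun _ => C)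
    (Metric.closedBall_mem_nhds p hr) ?_ ?_ ?_ ?_ (integrable_const C) ?_
  · filter_upwards [hW.mem_nhds hp] with q hq
    exact (hsec hg.continuousOn hq).aestronglyMeasurable
  · exact (hsec hg.continuousOn hp).integrable_of_hasCompactSupport
      (HasCompactSupport.of_compactSpace _)
  · exact (hsec hg'c hp).aestronglyMeasurable
  · exact Filter.Eventually.of_forall fun ζ q hq => hC _ ⟨hq, ζ.2⟩
  · refine Filter.Eventually.of_forall fun ζ q hq => ?_
    have h1 : HasFDerivAt g (fderiv ℝ g (q, (ζ : Vec n))) (q, (ζ : Vec n)) :=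
      ((hg.contDiffAt (hopen.mem_nhds (hmem (hrW hq) ζ))).differentiableAt (by simp)).hasFDerivAt
    exact h1.comp q (hasFDerivAt_prodMk_left q (ζ : Vec n))

theorem contDiffOn_integral_sphere {P : Type} [NormedAddCommGroup P] [NormedSpace ℝ P]
    [ProperSpace P] {W : Set P} (hW : IsOpen W) (m : ℕ) :
    ∀ {Γ : Type} [NormedAddCommGroup Γ] [NormedSpace ℝ Γ] {g : P × Vec n → Γ},
      ContDiffOn ℝ ∞ g (W ×ˢ {0}ᶜ) → ContDiffOn ℝ m
        (fun p => ∫ ζ : Metric.sphere (0 : Vec n) 1, g (p, ζ) ∂volume.toSphere) W := by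
  induction m with
  | zero =>
    intro Γ _ _ g hg
    exact contDiffOn_zero.2 fun p hp =>
      (hasFDerivAt_integral_sphere hW hg hp).continuousAt.continuousWithinAt
  | succ m ih =>
    intro Γ _ _ g hg
    have hopen : IsOpen (W ×ˢ ({0}ᶜ : Set (Vec n))) := hW.prod isOpen_compl_singleton
    rw [Nat.cast_succ, contDiffOn_succ_iff_fderiv_of_isOpen hW]
    refine ⟨fun p hp =>
      (hasFDerivAt_integral_sphere hW hg hp).differentiableAt.differentiableWithinAt,
      fun h => absurd h (by simp), ?_⟩
    refine (ih (g := fun q => (fderiv ℝ g q).comp (ContinuousLinearMap.inl ℝ P (Vec n)))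
      ((hg.fderiv_of_isOpen hopen (by simp)).clm_comp contDiffOn_const)).congr fun p hp =>
        (hasFDerivAt_integral_sphere hW hg hp).fderiv

/-- The volume of the unit ball of a positively homogeneous function, in polar coordinates. -/
theorem volume_lt_one_eq_integral [NeZero n] {g : Vec n → ℝ} (hg : ContinuousOn g {0}ᶜ)
    (hpos : ∀ y, y ≠ 0 → 0 < g y) (hhom : ∀ (r : ℝ) (y : Vec n), 0 ≤ r → g (r • y) = r * g y) :
    (volume {y | g y < 1}).toReal
      = (n : ℝ)⁻¹ * ∫ ζ : Metric.sphere (0 : Vec n) 1, (g ζ ^ n)⁻¹ ∂volume.toSphere := by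
  have hn : 0 < n := Nat.pos_of_ne_zero (NeZero.ne n)
  have hgs : Continuous fun ζ : Metric.sphere (0 : Vec n) 1 => g ζ :=
    hg.comp_continuous (by fun_prop) fun ζ => ne_zero_of_mem_unit_sphere ζ
  have hgp : ∀ ζ : Metric.sphere (0 : Vec n) 1, 0 < g ζ := fun ζ =>
    hpos _ (ne_zero_of_mem_unit_sphere ζ)
  let T : Set (Metric.sphere (0 : Vec n) 1 × Set.Ioi (0 : ℝ)) := {q | (q.2 : ℝ) * g q.1 < 1}
  have hT : MeasurableSet T := (isOpen_lt
    ((continuous_subtype_val.comp continuous_snd).mul (hgs.comp continuous_fst))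
    continuous_const).measurableSet
  have hmp := (volume : Measure (Vec n)).measurePreserving_homeomorphUnitSphereProd
  have h1 : volume {y | g y < 1}
      = (volume.toSphere.prod (Measure.volumeIoiPow (Module.finrank ℝ (Vec n) - 1))) T := by
    rw [← hmp.measure_preimage hT.nullMeasurableSet,
      comap_subtype_coe_apply (measurableSet_singleton _).compl]
    have h2 : (Subtype.val '' (homeomorphUnitSphereProd (Vec n) ⁻¹' T) : Set (Vec n))
        = {y | g y < 1} \ {0} := by
      ext y
      have key : ∀ hy : y ≠ 0, homeomorphUnitSphereProd (Vec n) ⟨y, hy⟩ ∈ T ↔ g y < 1 := by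
        intro hy
        have h3 : ‖y‖ * g (‖y‖⁻¹ • y) = g y := by
          rw [← hhom _ _ (norm_nonneg y), smul_smul, mul_inv_cancel₀ (norm_ne_zero_iff.2 hy),
            one_smul]
        simp only [T, Set.mem_ofPred_eq, homeomorphUnitSphereProd_apply_fst_coe,
          homeomorphUnitSphereProd_apply_snd_coe]
        rw [h3]
      constructor
      · rintro ⟨⟨z, hz⟩, hzT, rfl⟩
        exact ⟨(key hz).1 hzT, hz⟩
      · rintro ⟨hy1, hy0⟩
        exact ⟨⟨y, hy0⟩, (key hy0).2 hy1, rfl⟩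
    rw [h2, measure_sdiff_null (measure_singleton _)]
  have h2 : ∀ ζ : Metric.sphere (0 : Vec n) 1,
      Measure.volumeIoiPow (Module.finrank ℝ (Vec n) - 1) (Prod.mk ζ ⁻¹' T)
        = ENNReal.ofReal ((n : ℝ)⁻¹ * (g ζ ^ n)⁻¹) := fun ζ => by
    have h3 : Prod.mk ζ ⁻¹' T = Set.Iio ⟨(g ζ)⁻¹, inv_pos.2 (hgp ζ)⟩ := by
      ext r
      simp only [T, Set.mem_preimage, Set.mem_ofPred_eq, Set.mem_Iio, ← Subtype.coe_lt_coe]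
      rw [lt_inv_comm₀ r.2 (hgp ζ), ← one_div, lt_div_iff₀ r.2, mul_comm]
    rw [h3, Measure.volumeIoiPow_apply_Iio, finrank_euclideanSpace, Fintype.card_fin,
      Nat.sub_add_cancel hn, Nat.cast_pred hn, sub_add_cancel, inv_pow, div_eq_inv_mul]
  have hcont : Continuous fun ζ : Metric.sphere (0 : Vec n) 1 => (n : ℝ)⁻¹ * (g ζ ^ n)⁻¹ :=
    continuous_const.mul ((hgs.pow n).inv₀ fun ζ => (pow_pos (hgp ζ) n).ne')
  have hnn : ∀ ζ : Metric.sphere (0 : Vec n) 1, 0 ≤ (n : ℝ)⁻¹ * (g ζ ^ n)⁻¹ := fun ζ =>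
    mul_nonneg (by positivity) (inv_nonneg.2 (pow_pos (hgp ζ) n).le)
  rw [h1, Measure.prod_apply hT, lintegral_congr h2, ← integral_const_mul,
    integral_eq_lintegral_of_nonneg_ae (Filter.Eventually.of_forall hnn)
      hcont.aestronglyMeasurable]

end SphereIntegral

/-- `f` is the coordinate expression, over the open set `U`, of a Finsler metric. -/
structure IsFinslerOn {n : ℕ} (U : Set (Vec n)) (f : Vec n → Vec n → ℝ) : Prop where
  isOpen : IsOpen U
  contDiffOn : ContDiffOn ℝ ∞ (fun p : Vec n × Vec n => f p.1 p.2) (U ×ˢ {0}ᶜ)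
  pos : ∀ x ∈ U, ∀ y, y ≠ 0 → 0 < f x y
  homog : ∀ x ∈ U, ∀ (r : ℝ) (y : Vec n), 0 ≤ r → f x (r • y) = r * f x y
  posDef : ∀ x ∈ U, ∀ y v, y ≠ 0 → v ≠ 0 →
    0 < fderiv ℝ (fderiv ℝ (energy f x)) y v v

namespace IsFinslerOn

variable {n : ℕ} {U : Set (Vec n)} {f : Vec n → Vec n → ℝ} (hf : IsFinslerOn U f) {x : Vec n}

include hf

theorem isOpen_slit : IsOpen (U ×ˢ ({0}ᶜ : Set (Vec n))) := hf.isOpen.prod isOpen_compl_singleton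

theorem contDiffAt (hx : x ∈ U) {y : Vec n} (hy : y ≠ 0) :
    ContDiffAt ℝ ∞ (fun p : Vec n × Vec n => f p.1 p.2) (x, y) :=
  hf.contDiffOn.contDiffAt (hf.isOpen_slit.mem_nhds ⟨hx, hy⟩)

theorem contDiffAt_snd (hx : x ∈ U) {y : Vec n} (hy : y ≠ 0) : ContDiffAt ℝ ∞ (f x) y :=
  (hf.contDiffAt hx hy).comp y (f := fun z => (x, z)) (by fun_prop)

theorem isMinkowskiEnergy (hx : x ∈ U) : IsMinkowskiEnergy (energy f x) where
  contDiffOn _ hy := ((hf.contDiffAt_snd hx hy).pow 2).contDiffWithinAt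
  pos y hy := pow_pos (hf.pos x hx y hy) 2
  homog r y hr := by rw [energy, energy, hf.homog x hx r y hr]; ring
  posDef := hf.posDef x hx

theorem volume_lt_one_eq [NeZero n] (hx : x ∈ U) : (volume {y | f x y < 1}).toReal
    = (n : ℝ)⁻¹ * ∫ ζ : Metric.sphere (0 : Vec n) 1, (f x ζ ^ n)⁻¹ ∂volume.toSphere :=
  volume_lt_one_eq_integral
    (fun _ hy => (hf.contDiffAt_snd hx hy).continuousAt.continuousWithinAt) (hf.pos x hx)
    (hf.homog x hx)

theorem contDiffOn_volume [NeZero n] (m : ℕ) :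
    ContDiffOn ℝ m (fun x => (volume {y | f x y < 1}).toReal) U := by
  have h1 : ContDiffOn ℝ ∞ (fun p : Vec n × Vec n => (f p.1 p.2 ^ n)⁻¹) (U ×ˢ {0}ᶜ) :=
    (hf.contDiffOn.pow n).inv fun p hp => (pow_pos (hf.pos p.1 hp.1 p.2 hp.2) n).ne'
  exact (contDiffOn_const.mul (contDiffOn_integral_sphere hf.isOpen m h1)).congr fun x hx =>
    hf.volume_lt_one_eq hx

theorem volume_pos [NeZero n] (hx : x ∈ U) : 0 < (volume {y | f x y < 1}).toReal := by
  rw [hf.volume_lt_one_eq hx]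
  have hgs : Continuous fun ζ : Metric.sphere (0 : Vec n) 1 => f x ζ :=
    (continuousOn_of_forall_continuousAt (s := {0}ᶜ)
      fun y hy => (hf.contDiffAt_snd hx hy).continuousAt).comp_continuous (by fun_prop)
      fun ζ => ne_zero_of_mem_unit_sphere ζ
  have hgp : ∀ ζ : Metric.sphere (0 : Vec n) 1, 0 < (f x ζ ^ n)⁻¹ := fun ζ =>
    inv_pos.2 (pow_pos (hf.pos x hx _ (ne_zero_of_mem_unit_sphere ζ)) n)
  have hc : Continuous fun ζ : Metric.sphere (0 : Vec n) 1 => (f x ζ ^ n)⁻¹ :=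
    (hgs.pow n).inv₀ fun ζ => (inv_pos.1 (hgp ζ)).ne'
  have h0 : (⟨stdVec 0, by simp⟩ : Metric.sphere (0 : Vec n) 1) ∈ Set.univ := trivial
  exact mul_pos (inv_pos.2 (Nat.cast_pos.2 (Nat.pos_of_ne_zero (NeZero.ne n))))
    (hc.integral_pos_of_hasCompactSupport_nonneg_nonzero (HasCompactSupport.of_compactSpace _)
      (fun ζ => (hgp ζ).le) (hgp ⟨stdVec 0, by simp⟩).ne')

theorem log_bhDensity [NeZero n] (hx : x ∈ U) : Real.log (bhDensity f x)
    = Real.log (volume (Metric.ball (0 : Vec n) 1)).toReal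
      - Real.log (volume {y | f x y < 1}).toReal := by
  rw [bhDensity, Real.log_div _ (hf.volume_pos hx).ne']
  exact (ENNReal.toReal_pos (Metric.measure_ball_pos _ _ one_pos).ne' measure_ball_lt_top.ne).ne'

theorem contDiffOn_log_bhDensity [NeZero n] (m : ℕ) :
    ContDiffOn ℝ m (fun x => Real.log (bhDensity f x)) U :=
  (contDiffOn_const.sub ((hf.contDiffOn_volume m).log fun _ hx => (hf.volume_pos hx).ne')).congr
    fun _ hx => hf.log_bhDensity hx

/-- If `f` grows at the rate `ρ` along the vector `(v, A y)`, then the logarithm of the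
Busemann-Hausdorff density grows at the rate `n ρ - tr A` along `v`: the unit balls of
`y ↦ f (x + t v) (y + t A y)` and of `f (x + t v)` correspond to each other under `1 + t A`. -/
theorem fderiv_log_bhDensity [NeZero n] (hx : x ∈ U) {v : Vec n} {A : Vec n →L[ℝ] Vec n} {ρ : ℝ}
    (h : ∀ y, y ≠ 0 → fderiv ℝ (fun p : Vec n × Vec n => f p.1 p.2) (x, y) (v, A y) = ρ * f x y) :
    fderiv ℝ (fun x => Real.log (bhDensity f x)) x v = n * ρ - ∑ i, A (stdVec i) i := by
  let D : Vec n → ℝ := fun x => (volume {y | f x y < 1}).toReal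
  let a : Matrix (Fin n) (Fin n) ℝ := Matrix.of fun i j => A (stdVec j) i
  let T : ℝ → Vec n →ₗ[ℝ] Vec n := fun t => LinearMap.id + t • (A : Vec n →ₗ[ℝ] Vec n)
  have hT : ∀ t y, T t y = y + t • A y := fun t y => rfl
  have hdet : ∀ t, LinearMap.det (T t) = (1 + t • a).det := fun t => by
    rw [← LinearMap.det_toMatrix (EuclideanSpace.basisFun (Fin n) ℝ).toBasis]
    congr 1
    ext i j
    simp [LinearMap.toMatrix_apply, T, a, Matrix.one_apply]
  have hdd : HasDerivAt (fun t : ℝ => (1 + t • a).det) (∑ i, A (stdVec i) i) 0 :=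
    hasDerivAt_det_one_add_smul a
  have hd0 : (1 + (0 : ℝ) • a).det = 1 := by simp
  -- The parameters `t` for which `x + t v` stays in `U` and `1 + t A` is invertible.
  obtain ⟨W, hWs, hW, h0W⟩ : ∃ W : Set ℝ, (∀ t ∈ W, x + t • v ∈ U ∧ (1 + t • a).det ≠ 0) ∧
      IsOpen W ∧ (0 : ℝ) ∈ W := by
    have h1 : ∀ᶠ t : ℝ in 𝓝 0, x + t • v ∈ U :=
      ContinuousAt.eventually_mem (f := fun t : ℝ => x + t • v) (by fun_prop)
        (by simpa using hf.isOpen.mem_nhds hx)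
    have h2 : ∀ᶠ t : ℝ in 𝓝 0, (1 + t • a).det ≠ 0 :=
      hdd.continuousAt.eventually_ne (by rw [hd0]; exact one_ne_zero)
    exact eventually_nhds_iff.1 (h1.and h2)
  have hTne : ∀ t ∈ W, ∀ y : Vec n, y ≠ 0 → T t y ≠ 0 := fun t ht y hy h0 => by
    have h1 : IsUnit (LinearMap.det (T t)) := by
      rw [hdet]
      exact isUnit_iff_ne_zero.2 (hWs t ht).2
    have h2 := ((Module.End.isUnit_iff _).1 ((LinearMap.isUnit_iff_isUnit_det _).2 h1)).injective
    exact hy (h2 (h0.trans (map_zero (T t)).symm))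
  let G : ℝ × Vec n → ℝ := fun q => f (x + q.1 • v) (T q.1 q.2)
  have hmaps : Set.MapsTo (fun q : ℝ × Vec n => (x + q.1 • v, T q.1 q.2)) (W ×ˢ {0}ᶜ)
      (U ×ˢ {0}ᶜ) := fun q hq => ⟨(hWs q.1 hq.1).1, hTne q.1 hq.1 q.2 hq.2⟩
  have hsm : ContDiff ℝ ∞ (fun q : ℝ × Vec n => (x + q.1 • v, T q.1 q.2)) := by
    simp only [hT]
    fun_prop
  have hG : ContDiffOn ℝ ∞ G (W ×ˢ {0}ᶜ) := hf.contDiffOn.comp hsm.contDiffOn hmaps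
  have hGpos : ∀ t ∈ W, ∀ y, y ≠ 0 → 0 < G (t, y) := fun t ht y hy =>
    hf.pos _ (hWs t ht).1 _ (hTne t ht y hy)
  have hGn : ContDiffOn ℝ ∞ (fun q => (G q ^ n)⁻¹) (W ×ˢ {0}ᶜ) :=
    (hG.pow n).inv fun q hq => (pow_pos (hGpos q.1 hq.1 q.2 hq.2) n).ne'
  let H : ℝ → ℝ := fun t => (n : ℝ)⁻¹ *
    ∫ ζ : Metric.sphere (0 : Vec n) 1, (G (t, ζ) ^ n)⁻¹ ∂volume.toSphere
  have hH : ∀ t ∈ W, H t = (volume {y | G (t, y) < 1}).toReal := fun t ht => by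
    refine (volume_lt_one_eq_integral (g := fun y => G (t, y)) ?_ (hGpos t ht) ?_).symm
    · exact hG.continuousOn.comp (by fun_prop) fun y hy => ⟨ht, hy⟩
    · intro r y hr
      simp only [G, map_smul]
      exact hf.homog _ (hWs t ht).1 r _ hr
  have hHD : ∀ t ∈ W, D (x + t • v) = |(1 + t • a).det| * H t := fun t ht => by
    have h1 : {y | G (t, y) < 1} = T t ⁻¹' {z | f (x + t • v) z < 1} := rfl
    have h2 := (hWs t ht).2
    rw [hH t ht, h1, Measure.addHaar_preimage_linearMap _ (by rwa [hdet]), ENNReal.toReal_mul,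
      ENNReal.toReal_ofReal (abs_nonneg _), hdet, ← mul_assoc, ← abs_mul, mul_inv_cancel₀ h2,
      abs_one, one_mul]
  have hH' : HasDerivAt H (-(n * ρ) * H 0) 0 := by
    have h1 := (hasFDerivAt_integral_sphere hW hGn h0W).hasDerivAt
    have h2 : ∀ ζ : Metric.sphere (0 : Vec n) 1,
        (fderiv ℝ (fun q => (G q ^ n)⁻¹) (0, (ζ : Vec n))).comp
          (ContinuousLinearMap.inl ℝ ℝ (Vec n))
        = (-(n * ρ) * (G (0, (ζ : Vec n)) ^ n)⁻¹) • ContinuousLinearMap.id ℝ ℝ := by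
      intro ζ
      have hζ : (ζ : Vec n) ≠ 0 := ne_zero_of_mem_unit_sphere ζ
      have hmem : ((0 : ℝ), (ζ : Vec n)) ∈ W ×ˢ ({0}ᶜ : Set (Vec n)) := ⟨h0W, hζ⟩
      have hnhds := (hW.prod isOpen_compl_singleton).mem_nhds hmem
      have hpath : HasDerivAt (fun t : ℝ => (t, (ζ : Vec n))) (1, 0) 0 :=
        (hasDerivAt_id 0).prodMk (hasDerivAt_const _ _)
      have hG0 : HasDerivAt (fun t : ℝ => G (t, (ζ : Vec n))) (ρ * G (0, (ζ : Vec n))) 0 := by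
        have h3 : HasDerivAt (fun t : ℝ => (x + t • v, T t ζ)) (v, A ζ) 0 := by
          refine HasDerivAt.prodMk ?_ ?_
          · simpa using ((hasDerivAt_id (0 : ℝ)).smul_const v).const_add x
          · simp only [hT]
            simpa using ((hasDerivAt_id (0 : ℝ)).smul_const (A ζ)).const_add (ζ : Vec n)
        have h4 : HasFDerivAt (fun p : Vec n × Vec n => f p.1 p.2)
            (fderiv ℝ (fun p : Vec n × Vec n => f p.1 p.2) (x, ζ))
            (x + (0 : ℝ) • v, T 0 ζ) := by
          simpa [hT] using ((hf.contDiffAt hx hζ).differentiableAt (by simp)).hasFDerivAt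
        have h5 := h4.comp_hasDerivAt 0 h3
        rw [h _ hζ] at h5
        simpa [G, hT, Function.comp_def] using h5
      have hGn0 := ((hGn.contDiffAt hnhds).differentiableAt (by simp)).hasFDerivAt.comp_hasDerivAt 0
        hpath
      have h6 := hGn0.unique ((hG0.fun_pow n).fun_inv
        (pow_pos (hGpos 0 h0W ζ hζ) n).ne')
      ext
      simp only [ContinuousLinearMap.comp_apply, ContinuousLinearMap.inl_apply, _root_.smul_apply,
        ContinuousLinearMap.id_apply, smul_eq_mul, mul_one]
      rw [h6]
      have hG1 := (hGpos 0 h0W ζ hζ).ne'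
      have hpn : G (0, (ζ : Vec n)) ^ (n - 1) * G (0, (ζ : Vec n)) = G (0, (ζ : Vec n)) ^ n :=
        pow_sub_one_mul (NeZero.ne n) _
      field_simp
      rw [← hpn]
      ring
    simp only [h2, integral_smul_const, integral_const_mul] at h1
    have h7 : HasDerivAt H _ 0 := h1.const_mul (n : ℝ)⁻¹
    refine h7.congr_deriv ?_
    simp only [H, _root_.smul_apply, ContinuousLinearMap.id_apply, smul_eq_mul]
    ring
  have hD : DifferentiableAt ℝ D x :=
    ((hf.contDiffOn_volume 1).contDiffAt (hf.isOpen.mem_nhds hx)).differentiableAt (by simp)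
  have hline : HasDerivAt (fun t : ℝ => x + t • v) v 0 := by
    simpa using ((hasDerivAt_id (0 : ℝ)).smul_const v).const_add x
  have hDv : HasDerivAt (fun t : ℝ => D (x + t • v)) (fderiv ℝ D x v) 0 := by
    have h1 : HasFDerivAt D (fderiv ℝ D x) (x + (0 : ℝ) • v) := by simpa using hD.hasFDerivAt
    exact h1.comp_hasDerivAt 0 hline
  have hDv' : HasDerivAt (fun t : ℝ => D (x + t • v))
      ((∑ i, A (stdVec i) i) * H 0 + 1 * (-(n * ρ) * H 0)) 0 := by
    have h1 := hdd.fun_mul hH'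
    rw [hd0] at h1
    refine h1.congr_of_eventuallyEq ?_
    filter_upwards [hW.mem_nhds h0W, hdd.continuousAt.eventually_const_lt
      (show (0 : ℝ) < (1 + (0 : ℝ) • a).det by rw [hd0]; exact one_pos)] with t ht ht'
    rw [hHD t ht, abs_of_pos ht']
  have hD0 : D x = H 0 := by simpa [hd0] using hHD 0 h0W
  have hpos : 0 < D x := hf.volume_pos hx
  have h1 : (fun x => Real.log (bhDensity f x)) =ᶠ[𝓝 x] fun x =>
      Real.log (volume (Metric.ball (0 : Vec n) 1)).toReal - Real.log (D x) := by
    filter_upwards [hf.isOpen.mem_nhds hx] with z hz using hf.log_bhDensity hz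
  rw [h1.fderiv_eq, fderiv_const_sub, _root_.neg_apply, fderiv.log hD hpos.ne', _root_.smul_apply,
    hDv.unique hDv', smul_eq_mul, ← hD0]
  field_simp
  ring

end IsFinslerOn

end FinslerCoord

/-! ### The geodesic spray in coordinates -/

namespace FinslerCoord

/-- The energy `L = F²` as a function on the product `ℝⁿ × ℝⁿ`. -/
def totalEnergy {n : ℕ} (f : Vec n → Vec n → ℝ) (p : Vec n × Vec n) : ℝ := energy f p.1 p.2

/-- The vector `(G¹, …, Gⁿ)` of spray coefficients as a function on the product `ℝⁿ × ℝⁿ`. -/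
def sprayVec {n : ℕ} (f : Vec n → Vec n → ℝ) (p : Vec n × Vec n) : Vec n :=
  WithLp.toLp 2 fun i => sprayCoeff f i p.1 p.2

/-- The complete lift `(V, DV y)` of a vector field `V`. -/
def completeLift {n : ℕ} (V : Vec n → Vec n) (p : Vec n × Vec n) : Vec n × Vec n :=
  (V p.1, fderiv ℝ V p.1 p.2)

/-- The geodesic spray `(y, -2 G)`. -/
def sprayField {n : ℕ} (f : Vec n → Vec n → ℝ) (p : Vec n × Vec n) : Vec n × Vec n :=
  (p.2, (-2 : ℝ) • sprayVec f p)

section Partial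

variable {n : ℕ} {h : Vec n → Vec n → ℝ} {x y : Vec n}

theorem pdx_eq (hh : DifferentiableAt ℝ (fun p : Vec n × Vec n => h p.1 p.2) (x, y)) (i : Fin n) :
    pdx h i x y = fderiv ℝ (fun p : Vec n × Vec n => h p.1 p.2) (x, y) (stdVec i, 0) := by
  have h1 := hh.hasFDerivAt.comp (f := fun e => (e, y)) x (hasFDerivAt_prodMk_left x y)
  exact congrArg (fun T : Vec n →L[ℝ] ℝ => T (stdVec i)) h1.fderiv

theorem fderiv_snd_eq {G : Type*} [NormedAddCommGroup G] [NormedSpace ℝ G] {k : Vec n × Vec n → G}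
    (hk : DifferentiableAt ℝ k (x, y)) (w : Vec n) :
    fderiv ℝ (fun z => k (x, z)) y w = fderiv ℝ k (x, y) (0, w) := by
  have h1 := hk.hasFDerivAt.comp (f := fun e => (x, e)) y (hasFDerivAt_prodMk_right x y)
  exact congrArg (fun T : Vec n →L[ℝ] G => T w) h1.fderiv

theorem pdy_eq (hh : DifferentiableAt ℝ (fun p : Vec n × Vec n => h p.1 p.2) (x, y)) (i : Fin n) :
    pdy h i x y = fderiv ℝ (fun p : Vec n × Vec n => h p.1 p.2) (x, y) (0, stdVec i) :=
  fderiv_snd_eq (k := fun p : Vec n × Vec n => h p.1 p.2) hh _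

end Partial

namespace IsFinslerOn

variable {n : ℕ} {U : Set (Vec n)} {f : Vec n → Vec n → ℝ} (hf : IsFinslerOn U f) {x y : Vec n}

include hf

theorem contDiffOn_totalEnergy : ContDiffOn ℝ ∞ (totalEnergy f) (U ×ˢ {0}ᶜ) :=
  hf.contDiffOn.pow 2

theorem contDiffOn_fderiv_totalEnergy :
    ContDiffOn ℝ ∞ (fderiv ℝ (totalEnergy f)) (U ×ˢ {0}ᶜ) :=
  hf.contDiffOn_totalEnergy.fderiv_of_isOpen hf.isOpen_slit (by simp)

theorem contDiffOn_fderiv2_totalEnergy :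
    ContDiffOn ℝ ∞ (fderiv ℝ (fderiv ℝ (totalEnergy f))) (U ×ˢ {0}ᶜ) :=
  hf.contDiffOn_fderiv_totalEnergy.fderiv_of_isOpen hf.isOpen_slit (by simp)

theorem contDiffAt_totalEnergy (hx : x ∈ U) (hy : y ≠ 0) :
    ContDiffAt ℝ ∞ (totalEnergy f) (x, y) :=
  hf.contDiffOn_totalEnergy.contDiffAt (hf.isOpen_slit.mem_nhds ⟨hx, hy⟩)

theorem contDiffAt_fderiv_totalEnergy (hx : x ∈ U) (hy : y ≠ 0) :
    ContDiffAt ℝ ∞ (fderiv ℝ (totalEnergy f)) (x, y) :=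
  hf.contDiffOn_fderiv_totalEnergy.contDiffAt (hf.isOpen_slit.mem_nhds ⟨hx, hy⟩)

theorem contDiffAt_fderiv2_totalEnergy (hx : x ∈ U) (hy : y ≠ 0) :
    ContDiffAt ℝ ∞ (fderiv ℝ (fderiv ℝ (totalEnergy f))) (x, y) :=
  hf.contDiffOn_fderiv2_totalEnergy.contDiffAt (hf.isOpen_slit.mem_nhds ⟨hx, hy⟩)

theorem fderiv_energy (hx : x ∈ U) (hy : y ≠ 0) (w : Vec n) :
    fderiv ℝ (energy f x) y w = fderiv ℝ (totalEnergy f) (x, y) (0, w) :=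
  fderiv_snd_eq (k := totalEnergy f) ((hf.contDiffAt_totalEnergy hx hy).differentiableAt (by simp)) w

theorem fderiv2_energy (hx : x ∈ U) (hy : y ≠ 0) (v w : Vec n) :
    fderiv ℝ (fderiv ℝ (energy f x)) y v w
      = fderiv ℝ (fderiv ℝ (totalEnergy f)) (x, y) (0, v) (0, w) := by
  have h1 : fderiv ℝ (energy f x) =ᶠ[𝓝 y] fun z =>
      (fderiv ℝ (totalEnergy f) (x, z)).comp (ContinuousLinearMap.inr ℝ (Vec n) (Vec n)) := by
    filter_upwards [isOpen_ne.mem_nhds hy] with z hz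
    ext w
    exact hf.fderiv_energy hx hz w
  have hd := (hf.contDiffAt_fderiv_totalEnergy hx hy).differentiableAt (by simp)
  rw [h1.fderiv_eq, fderiv_snd_eq (k := fun p => (fderiv ℝ (totalEnergy f) p).comp
    (ContinuousLinearMap.inr ℝ (Vec n) (Vec n))) (hd.clm_comp (differentiableAt_const _)),
    fderiv_clm_comp hd (differentiableAt_const _)]
  simp

theorem fderiv2_totalEnergy_self (hx : x ∈ U) (hy : y ≠ 0) (w : Vec n) :
    fderiv ℝ (fderiv ℝ (totalEnergy f)) (x, y) (0, y) (0, w)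
      = fderiv ℝ (totalEnergy f) (x, y) (0, w) := by
  rw [← hf.fderiv2_energy hx hy, (hf.isMinkowskiEnergy hx).fderiv2_self hy, hf.fderiv_energy hx hy]

theorem fundMatrix_eq (hx : x ∈ U) (hy : y ≠ 0) :
    fundMatrix f x y = (2 : ℝ)⁻¹ • hessMatrix (energy f x) y := by
  ext i j
  have hM := hf.isMinkowskiEnergy hx
  simp only [fundMatrix, hessMatrix, Matrix.of_apply, Matrix.smul_apply, smul_eq_mul, one_div]
  congr 1
  rw [hM.fderiv2_symm hy]
  have h1 := fderiv_clm_apply (𝕜 := ℝ) (c := fderiv ℝ (energy f x)) (u := fun _ => stdVec i) (x := y)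
    ((hM.contDiffAt_fderiv hy).differentiableAt (by simp)) (differentiableAt_const _)
  exact (congrArg (fun T : Vec n →L[ℝ] ℝ => T (stdVec j)) h1).trans (by simp)

theorem pdx_energy (hx : x ∈ U) (hy : y ≠ 0) (i : Fin n) :
    pdx (energy f) i x y = fderiv ℝ (totalEnergy f) (x, y) (stdVec i, 0) :=
  pdx_eq ((hf.contDiffAt_totalEnergy hx hy).differentiableAt (by simp)) i

theorem pdy_pdx_energy (hx : x ∈ U) (hy : y ≠ 0) (k l : Fin n) :
    pdy (pdx (energy f) k) l x y
      = fderiv ℝ (fderiv ℝ (totalEnergy f)) (x, y) (0, stdVec l) (stdVec k, 0) := by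
  have h1 : pdx (energy f) k x =ᶠ[𝓝 y] fun z =>
      fderiv ℝ (totalEnergy f) (x, z) (stdVec k, 0) := by
    filter_upwards [isOpen_ne.mem_nhds hy] with z hz using hf.pdx_energy hx hz k
  have hd := (hf.contDiffAt_fderiv_totalEnergy hx hy).differentiableAt (by simp)
  have h2 : pdy (pdx (energy f) k) l x y = fderiv ℝ (pdx (energy f) k x) y (stdVec l) := rfl
  rw [h2, h1.fderiv_eq, fderiv_snd_eq (k := fun p => fderiv ℝ (totalEnergy f) p (stdVec k, 0))
    (hd.clm_apply (differentiableAt_const _)), fderiv_clm_apply hd (differentiableAt_const _)]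
  simp

theorem sum_pdy_pdx_energy (hx : x ∈ U) (hy : y ≠ 0) (l : Fin n) :
    ∑ k, pdy (pdx (energy f) k) l x y * y k
      = fderiv ℝ (fderiv ℝ (totalEnergy f)) (x, y) (0, stdVec l) (y, 0) := by
  have h1 := map_eq_sum_stdVec ((fderiv ℝ (fderiv ℝ (totalEnergy f)) (x, y) (0, stdVec l)).comp
    (ContinuousLinearMap.inl ℝ (Vec n) (Vec n))) y
  simp only [ContinuousLinearMap.comp_apply, ContinuousLinearMap.inl_apply] at h1
  rw [h1]
  refine Finset.sum_congr rfl fun k _ => ?_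
  rw [hf.pdy_pdx_energy hx hy, smul_eq_mul, mul_comm]

theorem sprayCoeff_eq (hx : x ∈ U) (hy : y ≠ 0) (i : Fin n) :
    sprayCoeff f i x y = (2 : ℝ)⁻¹ * ∑ l, (hessMatrix (energy f x) y)⁻¹ i l *
      (fderiv ℝ (fderiv ℝ (totalEnergy f)) (x, y) (0, stdVec l) (y, 0)
        - fderiv ℝ (totalEnergy f) (x, y) (stdVec l, 0)) := by
  have hM := hf.isMinkowskiEnergy hx
  have h2 : (fundMatrix f x y)⁻¹ = (2 : ℝ) • (hessMatrix (energy f x) y)⁻¹ := by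
    rw [hf.fundMatrix_eq hx hy]
    refine Matrix.inv_eq_right_inv ?_
    rw [Matrix.smul_mul, Matrix.mul_smul, Matrix.mul_nonsing_inv _ (hM.isUnit_det hy), smul_smul]
    norm_num
  simp only [sprayCoeff]
  rw [h2, Finset.mul_sum, Finset.mul_sum]
  refine Finset.sum_congr rfl fun l _ => ?_
  rw [hf.sum_pdy_pdx_energy hx hy, hf.pdx_energy hx hy, Matrix.smul_apply, smul_eq_mul]
  ring

theorem contDiffOn_sprayVec : ContDiffOn ℝ ∞ (sprayVec f) (U ×ˢ {0}ᶜ) := by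
  rw [contDiffOn_euclidean]
  intro i
  have h2 := hf.contDiffOn_fderiv2_totalEnergy
  have h1 := hf.contDiffOn_fderiv_totalEnergy
  let A : Vec n × Vec n → Matrix (Fin n) (Fin n) ℝ := fun p => Matrix.of fun i j =>
    fderiv ℝ (fderiv ℝ (totalEnergy f)) p (0, stdVec i) (0, stdVec j)
  have hA : ∀ p ∈ U ×ˢ ({0}ᶜ : Set (Vec n)), A p = hessMatrix (energy f p.1) p.2 := fun p hp => by
    ext i j
    exact (hf.fderiv2_energy hp.1 hp.2 _ _).symm
  have hAi : ∀ i j, ContDiffOn ℝ ∞ (fun p => (A p)⁻¹ i j) (U ×ˢ {0}ᶜ) := fun i j p hp => by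
    refine (contDiffAt_inv_apply (fun i j => ?_) ?_ i j).contDiffWithinAt
    · exact (((h2.contDiffAt (hf.isOpen_slit.mem_nhds hp)).clm_apply contDiffAt_const).clm_apply
        contDiffAt_const)
    · rw [hA p hp]
      exact ((hf.isMinkowskiEnergy hp.1).det_hessMatrix_pos hp.2).ne'
  have h3 : ContDiffOn ℝ ∞ (fun p : Vec n × Vec n => (2 : ℝ)⁻¹ * ∑ l, (A p)⁻¹ i l *
      (fderiv ℝ (fderiv ℝ (totalEnergy f)) p (0, stdVec l) (p.2, 0)
        - fderiv ℝ (totalEnergy f) p (stdVec l, 0))) (U ×ˢ {0}ᶜ) :=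
    contDiffOn_const.mul (ContDiffOn.sum fun l _ => (hAi i l).mul
      (((h2.clm_apply contDiffOn_const).clm_apply (by fun_prop)).sub
        (h1.clm_apply contDiffOn_const)))
  refine h3.congr fun p hp => ?_
  rw [hA p hp]
  exact hf.sprayCoeff_eq hp.1 hp.2 i

theorem contDiffAt_sprayVec (hx : x ∈ U) (hy : y ≠ 0) : ContDiffAt ℝ ∞ (sprayVec f) (x, y) :=
  hf.contDiffOn_sprayVec.contDiffAt (hf.isOpen_slit.mem_nhds ⟨hx, hy⟩)

theorem fderiv2_sprayVec (hx : x ∈ U) (hy : y ≠ 0) (w : Vec n) :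
    2 * fderiv ℝ (fderiv ℝ (totalEnergy f)) (x, y) (0, sprayVec f (x, y)) (0, w)
      = fderiv ℝ (fderiv ℝ (totalEnergy f)) (x, y) (0, w) (y, 0)
        - fderiv ℝ (totalEnergy f) (x, y) (w, 0) := by
  have hM := hf.isMinkowskiEnergy hx
  let ℓ : Vec n →L[ℝ] ℝ :=
    ((ContinuousLinearMap.apply ℝ ℝ ((y, 0) : Vec n × Vec n)).comp
      (fderiv ℝ (fderiv ℝ (totalEnergy f)) (x, y))).comp (ContinuousLinearMap.inr ℝ _ _)
      - (fderiv ℝ (totalEnergy f) (x, y)).comp (ContinuousLinearMap.inl ℝ _ _)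
  have h1 : sprayVec f (x, y) = (2 : ℝ)⁻¹ • dualVec (energy f x) ℓ y := by
    ext i
    exact hf.sprayCoeff_eq hx hy i
  rw [← hf.fderiv2_energy hx hy, h1, map_smul, _root_.smul_apply, hM.fderiv2_dualVec hy,
    smul_eq_mul, mul_inv_cancel_left₀ two_ne_zero]
  simp [ℓ]

/-- The Euler-Lagrange equation of the geodesics: the derivative of `∂L/∂yˡ` along the spray is
`∂L/∂xˡ`. -/
theorem fderiv2_sprayField (hx : x ∈ U) (hy : y ≠ 0) (w : Vec n) :
    fderiv ℝ (fderiv ℝ (totalEnergy f)) (x, y) (sprayField f (x, y)) (0, w)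
      = fderiv ℝ (totalEnergy f) (x, y) (w, 0) := by
  have h1 : sprayField f (x, y) = (y, 0) - (2 : ℝ) • (0, sprayVec f (x, y)) := by
    simp [sprayField]
  rw [h1, map_sub, map_smul, _root_.sub_apply, _root_.smul_apply, smul_eq_mul,
    hf.fderiv2_sprayVec hx hy, fderiv_fderiv_comm (hf.contDiffAt_totalEnergy hx hy) (y, 0)]
  ring

theorem sprayCoeff_homog (hx : x ∈ U) (i : Fin n) (r : ℝ) (hr : 0 < r) (y : Vec n) (hy : y ≠ 0) :
    sprayCoeff f i x (r • y) = r ^ 2 • sprayCoeff f i x y := by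
  have hpdx : ∀ k (r : ℝ), 0 < r → ∀ y, y ≠ 0 →
      pdx (energy f) k x (r • y) = r ^ 2 • pdx (energy f) k x y := fun k r hr y hy => by
    have h1 : (fun z => energy f z (r • y)) =ᶠ[𝓝 x] r ^ 2 • fun z => energy f z y := by
      filter_upwards [hf.isOpen.mem_nhds hx] with z hz
      exact (hf.isMinkowskiEnergy hz).homog r y hr.le
    simp only [pdx]
    rw [h1.fderiv_eq, fderiv_const_smul_field]
    rfl
  have hpdy : ∀ k l, pdy (pdx (energy f) k) l x (r • y)
      = r * pdy (pdx (energy f) k) l x y := fun k l => by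
    have h1 := fderiv_of_homogeneous (hpdx k) r hr y hy
    have h2 := congrArg (fun T : Vec n →L[ℝ] ℝ => T (stdVec l)) h1
    simpa only [pow_one] using! h2
  have hg : fundMatrix f x (r • y) = fundMatrix f x y := by
    rw [hf.fundMatrix_eq hx hy, hf.fundMatrix_eq hx (smul_ne_zero hr.ne' hy)]
    congr 1
    ext i j
    simp only [hessMatrix, Matrix.of_apply]
    rw [(hf.isMinkowskiEnergy hx).homog_fderiv2 r hr y hy, pow_zero, one_smul]
  simp only [sprayCoeff, hg, hpdy, hpdx _ r hr y hy, smul_eq_mul]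
  rw [Finset.mul_sum, Finset.mul_sum, Finset.mul_sum]
  refine Finset.sum_congr rfl fun l _ => ?_
  have h3 : ∑ k, r * pdy (pdx (energy f) k) l x y * (r • y) k
      = r ^ 2 * ∑ k, pdy (pdx (energy f) k) l x y * y k := by
    rw [Finset.mul_sum]
    refine Finset.sum_congr rfl fun k _ => ?_
    simp only [PiLp.smul_apply, smul_eq_mul]
    ring
  rw [h3]
  ring

theorem contDiffAt_sprayCoeff (hx : x ∈ U) (hy : y ≠ 0) (i : Fin n) :
    ContDiffAt ℝ ∞ (sprayCoeff f i x) y :=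
  (contDiffAt_euclidean.1 (hf.contDiffAt_sprayVec hx hy) i).comp y (f := fun z => (x, z))
    (by fun_prop)

theorem nonlinearConn_eq (hx : x ∈ U) (hy : y ≠ 0) (i j : Fin n) :
    nonlinearConn f i j x y = fderiv ℝ (sprayVec f) (x, y) (0, stdVec j) i := by
  have hd := (hf.contDiffAt_sprayVec hx hy).differentiableAt (by simp)
  rw [← fderiv_coord hd]
  exact pdy_eq (h := sprayCoeff f i)
    ((contDiffAt_euclidean.1 (hf.contDiffAt_sprayVec hx hy) i).differentiableAt (by simp)) j

theorem sum_nonlinearConn (hx : x ∈ U) (hy : y ≠ 0) (i : Fin n) :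
    ∑ j, y j * nonlinearConn f i j x y = 2 * sprayCoeff f i x y := by
  have h1 := fderiv_self_of_homogeneous (hf.sprayCoeff_homog hx i) hy
    ((hf.contDiffAt_sprayCoeff hx hy i).differentiableAt (by simp))
  rw [map_eq_sum_stdVec] at h1
  simpa only [Nat.cast_ofNat, Nat.cast_one, one_smul] using! h1

theorem sum_berwaldConn (hx : x ∈ U) (hy : y ≠ 0) (i j : Fin n) :
    ∑ k, y k * berwaldConn f i j k x y = nonlinearConn f i j x y := by
  have h0 : ∀ r : ℝ, 0 < r → ∀ y, y ≠ 0 →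
      nonlinearConn f i j x (r • y) = r ^ 1 • nonlinearConn f i j x y := fun r hr y hy => by
    have h1 := fderiv_of_homogeneous (hf.sprayCoeff_homog hx i) r hr y hy
    exact congrArg (fun T : Vec n →L[ℝ] ℝ => T (stdVec j)) h1
  have h2 : ContDiffAt ℝ ∞ (nonlinearConn f i j x) y :=
    ((hf.contDiffAt_sprayCoeff hx hy i).fderiv_right (m := ∞) (by simp)).clm_apply contDiffAt_const
  have h1 := fderiv_self_of_homogeneous h0 hy (h2.differentiableAt (by simp))
  rw [map_eq_sum_stdVec] at h1
  simpa only [Nat.cast_ofNat, Nat.cast_one, one_smul] using! h1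

end IsFinslerOn

end FinslerCoord

/-! ### Conformality and S-curvature in coordinates -/

namespace FinslerCoord

namespace IsFinslerOn

variable {n : ℕ} {U : Set (Vec n)} {f : Vec n → Vec n → ℝ} (hf : IsFinslerOn U f) {x y : Vec n}
  {V : Vec n → Vec n}

include hf

theorem lowered_eq (hx : x ∈ U) (hy : y ≠ 0) (i : Fin n) :
    lowered f V i x y = (2 : ℝ)⁻¹ * fderiv ℝ (fderiv ℝ (energy f x)) y (stdVec i) (V x) := by
  simp only [lowered]
  rw [hf.fundMatrix_eq hx hy, map_eq_sum_stdVec _ (V x), Finset.mul_sum]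
  refine Finset.sum_congr rfl fun m _ => ?_
  simp only [hessMatrix, Matrix.smul_apply, Matrix.of_apply, smul_eq_mul]
  ring

/-- The contraction `V_{0|0}` is half the derivative of `F²` along the complete lift of `V`. -/
theorem covDeriv00_eq (hV : DifferentiableAt ℝ V x) (hx : x ∈ U) (hy : y ≠ 0) :
    covDeriv00 f V x y
      = (2 : ℝ)⁻¹ * fderiv ℝ (totalEnergy f) (x, y) (completeLift V (x, y)) := by
  have hM := hf.isMinkowskiEnergy hx
  have h2 := (hf.contDiffAt_fderiv2_totalEnergy hx hy).differentiableAt (by simp)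
  have h1 := (hf.contDiffAt_fderiv_totalEnergy hx hy).differentiableAt (by simp)
  have hline : DifferentiableAt ℝ (fun z : Vec n => (z, y)) x := by fun_prop
  have hVx : DifferentiableAt ℝ (fun z : Vec n => ((0 : Vec n), V z)) x :=
    (differentiableAt_const _).prodMk hV
  -- The horizontal part: `yⁱ Vᵢ = ½ ∂L/∂yᵐ Vᵐ`.
  have hx1 : ∀ i, DifferentiableAt ℝ (fun z => lowered f V i z y) x := fun i => by
    have h3 : (fun z => lowered f V i z y) =ᶠ[𝓝 x] fun z =>
        (2 : ℝ)⁻¹ * fderiv ℝ (fderiv ℝ (totalEnergy f)) (z, y) (0, stdVec i) (0, V z) := by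
      filter_upwards [hf.isOpen.mem_nhds hx] with z hz
      rw [hf.lowered_eq hz hy, hf.fderiv2_energy hz hy]
    refine DifferentiableAt.congr_of_eventuallyEq ?_ h3
    exact (differentiableAt_const _).mul
      (((h2.comp x hline).clm_apply (differentiableAt_const _)).clm_apply hVx)
  have hT1 : ∑ i, ∑ j, pdx (lowered f V i) j x y * y i * y j
      = (2 : ℝ)⁻¹ * (fderiv ℝ (fderiv ℝ (totalEnergy f)) (x, y) (y, 0) (0, V x)
        + fderiv ℝ (totalEnergy f) (x, y) (0, fderiv ℝ V x y)) := by
    have e1 : ∀ i, ∑ j, pdx (lowered f V i) j x y * y i * y j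
        = fderiv ℝ (fun z => y i * lowered f V i z y) x y := fun i => by
      rw [fderiv_const_mul (hx1 i), _root_.smul_apply, map_eq_sum_stdVec, smul_eq_mul,
        Finset.mul_sum]
      refine Finset.sum_congr rfl fun j _ => ?_
      simp only [pdx, smul_eq_mul]
      ring
    have e2 : (fun z => ∑ i, y i * lowered f V i z y) =ᶠ[𝓝 x] fun z =>
        (2 : ℝ)⁻¹ * fderiv ℝ (totalEnergy f) (z, y) (0, V z) := by
      filter_upwards [hf.isOpen.mem_nhds hx] with z hz
      rw [← hf.fderiv2_totalEnergy_self hz hy, ← hf.fderiv2_energy hz hy, map_eq_sum_stdVec _ y,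
        _root_.sum_apply, Finset.mul_sum]
      refine Finset.sum_congr rfl fun i _ => ?_
      rw [hf.lowered_eq hz hy, _root_.smul_apply, smul_eq_mul]
      ring
    have e3 := fderiv_fun_sum (𝕜 := ℝ) (u := Finset.univ) (x := x)
      (A := fun i z => y i * lowered f V i z y) fun i _ => (hx1 i).const_mul _
    rw [Finset.sum_congr rfl fun i _ => e1 i, ← _root_.sum_apply, ← e3, e2.fderiv_eq]
    have h1' : DifferentiableAt ℝ (fun z => fderiv ℝ (totalEnergy f) (z, y)) x := h1.comp x hline
    have e4 : fderiv ℝ (fun z => fderiv ℝ (totalEnergy f) (z, y)) x y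
        = fderiv ℝ (fderiv ℝ (totalEnergy f)) (x, y) (y, 0) := by
      have h4 := h1.hasFDerivAt.comp (f := fun e => (e, y)) x (hasFDerivAt_prodMk_left x y)
      exact congrArg (fun T : Vec n →L[ℝ] _ => T y) h4.fderiv
    have e5 : fderiv ℝ (fun z : Vec n => ((0 : Vec n), V z)) x y = (0, fderiv ℝ V x y) := by
      have h4 := (hasFDerivAt_const (0 : Vec n) x).prodMk hV.hasFDerivAt
      exact congrArg (fun T : Vec n →L[ℝ] _ => T y) h4.fderiv
    have e6 := fderiv_clm_apply (𝕜 := ℝ) (c := fun z => fderiv ℝ (totalEnergy f) (z, y)) h1' hVx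
    rw [fderiv_const_mul (h1'.clm_apply hVx), _root_.smul_apply, e6, smul_eq_mul]
    simp only [_root_.add_apply, ContinuousLinearMap.comp_apply, ContinuousLinearMap.flip_apply,
      e4, e5]
    ring
  -- The vertical part vanishes, because `yⁱ ∂gᵢₘ/∂yᵏ = 0`.
  have hT2 : ∀ k, ∑ i, y i * pdy (lowered f V i) k x y = 0 := fun k => by
    have h3 := hM.differentiableAt_fderiv2 hy
    have e1 : ∀ i, fderiv ℝ (lowered f V i x) y = (2 : ℝ)⁻¹ •
        fderiv ℝ (fun z => fderiv ℝ (fderiv ℝ (energy f x)) z (stdVec i) (V x)) y := fun i => by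
      have e2 : lowered f V i x =ᶠ[𝓝 y] (2 : ℝ)⁻¹ • fun z =>
          fderiv ℝ (fderiv ℝ (energy f x)) z (stdVec i) (V x) := by
        filter_upwards [isOpen_ne.mem_nhds hy] with z hz using hf.lowered_eq hx hz i
      rw [e2.fderiv_eq, fderiv_const_smul_field]
      rfl
    have e3 : ∀ i, y i * pdy (lowered f V i) k x y = (2 : ℝ)⁻¹ *
        (y i * fderiv ℝ (fderiv ℝ (fderiv ℝ (energy f x))) y (stdVec k) (V x) (stdVec i)) :=
      fun i => by
        have e4 : pdy (lowered f V i) k x y = fderiv ℝ (lowered f V i x) y (stdVec k) := rfl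
        rw [e4, e1, _root_.smul_apply, IsMinkowskiEnergy.fderiv_apply_apply h3,
          hM.fderiv3_symm_right hy, smul_eq_mul]
        ring
    rw [Finset.sum_congr rfl fun i _ => e3 i, ← Finset.mul_sum]
    have e5 := map_eq_sum_stdVec
      (fderiv ℝ (fderiv ℝ (fderiv ℝ (energy f x))) y (stdVec k) (V x)) y
    rw [hM.fderiv3_symm_right hy, hM.fderiv3_symm_left hy, hM.fderiv3_self hy] at e5
    simp only [smul_eq_mul, _root_.zero_apply] at e5
    rw [← e5, mul_zero]
  have hT3 : ∑ k, 2 * sprayCoeff f k x y * lowered f V k x y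
      = fderiv ℝ (fderiv ℝ (totalEnergy f)) (x, y) (0, sprayVec f (x, y)) (0, V x) := by
    rw [← hf.fderiv2_energy hx hy, map_eq_sum_stdVec _ (sprayVec f (x, y)), _root_.sum_apply]
    refine Finset.sum_congr rfl fun k _ => ?_
    rw [hf.lowered_eq hx hy, _root_.smul_apply, smul_eq_mul]
    simp only [sprayVec]
    ring
  have hsum : covDeriv00 f V x y = ∑ i, ∑ j, pdx (lowered f V i) j x y * y i * y j
      - ∑ k, 2 * sprayCoeff f k x y * (∑ i, y i * pdy (lowered f V i) k x y)
      - ∑ k, 2 * sprayCoeff f k x y * lowered f V k x y := by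
    have e1 : ∑ i, ∑ j, ∑ k, nonlinearConn f k j x y * pdy (lowered f V i) k x y * y i * y j
        = ∑ k, 2 * sprayCoeff f k x y * (∑ i, y i * pdy (lowered f V i) k x y) := by
      rw [Finset.sum_congr rfl fun i _ => Finset.sum_comm, Finset.sum_comm]
      refine Finset.sum_congr rfl fun k _ => ?_
      rw [← hf.sum_nonlinearConn hx hy, Finset.mul_sum]
      refine Finset.sum_congr rfl fun i _ => ?_
      rw [Finset.sum_mul]
      exact Finset.sum_congr rfl fun j _ => by ring
    have e2 : ∑ i, ∑ j, ∑ k, berwaldConn f k i j x y * lowered f V k x y * y i * y j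
        = ∑ k, 2 * sprayCoeff f k x y * lowered f V k x y := by
      rw [Finset.sum_congr rfl fun i _ => Finset.sum_comm, Finset.sum_comm]
      refine Finset.sum_congr rfl fun k _ => ?_
      rw [← hf.sum_nonlinearConn hx hy, Finset.sum_mul]
      refine Finset.sum_congr rfl fun i _ => ?_
      rw [← hf.sum_berwaldConn hx hy, Finset.mul_sum, Finset.sum_mul]
      exact Finset.sum_congr rfl fun j _ => by ring
    rw [← e1, ← e2]
    simp only [covDeriv00, covDeriv, horizDeriv, sub_mul, Finset.sum_mul, Finset.sum_sub_distrib]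
  rw [hsum, hT1, hT3, Finset.sum_congr rfl fun k _ => by rw [hT2 k, mul_zero],
    Finset.sum_const_zero, sub_zero]
  have h4 := hf.fderiv2_sprayVec hx hy (V x)
  have h5 := fderiv_fderiv_comm (hf.contDiffAt_totalEnergy hx hy) (y, 0) (0, V x)
  have h6 : completeLift V (x, y) = (V x, 0) + (0, fderiv ℝ V x y) := by simp [completeLift]
  rw [h6, map_add, h5]
  linarith

/-- The S-curvature in terms of the divergence of the spray coefficients. -/
theorem sCurvature_eq (hx : x ∈ U) (hy : y ≠ 0) :
    sCurvature f x y = ∑ m, fderiv ℝ (sprayVec f) (x, y) (0, stdVec m) m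
      - fderiv ℝ (fun x => Real.log (bhDensity f x)) x y := by
  rw [sCurvature, map_eq_sum_stdVec _ y]
  congr 1
  exact Finset.sum_congr rfl fun m _ => hf.nonlinearConn_eq hx hy m m

end IsFinslerOn

end FinslerCoord

/-! ### The Lie derivative of the spray -/

namespace FinslerCoord

/-- The commutator of the derivatives of a function along two vector fields is its derivative along
their Lie bracket. -/
theorem fderiv_lieBracket {X : Type*} [NormedAddCommGroup X] [NormedSpace ℝ X] {h : X → ℝ}
    {A B : X → X} {p : X} (hh : ContDiffAt ℝ ∞ h p) (hA : DifferentiableAt ℝ A p)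
    (hB : DifferentiableAt ℝ B p) :
    fderiv ℝ (fun q => fderiv ℝ h q (B q)) p (A p) - fderiv ℝ (fun q => fderiv ℝ h q (A q)) p (B p)
      = fderiv ℝ h p (VectorField.lieBracket ℝ A B p) := by
  have h1 : DifferentiableAt ℝ (fderiv ℝ h) p :=
    (hh.fderiv_right (m := ∞) (by simp)).differentiableAt (by simp)
  rw [fderiv_clm_apply h1 hB, fderiv_clm_apply h1 hA, VectorField.lieBracket, map_sub]
  simp only [_root_.add_apply, ContinuousLinearMap.comp_apply, ContinuousLinearMap.flip_apply]
  rw [fderiv_fderiv_comm hh]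
  ring

/-- The Lie derivative `V(Gⁱ) - Gᵏ ∂Vⁱ/∂xᵏ + ½ yʲ yᵏ ∂²Vⁱ/∂xʲ∂xᵏ` of the spray coefficients along
`V`, where `V(Gⁱ)` is the derivative along the complete lift. -/
def lieSpray {n : ℕ} (f : Vec n → Vec n → ℝ) (V : Vec n → Vec n) (p : Vec n × Vec n) : Vec n :=
  fderiv ℝ (sprayVec f) p (completeLift V p)
    + (2 : ℝ)⁻¹ • fderiv ℝ (fderiv ℝ V) p.1 p.2 p.2 - fderiv ℝ V p.1 (sprayVec f p)

/-- The divergence `∂Gᵐ/∂yᵐ` of the spray coefficients. -/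
def sprayDivergence {n : ℕ} (f : Vec n → Vec n → ℝ) (p : Vec n × Vec n) : ℝ :=
  ∑ m, fderiv ℝ (sprayVec f) p (0, stdVec m) m

theorem differentiableAt_completeLift {n : ℕ} {V : Vec n → Vec n} {x : Vec n}
    (hVx : ContDiffAt ℝ ∞ V x) (y : Vec n) : DifferentiableAt ℝ (completeLift V) (x, y) := by
  have h1 : DifferentiableAt ℝ (fderiv ℝ V) x :=
    (hVx.fderiv_right (m := ∞) (by simp)).differentiableAt (by simp)
  have h0 : DifferentiableAt ℝ V x := hVx.differentiableAt (by simp)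
  exact (h0.comp (x, y) differentiableAt_fst).prodMk
    ((h1.comp (x, y) differentiableAt_fst).clm_apply differentiableAt_snd)

theorem fderiv_completeLift {n : ℕ} {V : Vec n → Vec n} {x : Vec n}
    (hVx : ContDiffAt ℝ ∞ V x) (y : Vec n) (v : Vec n × Vec n) :
    fderiv ℝ (completeLift V) (x, y) v
      = (fderiv ℝ V x v.1, fderiv ℝ V x v.2 + fderiv ℝ (fderiv ℝ V) x v.1 y) := by
  have h1 : DifferentiableAt ℝ (fderiv ℝ V) x :=
    (hVx.fderiv_right (m := ∞) (by simp)).differentiableAt (by simp)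
  have h0 : DifferentiableAt ℝ V x := hVx.differentiableAt (by simp)
  have h2 := h0.hasFDerivAt.comp (x, y) (hasFDerivAt_fst (𝕜 := ℝ) (E := Vec n) (F := Vec n)
    (p := (x, y)))
  have h3 := h1.hasFDerivAt.comp (x, y) (hasFDerivAt_fst (𝕜 := ℝ) (E := Vec n) (F := Vec n)
    (p := (x, y)))
  have h4 := (h2.prodMk (h3.clm_apply (hasFDerivAt_snd (𝕜 := ℝ)))).fderiv
  exact congrArg (fun T : Vec n × Vec n →L[ℝ] _ => T v) h4

namespace IsFinslerOn

variable {n : ℕ} {U : Set (Vec n)} {f : Vec n → Vec n → ℝ} (hf : IsFinslerOn U f) {x y : Vec n}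
  {V : Vec n → Vec n} {ρ : Vec n → ℝ}

include hf

theorem differentiableAt_sprayField (hx : x ∈ U) (hy : y ≠ 0) :
    DifferentiableAt ℝ (sprayField f) (x, y) :=
  differentiableAt_snd.prodMk
    (((hf.contDiffAt_sprayVec hx hy).differentiableAt (by simp)).fun_const_smul _)

theorem lieBracket_completeLift_sprayField (hVx : ContDiffAt ℝ ∞ V x) (hx : x ∈ U) (hy : y ≠ 0) :
    VectorField.lieBracket ℝ (completeLift V) (sprayField f) (x, y)
      = (0, (-2 : ℝ) • lieSpray f V (x, y)) := by
  have hG := (hf.contDiffAt_sprayVec hx hy).differentiableAt (by simp)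
  have h1 : ∀ v, fderiv ℝ (sprayField f) (x, y) v
      = (v.2, (-2 : ℝ) • fderiv ℝ (sprayVec f) (x, y) v) := fun v => by
    have h2 := ((hasFDerivAt_snd (𝕜 := ℝ) (E := Vec n) (F := Vec n) (p := (x, y))).prodMk
      (hG.hasFDerivAt.fun_const_smul (-2 : ℝ))).fderiv
    exact congrArg (fun T : Vec n × Vec n →L[ℝ] _ => T v) h2
  rw [VectorField.lieBracket, h1, fderiv_completeLift hVx]
  simp only [lieSpray, completeLift, sprayField, map_smul]
  ext i
  · simp
  · simp
    ring

/-- Along the complete lift of `V`, the partial derivatives of an energy with `X L = 2 ρ L`. -/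
theorem fderiv_fderiv_completeLift (hV : ContDiffOn ℝ ∞ V U) (hρ : ContDiffOn ℝ ∞ ρ U)
    (hL : ∀ x ∈ U, ∀ y, y ≠ 0 →
      fderiv ℝ (totalEnergy f) (x, y) (completeLift V (x, y)) = 2 * ρ x * totalEnergy f (x, y))
    (hx : x ∈ U) (hy : y ≠ 0) (v : Vec n × Vec n) :
    fderiv ℝ (fun q => fderiv ℝ (totalEnergy f) q v) (x, y) (completeLift V (x, y))
      = 2 * (fderiv ℝ ρ x v.1 * totalEnergy f (x, y) + ρ x * fderiv ℝ (totalEnergy f) (x, y) v)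
        - fderiv ℝ (totalEnergy f) (x, y) (fderiv ℝ V x v.1,
            fderiv ℝ V x v.2 + fderiv ℝ (fderiv ℝ V) x v.1 y) := by
  have hVx : ContDiffAt ℝ ∞ V x := hV.contDiffAt (hf.isOpen.mem_nhds hx)
  have hρx : DifferentiableAt ℝ ρ x :=
    (hρ.contDiffAt (hf.isOpen.mem_nhds hx)).differentiableAt (by simp)
  have hΩ := hf.isOpen_slit.mem_nhds (show (x, y) ∈ U ×ˢ ({0}ᶜ : Set (Vec n)) from ⟨hx, hy⟩)
  have hLs := hf.contDiffAt_totalEnergy hx hy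
  have hLd := hLs.differentiableAt (by simp)
  set T := totalEnergy f with hT
  have hρ1 := hρx.hasFDerivAt.comp (x, y)
    (hasFDerivAt_fst (𝕜 := ℝ) (E := Vec n) (F := Vec n) (p := (x, y)))
  have h1 : (fun q => fderiv ℝ T q (completeLift V q)) =ᶠ[𝓝 (x, y)]
      fun q => 2 * (ρ q.1 * T q) := by
    filter_upwards [hΩ] with q hq
    rw [← mul_assoc]
    exact hL q.1 hq.1 q.2 hq.2
  have h2 := fderiv_lieBracket hLs (differentiableAt_completeLift hVx y)
    (differentiableAt_const v)
  have h3 : fderiv ℝ (fun q => 2 * (ρ q.1 * T q)) (x, y) v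
      = 2 * (fderiv ℝ ρ x v.1 * T (x, y) + ρ x * fderiv ℝ T (x, y) v) := by
    have h4 := ((hρ1.fun_mul hLd.hasFDerivAt).const_mul 2).fderiv
    refine (congrArg (fun S : Vec n × Vec n →L[ℝ] ℝ => S v) h4).trans ?_
    simp only [_root_.smul_apply, _root_.add_apply, ContinuousLinearMap.comp_apply,
      ContinuousLinearMap.coe_fst', smul_eq_mul, Function.comp_apply]
    ring
  have h5 : VectorField.lieBracket ℝ (completeLift V) (fun _ => v) (x, y)
      = -(fderiv ℝ V x v.1, fderiv ℝ V x v.2 + fderiv ℝ (fderiv ℝ V) x v.1 y) := by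
    rw [VectorField.lieBracket, fderiv_completeLift hVx, fderiv_const_apply, _root_.zero_apply,
      zero_sub]
  rw [h1.fderiv_eq, h3, h5, map_neg] at h2
  linarith

/-- If `F` grows at the rate `ρ` along the complete lift of `V`, then the Lie derivative of the
spray coefficients is `ρ₀ y - L R`, where `ρ₀ = dρ(y)` and `R` is dual to `dρ` with respect to the
Hessian of the energy `L`. -/
theorem lieSpray_eq (hV : ContDiffOn ℝ ∞ V U) (hρ : ContDiffOn ℝ ∞ ρ U)
    (hL : ∀ x ∈ U, ∀ y, y ≠ 0 →
      fderiv ℝ (totalEnergy f) (x, y) (completeLift V (x, y)) = 2 * ρ x * totalEnergy f (x, y))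
    (hx : x ∈ U) (hy : y ≠ 0) :
    lieSpray f V (x, y) = fderiv ℝ ρ x y • y
      - totalEnergy f (x, y) • dualVec (energy f x) (fderiv ℝ ρ x) y := by
  have hM := hf.isMinkowskiEnergy hx
  have hVx : ContDiffAt ℝ ∞ V x := hV.contDiffAt (hf.isOpen.mem_nhds hx)
  have hV1 : DifferentiableAt ℝ (fderiv ℝ V) x :=
    (hVx.fderiv_right (m := ∞) (by simp)).differentiableAt (by simp)
  have hρx : DifferentiableAt ℝ ρ x :=
    (hρ.contDiffAt (hf.isOpen.mem_nhds hx)).differentiableAt (by simp)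
  have hΩ := hf.isOpen_slit.mem_nhds (show (x, y) ∈ U ×ˢ ({0}ᶜ : Set (Vec n)) from ⟨hx, hy⟩)
  have hDs := hf.contDiffAt_fderiv_totalEnergy hx hy
  have hDd := hDs.differentiableAt (by simp)
  refine hM.eq_of_fderiv2_eq hy ?_
  ext w
  have hkey := fderiv_lieBracket (hDs.clm_apply (contDiffAt_const (c := ((0 : Vec n), w))))
    (differentiableAt_completeLift hVx y) (hf.differentiableAt_sprayField hx hy)
  rw [hf.lieBracket_completeLift_sprayField hVx hx hy] at hkey
  have hD2 : ∀ v, fderiv ℝ (fun q => fderiv ℝ (totalEnergy f) q (0, w)) (x, y) v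
      = fderiv ℝ (fderiv ℝ (totalEnergy f)) (x, y) v (0, w) := fun v => by
    rw [fderiv_clm_apply hDd (differentiableAt_const _)]
    simp
  -- The derivative of `∂L/∂yˡ` along the spray is `∂L/∂xˡ`.
  have e1 : (fun q => fderiv ℝ (fun q => fderiv ℝ (totalEnergy f) q (0, w)) q (sprayField f q))
      =ᶠ[𝓝 (x, y)] fun q => fderiv ℝ (totalEnergy f) q (w, 0) := by
    filter_upwards [hΩ] with q hq
    have hd := (hf.contDiffAt_fderiv_totalEnergy hq.1 hq.2).differentiableAt (by simp)
    have h1 := hf.fderiv2_sprayField hq.1 hq.2 w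
    rw [fderiv_clm_apply hd (differentiableAt_const _)]
    simpa using h1
  -- The derivative of `∂L/∂yˡ` along the complete lift.
  have e2 : (fun q => fderiv ℝ (fun q => fderiv ℝ (totalEnergy f) q (0, w)) q (completeLift V q))
      =ᶠ[𝓝 (x, y)] fun q => 2 * (ρ q.1 * fderiv ℝ (totalEnergy f) q (0, w))
        - fderiv ℝ (totalEnergy f) q (0, fderiv ℝ V q.1 w) := by
    filter_upwards [hΩ] with q hq
    have h1 := hf.fderiv_fderiv_completeLift hV hρ hL hq.1 hq.2 (0, w)
    simpa using h1
  have hρ1 := hρx.hasFDerivAt.comp (x, y)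
    (hasFDerivAt_fst (𝕜 := ℝ) (E := Vec n) (F := Vec n) (p := (x, y)))
  have hw := (hDd.clm_apply (differentiableAt_const ((0 : Vec n), w))).hasFDerivAt
  have hVw : HasFDerivAt (fun q : Vec n × Vec n => ((0 : Vec n), fderiv ℝ V q.1 w))
      (ContinuousLinearMap.prod 0 (((fderiv ℝ (fderiv ℝ V) x).flip w).comp
        (ContinuousLinearMap.fst ℝ (Vec n) (Vec n)))) (x, y) := by
    have h1 : HasFDerivAt (fun z => fderiv ℝ V z w) ((fderiv ℝ (fderiv ℝ V) x).flip w) x := by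
      simpa using hV1.hasFDerivAt.clm_apply (hasFDerivAt_const w x)
    exact (hasFDerivAt_const _ _).prodMk (h1.comp (f := Prod.fst) (x, y) hasFDerivAt_fst)
  have e3 : ∀ v, fderiv ℝ (fun q => 2 * (ρ q.1 * fderiv ℝ (totalEnergy f) q (0, w))
        - fderiv ℝ (totalEnergy f) q (0, fderiv ℝ V q.1 w)) (x, y) v
      = 2 * (fderiv ℝ ρ x v.1 * fderiv ℝ (totalEnergy f) (x, y) (0, w)
          + ρ x * fderiv ℝ (fderiv ℝ (totalEnergy f)) (x, y) v (0, w))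
        - (fderiv ℝ (fderiv ℝ (totalEnergy f)) (x, y) v (0, fderiv ℝ V x w)
          + fderiv ℝ (totalEnergy f) (x, y) (0, fderiv ℝ (fderiv ℝ V) x v.1 w)) := fun v => by
    have h1 := (((hρ1.fun_mul hw).const_mul 2).fun_sub (hDd.hasFDerivAt.clm_apply hVw)).fderiv
    refine (congrArg (fun S : Vec n × Vec n →L[ℝ] ℝ => S v) h1).trans ?_
    simp only [_root_.sub_apply, _root_.smul_apply, _root_.add_apply,
      ContinuousLinearMap.comp_apply, ContinuousLinearMap.coe_fst', smul_eq_mul,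
      Function.comp_apply, hD2, ContinuousLinearMap.flip_apply, ContinuousLinearMap.prod_apply,
      _root_.zero_apply]
    ring
  rw [e1.fderiv_eq, e2.fderiv_eq, e3, hD2, hf.fderiv2_sprayField hx hy,
    hf.fderiv2_sprayField hx hy, hf.fderiv_fderiv_completeLift hV hρ hL hx hy] at hkey
  have h5 : (0, (-2 : ℝ) • lieSpray f V (x, y))
      = (-2 : ℝ) • ((0 : Vec n), lieSpray f V (x, y)) := by simp
  rw [h5, map_smul, _root_.smul_apply, smul_eq_mul, ← hf.fderiv2_energy hx hy] at hkey
  rw [map_sub, map_smul, map_smul, hM.fderiv2_self hy, _root_.sub_apply, _root_.smul_apply,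
    _root_.smul_apply, hM.fderiv2_dualVec hy, hf.fderiv_energy hx hy, smul_eq_mul, smul_eq_mul]
  have h6 : fderiv ℝ (totalEnergy f) (x, y) (fderiv ℝ V x w, fderiv ℝ (fderiv ℝ V) x w y)
      = fderiv ℝ (totalEnergy f) (x, y) (fderiv ℝ V x w, 0)
        + fderiv ℝ (totalEnergy f) (x, y) (0, fderiv ℝ (fderiv ℝ V) x y w) := by
    rw [← map_add, fderiv_fderiv_comm hVx w y]
    simp
  have h7 : (sprayField f (x, y)).1 = y := rfl
  simp only [map_zero, zero_add, h7, h6] at hkey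
  linarith

end IsFinslerOn

end FinslerCoord

/-! ### Conformal fields of metrics of isotropic S-curvature -/

namespace FinslerCoord

theorem sum_comp_apply_stdVec {n : ℕ} (S T : Vec n →L[ℝ] Vec n) :
    ∑ m, S (T (stdVec m)) m = ∑ m, T (S (stdVec m)) m := by
  have h : ∀ (S T : Vec n →L[ℝ] Vec n) m,
      S (T (stdVec m)) m = ∑ k, T (stdVec m) k * S (stdVec k) m := fun S T m => by
    rw [map_eq_sum_stdVec S (T (stdVec m))]
    simp
  rw [Finset.sum_congr rfl fun m _ => h S T m, Finset.sum_comm,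
    Finset.sum_congr rfl fun m _ => h T S m]
  exact Finset.sum_congr rfl fun m _ => Finset.sum_congr rfl fun k _ => mul_comm _ _

theorem fderiv_divergence {n : ℕ} {V : Vec n → Vec n} {x : Vec n} (hV : ContDiffAt ℝ ∞ V x)
    (w : Vec n) :
    fderiv ℝ (divergence V) x w = ∑ m, fderiv ℝ (fderiv ℝ V) x w (stdVec m) m := by
  have h1 : DifferentiableAt ℝ (fderiv ℝ V) x :=
    (hV.fderiv_right (m := ∞) (by simp)).differentiableAt (by simp)
  have h2 : ∀ m : Fin n, DifferentiableAt ℝ (fun z => fderiv ℝ V z (stdVec m)) x := fun m =>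
    h1.clm_apply (differentiableAt_const _)
  have h3 := fderiv_fun_sum (𝕜 := ℝ) (u := Finset.univ) (x := x)
    (A := fun m z => fderiv ℝ V z (stdVec m) m) fun m _ =>
      (EuclideanSpace.proj m : Vec n →L[ℝ] ℝ).differentiableAt.comp x (h2 m)
  refine (congrArg (fun T : Vec n →L[ℝ] ℝ => T w) h3).trans ?_
  simp only [_root_.sum_apply]
  refine Finset.sum_congr rfl fun m _ => ?_
  rw [fderiv_coord (h2 m), fderiv_clm_apply h1 (differentiableAt_const _)]
  simp

theorem IsMinkowskiEnergy.divergence_smul_sub {n : ℕ} {L : Vec n → ℝ} (hL : IsMinkowskiEnergy L)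
    (ℓ : Vec n →L[ℝ] ℝ) {y : Vec n} (hy : y ≠ 0) :
    divergence (fun z => ℓ z • z - L z • dualVec L ℓ z) y
      = n * ℓ y + L y * fderiv ℝ (logDetHess L) y (dualVec L ℓ y) := by
  have hLd := (hL.contDiffAt hy).differentiableAt (by simp)
  have hR := (hL.contDiffAt_dualVec hy ℓ).differentiableAt (by simp)
  have h1 : divergence (fun z => ℓ z • z - L z • dualVec L ℓ z) y
      = divergence (fun z => ℓ z • z) y - divergence (fun z => L z • dualVec L ℓ z) y := by
    have a : DifferentiableAt ℝ (fun z => ℓ z • z) y := ℓ.differentiableAt.smul differentiableAt_id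
    have b : DifferentiableAt ℝ (fun z => L z • dualVec L ℓ z) y := hLd.smul hR
    simp only [divergence]
    rw [fderiv_fun_sub a b]
    simp
  have h2 : divergence (fun z : Vec n => z) y = n := by simp [divergence]
  rw [h1, divergence_smul (R := fun z => z) ℓ.differentiableAt differentiableAt_id, h2,
    divergence_smul hLd hR, hL.divergence_dualVec hy, ← hL.fderiv2_self hy, hL.fderiv2_symm hy,
    hL.fderiv2_dualVec hy, ContinuousLinearMap.fderiv]
  ring

namespace IsFinslerOn

variable {n : ℕ} {U : Set (Vec n)} {f : Vec n → Vec n → ℝ} (hf : IsFinslerOn U f) {x y : Vec n}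
  {V : Vec n → Vec n} {ρ : Vec n → ℝ}

include hf

theorem contDiffOn_fderiv_sprayVec :
    ContDiffOn ℝ ∞ (fderiv ℝ (sprayVec f)) (U ×ˢ {0}ᶜ) :=
  hf.contDiffOn_sprayVec.fderiv_of_isOpen hf.isOpen_slit (by simp)

theorem contDiffAt_fderiv_sprayVec (hx : x ∈ U) (hy : y ≠ 0) :
    ContDiffAt ℝ ∞ (fderiv ℝ (sprayVec f)) (x, y) :=
  hf.contDiffOn_fderiv_sprayVec.contDiffAt (hf.isOpen_slit.mem_nhds ⟨hx, hy⟩)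

theorem fderiv_sprayDivergence (hx : x ∈ U) (hy : y ≠ 0) (v : Vec n × Vec n) :
    fderiv ℝ (sprayDivergence f) (x, y) v
      = ∑ m, fderiv ℝ (fderiv ℝ (sprayVec f)) (x, y) v (0, stdVec m) m := by
  have h1 := (hf.contDiffAt_fderiv_sprayVec hx hy).differentiableAt (by simp)
  have h2 : ∀ m : Fin n,
      DifferentiableAt ℝ (fun z => fderiv ℝ (sprayVec f) z (0, stdVec m)) (x, y) := fun m =>
    h1.clm_apply (differentiableAt_const _)
  have h3 := fderiv_fun_sum (𝕜 := ℝ) (u := Finset.univ) (x := (x, y))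
    (A := fun m z => fderiv ℝ (sprayVec f) z (0, stdVec m) m) fun m _ =>
      (EuclideanSpace.proj m : Vec n →L[ℝ] ℝ).differentiableAt.comp (x, y) (h2 m)
  refine (congrArg (fun T : Vec n × Vec n →L[ℝ] ℝ => T v) h3).trans ?_
  simp only [_root_.sum_apply]
  refine Finset.sum_congr rfl fun m _ => ?_
  rw [fderiv_coord (h2 m), fderiv_clm_apply h1 (differentiableAt_const _)]
  simp

theorem contDiffOn_sprayDivergence : ContDiffOn ℝ ∞ (sprayDivergence f) (U ×ˢ {0}ᶜ) :=
  ContDiffOn.sum fun m _ => contDiffOn_euclidean.1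
    (hf.contDiffOn_fderiv_sprayVec.clm_apply contDiffOn_const) m

/-- The fibrewise divergence of the Lie derivative of the spray coefficients is the Lie derivative
of their divergence. -/
theorem divergence_lieSpray (hVx : ContDiffAt ℝ ∞ V x) (hx : x ∈ U) (hy : y ≠ 0) :
    divergence (fun z => lieSpray f V (x, z)) y
      = fderiv ℝ (sprayDivergence f) (x, y) (completeLift V (x, y))
        + fderiv ℝ (divergence V) x y := by
  have hG := (hf.contDiffAt_sprayVec hx hy).differentiableAt (by simp)
  have hGs := hf.contDiffAt_sprayVec hx hy
  have hDG := (hf.contDiffAt_fderiv_sprayVec hx hy).differentiableAt (by simp)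
  have hX := differentiableAt_completeLift hVx y
  have hpath : DifferentiableAt ℝ (fun z : Vec n => (x, z)) y := by fun_prop
  have t1 : ∀ w, fderiv ℝ (fun z => fderiv ℝ (sprayVec f) (x, z) (completeLift V (x, z))) y w
      = fderiv ℝ (fderiv ℝ (sprayVec f)) (x, y) (completeLift V (x, y)) (0, w)
        + fderiv ℝ (sprayVec f) (x, y) (0, fderiv ℝ V x w) := fun w => by
    rw [fderiv_snd_eq (k := fun q => fderiv ℝ (sprayVec f) q (completeLift V q))
      (hDG.clm_apply hX), fderiv_clm_apply hDG hX]
    simp only [_root_.add_apply, ContinuousLinearMap.comp_apply, ContinuousLinearMap.flip_apply,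
      fderiv_completeLift hVx, map_zero, _root_.zero_apply, add_zero]
    rw [fderiv_fderiv_comm hGs, add_comm]
  have d1 : DifferentiableAt ℝ
      (fun z => fderiv ℝ (sprayVec f) (x, z) (completeLift V (x, z))) y :=
    (hDG.clm_apply hX).comp (g := fun q => fderiv ℝ (sprayVec f) q (completeLift V q)) y hpath
  have t2 : HasFDerivAt (fun z => (2 : ℝ)⁻¹ • fderiv ℝ (fderiv ℝ V) x z z)
      (fderiv ℝ (fderiv ℝ V) x y) y := by
    have h1 := ((fderiv ℝ (fderiv ℝ V) x).hasFDerivAt (x := y)).clm_apply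
      (hasFDerivAt_id (𝕜 := ℝ) y)
    refine (h1.fun_const_smul (2 : ℝ)⁻¹).congr_fderiv ?_
    ext1 w
    simp only [_root_.smul_apply, _root_.add_apply, ContinuousLinearMap.comp_apply,
      ContinuousLinearMap.flip_apply, id_eq, ContinuousLinearMap.id_apply]
    rw [fderiv_fderiv_comm hVx w y, ← two_smul ℝ, smul_smul, inv_mul_cancel₀ two_ne_zero, one_smul]
  have t3 : ∀ w, fderiv ℝ (fun z => fderiv ℝ V x (sprayVec f (x, z))) y w
      = fderiv ℝ V x (fderiv ℝ (sprayVec f) (x, y) (0, w)) := fun w => by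
    have h1 := (fderiv ℝ V x).hasFDerivAt.comp y
      (hG.hasFDerivAt.comp (f := fun z => (x, z)) y (hasFDerivAt_prodMk_right x y))
    exact congrArg (fun T : Vec n →L[ℝ] Vec n => T w) h1.fderiv
  have d3 : DifferentiableAt ℝ (fun z => fderiv ℝ V x (sprayVec f (x, z))) y :=
    (fderiv ℝ V x).differentiableAt.comp y (hG.comp (f := fun z => (x, z)) y hpath)
  have h1 : ∀ w, fderiv ℝ (fun z => lieSpray f V (x, z)) y w
      = fderiv ℝ (fderiv ℝ (sprayVec f)) (x, y) (completeLift V (x, y)) (0, w)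
        + fderiv ℝ (sprayVec f) (x, y) (0, fderiv ℝ V x w) + fderiv ℝ (fderiv ℝ V) x y w
        - fderiv ℝ V x (fderiv ℝ (sprayVec f) (x, y) (0, w)) := fun w => by
    have h2 := ((d1.hasFDerivAt.fun_add t2).fun_sub d3.hasFDerivAt).fderiv
    refine (congrArg (fun T : Vec n →L[ℝ] Vec n => T w) h2).trans ?_
    simp only [_root_.sub_apply, _root_.add_apply, t1, t3]
  have h2 := sum_comp_apply_stdVec ((fderiv ℝ (sprayVec f) (x, y)).comp
    (ContinuousLinearMap.inr ℝ (Vec n) (Vec n))) (fderiv ℝ V x)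
  simp only [ContinuousLinearMap.comp_apply, ContinuousLinearMap.inr_apply] at h2
  simp only [divergence, h1, PiLp.add_apply, PiLp.sub_apply, Finset.sum_add_distrib,
    Finset.sum_sub_distrib]
  rw [h2, hf.fderiv_sprayDivergence hx hy, fderiv_divergence hVx y]
  ring

/-- A conformal vector field of a Finsler metric of isotropic S-curvature has a smooth conformal
factor, and where its differential does not vanish, the metric is Euclidean in the tangent space. -/
theorem exists_bilinear_of_conformal (hn : 2 ≤ n) (hV : ContDiffOn ℝ ∞ V U) {θ c : Vec n → ℝ}
    (hS : ∀ x ∈ U, ∀ y, y ≠ 0 → sCurvature f x y = ((n : ℝ) + 1) * θ x * f x y)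
    (hc : ∀ x ∈ U, ∀ y, y ≠ 0 → covDeriv00 f V x y = -2 * c x * f x y ^ 2) :
    ContDiffOn ℝ ∞ c U ∧ ∀ x ∈ U, fderiv ℝ c x ≠ 0 →
      ∃ B : Vec n →L[ℝ] Vec n →L[ℝ] ℝ, ∀ y, f x y ^ 2 = B y y := by
  have : NeZero n := ⟨by omega⟩
  set y₀ : Vec n := stdVec 0
  have hy₀ : y₀ ≠ 0 := by simp [y₀]
  have hpt : ∀ x ∈ U, (x, y₀) ∈ U ×ˢ ({0}ᶜ : Set (Vec n)) := fun x hx => ⟨hx, hy₀⟩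
  have hpath : ContDiff ℝ ∞ fun x : Vec n => (x, y₀) := by fun_prop
  have hVd : ∀ x ∈ U, ContDiffAt ℝ ∞ V x := fun x hx => hV.contDiffAt (hf.isOpen.mem_nhds hx)
  let F : Vec n × Vec n → ℝ := fun p => f p.1 p.2
  have hXL : ∀ x ∈ U, ∀ y, y ≠ 0 → fderiv ℝ (totalEnergy f) (x, y) (completeLift V (x, y))
      = 2 * (-2 * c x) * totalEnergy f (x, y) := fun x hx y hy => by
    have h1 := hf.covDeriv00_eq ((hVd x hx).differentiableAt (by simp)) hx hy
    rw [hc x hx y hy] at h1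
    have h2 : totalEnergy f (x, y) = f x y ^ 2 := rfl
    rw [h2]
    linarith
  have hXF : ∀ x ∈ U, ∀ y, y ≠ 0 →
      fderiv ℝ F (x, y) (completeLift V (x, y)) = -2 * c x * f x y := fun x hx y hy => by
    have hFd := (hf.contDiffAt hx hy).differentiableAt (by simp)
    have h1 := hXL x hx y hy
    have h2 : fderiv ℝ (totalEnergy f) (x, y) (completeLift V (x, y))
        = 2 * f x y * fderiv ℝ F (x, y) (completeLift V (x, y)) := by
      have h3 := ((hasDerivAt_pow 2 _).comp_hasFDerivAt (x, y) hFd.hasFDerivAt).fderiv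
      refine (congrArg (fun T : Vec n × Vec n →L[ℝ] ℝ => T (completeLift V (x, y))) h3).trans ?_
      simp [F]
    have h4 : totalEnergy f (x, y) = f x y ^ 2 := rfl
    rw [h2, h4] at h1
    have h5 := (hf.pos x hx y hy).ne'
    have h6 : 2 * f x y * (fderiv ℝ F (x, y) (completeLift V (x, y)) - -2 * c x * f x y) = 0 := by
      linarith
    have h7 := (mul_eq_zero.1 h6).resolve_left (mul_ne_zero two_ne_zero h5)
    linarith
  have hcs : ContDiffOn ℝ ∞ c U := by
    have h1 : ContDiffOn ℝ ∞ (completeLift V) (U ×ˢ {0}ᶜ) := by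
      have h2 := hV.fderiv_of_isOpen hf.isOpen (m := ∞) (by simp)
      exact (hV.comp contDiffOn_fst fun q hq => hq.1).prodMk
        ((h2.comp contDiffOn_fst fun q hq => hq.1).clm_apply contDiffOn_snd)
    have h2 : ContDiffOn ℝ ∞ (fun p => fderiv ℝ (totalEnergy f) p (completeLift V p)
        / (-4 * totalEnergy f p)) (U ×ˢ {0}ᶜ) :=
      (hf.contDiffOn_fderiv_totalEnergy.clm_apply h1).div
        (contDiffOn_const.mul hf.contDiffOn_totalEnergy) fun p hp =>
          mul_ne_zero (by norm_num) (pow_pos (hf.pos p.1 hp.1 p.2 hp.2) 2).ne'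
    refine (h2.comp hpath.contDiffOn hpt).congr fun x hx => ?_
    have h3 : totalEnergy f (x, y₀) ≠ 0 := (pow_pos (hf.pos x hx y₀ hy₀) 2).ne'
    simp only [Function.comp_apply]
    rw [hXL x hx y₀ hy₀]
    field_simp
    ring
  refine ⟨hcs, fun x hx hne => ?_⟩
  set ρ : Vec n → ℝ := fun x => -2 * c x with hρ
  have hρs : ContDiffOn ℝ ∞ ρ U := contDiffOn_const.mul hcs
  have hρx : fderiv ℝ ρ x = (-2 : ℝ) • fderiv ℝ c x := by
    rw [hρ, fderiv_const_mul ((hcs.contDiffAt (hf.isOpen.mem_nhds hx)).differentiableAt (by simp))]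
  have hρne : fderiv ℝ ρ x ≠ 0 := by
    rw [hρx]
    exact smul_ne_zero (by norm_num) hne
  set s : Vec n → ℝ := fun x => Real.log (bhDensity f x) with hs
  have hsC : ContDiffOn ℝ 2 s U := by exact_mod_cast hf.contDiffOn_log_bhDensity 2
  have hsd : ∀ x ∈ U, DifferentiableAt ℝ (fderiv ℝ s) x := fun x hx =>
    ((hsC.contDiffAt (hf.isOpen.mem_nhds hx)).fderiv_right (m := 1)
      (by norm_num)).differentiableAt one_ne_zero
  -- The S-curvature hypothesis says that `Π - d(ln σ)(y) = (n + 1) θ F`; evaluating it at a fixed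
  -- vector shows that `θ` is differentiable.
  let K : Vec n × Vec n → ℝ := fun p => sprayDivergence f p - fderiv ℝ s p.1 p.2
  have hK : ∀ x ∈ U, ∀ y, y ≠ 0 → K (x, y) = ((n : ℝ) + 1) * θ x * f x y := fun x hx y hy => by
    rw [← hS x hx y hy, hf.sCurvature_eq hx hy]
    rfl
  have hKd : ∀ x ∈ U, ∀ y, y ≠ 0 → DifferentiableAt ℝ K (x, y) := fun x hx y hy => by
    have hΩ := hf.isOpen_slit.mem_nhds (show (x, y) ∈ U ×ˢ ({0}ᶜ : Set (Vec n)) from ⟨hx, hy⟩)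
    have h1 := (hf.contDiffOn_sprayDivergence.contDiffAt hΩ).differentiableAt (by simp)
    exact h1.sub (((hsd x hx).comp (x, y) differentiableAt_fst).clm_apply differentiableAt_snd)
  set κ : Vec n → ℝ := fun x => ((n : ℝ) + 1) * θ x with hκ
  have hκd : DifferentiableAt ℝ κ x := by
    have hp := hpath.differentiable (by simp) x
    have a : DifferentiableAt ℝ (fun z => K (z, y₀)) x :=
      (hKd x hx y₀ hy₀).comp (f := fun z => (z, y₀)) x hp
    have b : DifferentiableAt ℝ (fun z => F (z, y₀)) x :=
      ((hf.contDiffAt hx hy₀).differentiableAt (by simp)).comp (f := fun z => (z, y₀)) x hp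
    have h1 : DifferentiableAt ℝ (fun z => K (z, y₀) * (F (z, y₀))⁻¹) x :=
      a.fun_mul (b.fun_inv (hf.pos x hx y₀ hy₀).ne')
    refine h1.congr_of_eventuallyEq ?_
    filter_upwards [hf.isOpen.mem_nhds hx] with z hz
    rw [hK z hz y₀ hy₀]
    exact (mul_inv_cancel_right₀ (hf.pos z hz y₀ hy₀).ne' _).symm
  have hVx := hVd x hx
  have hM := hf.isMinkowskiEnergy hx
  refine hM.exists_bilinear hn hρne (k := fderiv ℝ κ x (V x) + κ x * ρ x) fun y hy => ?_
  have hsymm : ∀ v w, fderiv ℝ (fderiv ℝ s) x v w = fderiv ℝ (fderiv ℝ s) x w v := fun v w =>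
    ((hsC.contDiffAt (hf.isOpen.mem_nhds hx)).isSymmSndFDerivAt (by simp)).eq v w
  -- The derivative of `Π - d(ln σ)(y)` along the complete lift, computed in two ways.
  have hΩ := hf.isOpen_slit.mem_nhds (show (x, y) ∈ U ×ˢ ({0}ᶜ : Set (Vec n)) from ⟨hx, hy⟩)
  have e1 : fderiv ℝ K (x, y) (completeLift V (x, y))
      = (fderiv ℝ κ x (V x) + κ x * ρ x) * f x y := by
    have h1 : K =ᶠ[𝓝 (x, y)] fun q => κ q.1 * F q := by
      filter_upwards [hΩ] with q hq using hK q.1 hq.1 q.2 hq.2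
    have h2 := hκd.hasFDerivAt.comp (x, y)
      (hasFDerivAt_fst (𝕜 := ℝ) (E := Vec n) (F := Vec n) (p := (x, y)))
    have h3 := (h2.fun_mul ((hf.contDiffAt hx hy).differentiableAt (by simp)).hasFDerivAt).fderiv
    rw [h1.fderiv_eq]
    refine (congrArg (fun T : Vec n × Vec n →L[ℝ] ℝ => T (completeLift V (x, y))) h3).trans ?_
    have h4 := hXF x hx y hy
    simp only [_root_.add_apply, _root_.smul_apply, smul_eq_mul, ContinuousLinearMap.comp_apply,
      ContinuousLinearMap.coe_fst', Function.comp_apply]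
    have h5 : (completeLift V (x, y)).1 = V x := rfl
    rw [h5, show fderiv ℝ (fun p : Vec n × Vec n => f p.1 p.2) (x, y) (completeLift V (x, y))
      = ρ x * f x y from h4]
    ring
  have e2 : fderiv ℝ K (x, y) (completeLift V (x, y))
      = fderiv ℝ (sprayDivergence f) (x, y) (completeLift V (x, y))
        - (fderiv ℝ (fderiv ℝ s) x (V x) y + fderiv ℝ s x (fderiv ℝ V x y)) := by
    have h1 := (hf.contDiffOn_sprayDivergence.contDiffAt hΩ).differentiableAt (by simp)
    have h2 := (hsd x hx).hasFDerivAt.comp (x, y)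
      (hasFDerivAt_fst (𝕜 := ℝ) (E := Vec n) (F := Vec n) (p := (x, y)))
    have h3 := (h1.hasFDerivAt.fun_sub (h2.clm_apply (hasFDerivAt_snd (𝕜 := ℝ)))).fderiv
    refine (congrArg (fun T : Vec n × Vec n →L[ℝ] ℝ => T (completeLift V (x, y))) h3).trans ?_
    simp [completeLift]
    ring
  -- The logarithm of the Busemann-Hausdorff density grows at the rate `n ρ - div V`.
  have e3 : fderiv ℝ (fderiv ℝ s) x (V x) y + fderiv ℝ s x (fderiv ℝ V x y)
      = n * fderiv ℝ ρ x y - fderiv ℝ (divergence V) x y := by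
    have h1 : (fun z => fderiv ℝ s z (V z)) =ᶠ[𝓝 x] fun z => n * ρ z - divergence V z := by
      filter_upwards [hf.isOpen.mem_nhds hx] with z hz
      exact hf.fderiv_log_bhDensity hz fun y hy => hXF z hz y hy
    have h2 : DifferentiableAt ℝ (divergence V) x := by
      have h3 := (hVx.fderiv_right (m := ∞) (by simp)).differentiableAt (by simp)
      exact DifferentiableAt.fun_sum fun m _ =>
        (EuclideanSpace.proj m : Vec n →L[ℝ] ℝ).differentiableAt.comp x
          (h3.clm_apply (differentiableAt_const _))
    have hρd : DifferentiableAt ℝ ρ x :=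
      (hρs.contDiffAt (hf.isOpen.mem_nhds hx)).differentiableAt (by simp)
    have h4 := congrArg (fun T : Vec n →L[ℝ] ℝ => T y) h1.fderiv_eq
    rw [fderiv_clm_apply (hsd x hx) (hVx.differentiableAt (by simp)),
      fderiv_fun_sub (hρd.const_mul _) h2, fderiv_const_mul hρd] at h4
    simp only [_root_.add_apply, _root_.sub_apply, _root_.smul_apply, smul_eq_mul,
      ContinuousLinearMap.comp_apply, ContinuousLinearMap.flip_apply] at h4
    rw [hsymm, ← h4]
    ring
  -- The fibrewise divergence of the Lie derivative of the spray, computed in two ways.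
  have e4 : fderiv ℝ (sprayDivergence f) (x, y) (completeLift V (x, y))
        + fderiv ℝ (divergence V) x y
      = n * fderiv ℝ ρ x y + f x y ^ 2 * fderiv ℝ (logDetHess (energy f x)) y
          (dualVec (energy f x) (fderiv ℝ ρ x) y) := by
    rw [← hf.divergence_lieSpray hVx hx hy]
    have h1 : (fun z => lieSpray f V (x, z)) =ᶠ[𝓝 y] fun z => fderiv ℝ ρ x z • z
        - energy f x z • dualVec (energy f x) (fderiv ℝ ρ x) z := by
      filter_upwards [isOpen_ne.mem_nhds hy] with z hz using hf.lieSpray_eq hV hρs hXL hx hz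
    have h2 := hM.divergence_smul_sub (fderiv ℝ ρ x) hy
    rw [divergence, h1.fderiv_eq]
    exact h2
  have hF := hf.pos x hx y hy
  have h1 : √(energy f x y) = f x y := Real.sqrt_sq hF.le
  rw [h1]
  have h2 : f x y * (f x y * fderiv ℝ (logDetHess (energy f x)) y
      (dualVec (energy f x) (fderiv ℝ ρ x) y) - (fderiv ℝ κ x (V x) + κ x * ρ x)) = 0 := by
    linarith
  exact sub_eq_zero.1 ((mul_eq_zero.1 h2).resolve_left hF.ne')

end IsFinslerOn

end FinslerCoord

/-! ### Passage to manifolds -/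

open FinslerCoord

namespace Finsler

variable {n : ℕ} {M : Type*} [TopologicalSpace M] [ChartedSpace (EuclideanSpace ℝ (Fin n)) M]

theorem contMDiff_tangentBundle_mk :
    ContMDiff 𝓘(ℝ, Vec n × Vec n) (𝓡 n).tangent ∞
      (fun p : Vec n × Vec n => (⟨p.1, p.2⟩ : TangentBundle (𝓡 n) (Vec n))) := by
  intro p
  refine Bundle.contMDiffAt_totalSpace.2 ⟨?_, ?_⟩
  · exact contDiff_fst.contMDiff.contMDiffAt
  · simpa using contDiff_snd.contMDiff.contMDiffAt

/-- The iterated derivative that defines the fundamental form is a value of the second derivative. -/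
theorem deriv_deriv_add_smul {E : Type*} [NormedAddCommGroup E] [NormedSpace ℝ E] {h : E → ℝ}
    {y : E} (hh : ContDiffAt ℝ 2 h y) (v : E) :
    deriv (fun s : ℝ => deriv (fun t : ℝ => h (y + s • v + t • v)) 0) 0
      = fderiv ℝ (fderiv ℝ h) y v v := by
  have hline : ∀ z : E, HasDerivAt (fun t : ℝ => z + t • v) v 0 := fun z => by
    simpa using ((hasDerivAt_id (0 : ℝ)).smul_const v).const_add z
  have h1 : ∀ᶠ z in 𝓝 y, DifferentiableAt ℝ h z :=
    (hh.eventually (by simp)).mono fun z hz => hz.differentiableAt two_ne_zero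
  have h2 : Filter.Tendsto (fun s : ℝ => y + s • v) (𝓝 0) (𝓝 y) := by
    simpa using (hline y).continuousAt.tendsto
  have h3 : (fun s : ℝ => deriv (fun t : ℝ => h (y + s • v + t • v)) 0)
      =ᶠ[𝓝 0] fun s => fderiv ℝ h (y + s • v) v := by
    filter_upwards [h2.eventually h1] with s hs
    have h4 : HasFDerivAt h (fderiv ℝ h (y + s • v)) (y + s • v + (0 : ℝ) • v) := by
      simpa using hs.hasFDerivAt
    exact (h4.comp_hasDerivAt 0 (hline (y + s • v))).deriv
  rw [h3.deriv_eq]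
  have h5 : DifferentiableAt ℝ (fderiv ℝ h) y :=
    (hh.fderiv_right (m := 1) (by norm_num)).differentiableAt one_ne_zero
  have h6 : HasFDerivAt (fun z => fderiv ℝ h z v) ((fderiv ℝ (fderiv ℝ h) y).flip v)
      (y + (0 : ℝ) • v) := by
    simpa using h5.hasFDerivAt.clm_apply (hasFDerivAt_const v y)
  exact (h6.comp_hasDerivAt 0 (hline y)).deriv

variable [IsManifold (𝓡 n) ∞ M]

theorem contDiffOn_coordMetric {F : (x : M) → TangentSpace (𝓡 n) x → ℝ} (hF : IsFinslerMetric F)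
    {e : OpenPartialHomeomorph M (Vec n)} (he : e ∈ IsManifold.maximalAtlas (𝓡 n) ∞ M)
    (hd : e.MDifferentiable (𝓡 n) (𝓡 n)) :
    ContDiffOn ℝ ∞ (fun p : Vec n × Vec n => coordMetric F e p.1 p.2) (e.target ×ˢ {0}ᶜ) := by
  have : IsManifold (𝓡 n) 1 M := IsManifold.of_le (n := ∞) (by simp)
  have h1 : ContMDiffOn (𝓡 n).tangent (𝓡 n).tangent ∞
      (tangentMapWithin (𝓡 n) (𝓡 n) e.symm e.target) _ :=
    (contMDiffOn_symm_of_mem_maximalAtlas he).contMDiffOn_tangentMapWithin (m := ∞) (by simp)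
      e.open_target.uniqueMDiffOn
  have h2 : ContMDiffOn 𝓘(ℝ, Vec n × Vec n) (𝓡 n).tangent ∞
      (fun p : Vec n × Vec n => tangentMapWithin (𝓡 n) (𝓡 n) e.symm e.target ⟨p.1, p.2⟩)
      (e.target ×ˢ {0}ᶜ) :=
    h1.comp contMDiff_tangentBundle_mk.contMDiffOn fun p hp => hp.1
  have h3 := hF.smooth.comp h2 fun p hp => by
    have h4 := mfderivWithin_of_isOpen (I := 𝓡 n) (I' := 𝓡 n) (f := e.symm) e.open_target hp.1
    have h5 := (injective_iff_map_eq_zero _).1 (hd.symm.mfderiv_injective hp.1) p.2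
    exact fun h => hp.2 (h5 ((congrArg (fun T : Vec n →L[ℝ] Vec n => T p.2) h4).symm.trans h))
  refine contMDiffOn_iff_contDiffOn.1 (h3.congr fun p hp => ?_)
  have h4 := mfderivWithin_of_isOpen (I := 𝓡 n) (I' := 𝓡 n) (f := e.symm) e.open_target hp.1
  exact congrArg (fun T : Vec n →L[ℝ] TangentSpace (𝓡 n) (e.symm p.1) => F (e.symm p.1) (T p.2))
    h4.symm

theorem contDiffOn_coordField {V : (x : M) → TangentSpace (𝓡 n) x}
    (hV : ContMDiff (𝓡 n) (𝓡 n).tangent ∞ (fun x => (⟨x, V x⟩ : TangentBundle (𝓡 n) M)))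
    {e : OpenPartialHomeomorph M (Vec n)} (he : e ∈ IsManifold.maximalAtlas (𝓡 n) ∞ M) :
    ContDiffOn ℝ ∞ (coordField V e) e.target := by
  have : IsManifold (𝓡 n) 1 M := IsManifold.of_le (n := ∞) (by simp)
  have h1 : ContMDiffOn (𝓡 n).tangent (𝓡 n).tangent ∞
      (tangentMapWithin (𝓡 n) (𝓡 n) e e.source) _ :=
    (contMDiffOn_of_mem_maximalAtlas he).contMDiffOn_tangentMapWithin (m := ∞) (by simp)
      e.open_source.uniqueMDiffOn
  have h2 := (h1.comp hV.contMDiffOn fun x (hx : x ∈ e.source) => hx).comp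
    (contMDiffOn_symm_of_mem_maximalAtlas he) fun u hu => e.map_target hu
  have h3 := (contMDiff_snd_tangentBundle_modelSpace (Vec n) (𝓡 n) (n := ∞)).comp_contMDiffOn h2
  refine contMDiffOn_iff_contDiffOn.1 (h3.congr fun u hu => ?_)
  have h4 := mfderivWithin_of_isOpen (I := 𝓡 n) (I' := 𝓡 n) (f := e) e.open_source
    (e.map_target hu)
  exact congrArg (fun T : TangentSpace (𝓡 n) (e.symm u) →L[ℝ] Vec n => T (V (e.symm u))) h4.symm

theorem IsFinslerMetric.isFinslerOn {F : (x : M) → TangentSpace (𝓡 n) x → ℝ}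
    (hF : IsFinslerMetric F) {e : OpenPartialHomeomorph M (Vec n)}
    (he : e ∈ IsManifold.maximalAtlas (𝓡 n) ∞ M) (hd : e.MDifferentiable (𝓡 n) (𝓡 n)) :
    IsFinslerOn e.target (coordMetric F e) := by
  have hne : ∀ x ∈ e.target, ∀ y : Vec n, y ≠ 0 →
      mfderiv (𝓡 n) (𝓡 n) e.symm x y ≠ 0 := fun x hx y hy h =>
    hy ((injective_iff_map_eq_zero _).1 (hd.symm.mfderiv_injective hx) y h)
  have hs := contDiffOn_coordMetric hF he hd
  refine ⟨e.open_target, hs, fun x hx y hy => hF.pos _ _ (hne x hx y hy), fun x hx r y hr => ?_,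
    fun x hx y v hy hv => ?_⟩
  · have h1 := hF.homog (e.symm x) (mfderiv (𝓡 n) (𝓡 n) e.symm x y) r hr
    exact (congrArg (F (e.symm x)) (map_smul (mfderiv (𝓡 n) (𝓡 n) e.symm x) r y)).trans h1
  · have h1 := hF.posDef (e.symm x) _ _ (hne x hx y hy) (hne x hx v hv)
    have h2 : ContDiffAt ℝ 2 (energy (coordMetric F e) x) y := by
      have h3 : (x, y) ∈ e.target ×ˢ ({0}ᶜ : Set (Vec n)) := ⟨hx, hy⟩
      have h4 := hs.contDiffAt ((e.open_target.prod isOpen_compl_singleton).mem_nhds h3)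
      have h5 : ContDiffAt ℝ ∞ (fun z => coordMetric F e x z) y :=
        h4.comp (f := fun z => (x, z)) y (by fun_prop)
      exact (h5.pow 2).of_le (by norm_cast)
    rw [← deriv_deriv_add_smul h2 v]
    have h3 : ∀ s t : ℝ, energy (coordMetric F e) x (y + s • v + t • v)
        = F (e.symm x) (mfderiv (𝓡 n) (𝓡 n) e.symm x y + s • mfderiv (𝓡 n) (𝓡 n) e.symm x v
          + t • mfderiv (𝓡 n) (𝓡 n) e.symm x v) ^ 2 := fun s t => by
      have h4 : mfderiv (𝓡 n) (𝓡 n) e.symm x (y + s • v + t • v)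
          = mfderiv (𝓡 n) (𝓡 n) e.symm x y + s • mfderiv (𝓡 n) (𝓡 n) e.symm x v
          + t • mfderiv (𝓡 n) (𝓡 n) e.symm x v := by
        erw [map_add, map_add, map_smul, map_smul]
      exact congrArg (fun w => F (e.symm x) w ^ 2) h4
    simp only [h3]
    linarith

omit [IsManifold (𝓡 n) ∞ M] in
theorem isRiemannianAt_of_coordMetric {F : (x : M) → TangentSpace (𝓡 n) x → ℝ}
    {e : OpenPartialHomeomorph M (Vec n)} (hd : e.MDifferentiable (𝓡 n) (𝓡 n)) {u : Vec n}
    (hu : u ∈ e.target) {B : Vec n →L[ℝ] Vec n →L[ℝ] ℝ}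
    (hB : ∀ y, coordMetric F e u y ^ 2 = B y y) : IsRiemannianAt F (e.symm u) := by
  let T : TangentSpace (𝓡 n) (e.symm u) →L[ℝ] Vec n := mfderiv (𝓡 n) (𝓡 n) e (e.symm u)
  refine ⟨LinearMap.mk₂ ℝ (fun v w => B (T v) (T w)) (by simp) (by simp) (by simp) (by simp),
    fun v => ?_⟩
  obtain ⟨y, rfl⟩ := hd.symm.mfderiv_surjective hu v
  have h1 : T (mfderiv (𝓡 n) (𝓡 n) e.symm u y) = y :=
    congrArg (fun S : Vec n →L[ℝ] Vec n => S y) (hd.comp_symm_deriv hu)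
  exact (hB y).trans (by rw [LinearMap.mk₂_apply, h1])

end Finsler

end

theorem theorem5p1 (n : ℕ) (hn : 2 ≤ n) {M : Type*} [TopologicalSpace M]
    [ChartedSpace (EuclideanSpace ℝ (Fin n)) M] [IsManifold (𝓡 n) ∞ M] [ConnectedSpace M]
    (a : Bundle.ContMDiffRiemannianMetric (𝓡 n) ∞ (EuclideanSpace ℝ (Fin n))
      (fun x : M => TangentSpace (𝓡 n) x))
    (β : (x : M) → TangentSpace (𝓡 n) x →L[ℝ] ℝ) (φ : ℝ → ℝ) (b₀ : EReal)
    (hF : Finsler.IsAlphaBetaMetric a β φ b₀) (hφ : φ 0 = 1)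
    (hnonRiem : Finsler.IsNonRiemannian (Finsler.alphaBeta a β φ))
    (hS : Finsler.HasIsotropicSCurvature (Finsler.alphaBeta a β φ))
    (V : (x : M) → TangentSpace (𝓡 n) x)
    (hVsmooth : ContMDiff (𝓡 n) (𝓡 n).tangent ∞
      (fun x => (⟨x, V x⟩ : TangentBundle (𝓡 n) M)))
    (hV : Finsler.IsConformal (Finsler.alphaBeta a β φ) V) :
    Finsler.IsHomothetic (Finsler.alphaBeta a β φ) V := by
  obtain ⟨θ, hθ⟩ := hS
  obtain ⟨c, hc⟩ := hV
  have : IsManifold (𝓡 n) 1 M := IsManifold.of_le (n := ∞) (by simp)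
  have hloc : IsLocallyConstant c := by
    refine (IsLocallyConstant.iff_eventually_eq c).2 fun x => ?_
    let e := chartAt (EuclideanSpace ℝ (Fin n)) x
    have he : e ∈ IsManifold.maximalAtlas (𝓡 n) ∞ M := IsManifold.chart_mem_maximalAtlas x
    have hd : e.MDifferentiable (𝓡 n) (𝓡 n) := mdifferentiable_chart x
    obtain ⟨hcs, hB⟩ := (hF.finsler.isFinslerOn he hd).exists_bilinear_of_conformal hn
      (Finsler.contDiffOn_coordField hVsmooth he) (θ := θ ∘ e.symm) (c := c ∘ e.symm)
      (hθ e he) (hc e he)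
    have hzero : ∀ u ∈ e.target, fderiv ℝ (c ∘ e.symm) u = 0 := by
      -- Otherwise `F` would be Riemannian on the nonempty open set where `dc ≠ 0`.
      by_contra! ⟨u, hu, hne⟩
      have hO : IsOpen (e.target ∩ fderiv ℝ (c ∘ e.symm) ⁻¹' {0}ᶜ) :=
        (hcs.continuousOn_fderiv_of_isOpen e.open_target (by simp)).isOpen_inter_preimage
          e.open_target isOpen_compl_singleton
      refine hnonRiem _ (e.symm.isOpen_image_of_subset_source hO Set.inter_subset_left)
        ⟨_, u, ⟨hu, hne⟩, rfl⟩ ?_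
      rintro _ ⟨w, ⟨hw, hwne⟩, rfl⟩
      obtain ⟨B, hB⟩ := hB w hw hwne
      exact Finsler.isRiemannianAt_of_coordMetric hd hw hB
    obtain ⟨r, hr, hball⟩ := Metric.isOpen_iff.1 e.open_target (e x) (mem_chart_target _ x)
    have hconst : ∀ u ∈ Metric.ball (e x) r, (c ∘ e.symm) u = (c ∘ e.symm) (e x) := fun u hu =>
      Metric.isOpen_ball.is_const_of_fderiv_eq_zero
        (convex_ball (e x) r).isPreconnected
        ((hcs.differentiableOn (by simp)).mono hball) (fun w hw => hzero w (hball hw)) hu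
        (Metric.mem_ball_self hr)
    have h1 := (e.continuousAt (mem_chart_source _ x)).eventually (Metric.ball_mem_nhds _ hr)
    filter_upwards [h1, e.open_source.mem_nhds (mem_chart_source _ x)] with z hz hzs
    have h2 := hconst _ hz
    simp only [Function.comp_apply] at h2
    rwa [e.left_inv hzs, e.left_inv (mem_chart_source _ x)] at h2
  obtain ⟨x₀⟩ : Nonempty M := inferInstance
  refine ⟨c x₀, ?_⟩
  rwa [show (fun _ => c x₀) = c from funext fun x => hloc.apply_eq_of_preconnectedSpace x₀ x]
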